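/- Let $(M,\eta,g,\phi)$ be a nonempty contact metric manifold of dimension $2n+1\ge 3$ with Reeb vector field $\xi$: here $\eta$ is a contact form, $\eta(\xi)=1$, $d\eta(\xi,\cdot)=0$, $g(X,\xi)=\eta(X)$, $\phi^2=-I+\eta\otimes\xi$ and $d\eta(X,Y)=g(X,\phi Y)$, with the normalization $2\,d\eta(X,Y)=X\eta(Y)-Y\eta(X)-\eta([X,Y])$. Put $h=\tfrac12\mathcal L_\xi\phi$. $M$ is called a $(\kappa,\mu)$-manifold, for constants $\kappa,\mu\in\mathbb R$, if its curvature tensor satisfies $R(X,Y)\xi=(\kappa I+\mu h)(\eta(Y)X-\eta(X)Y)$ for all vector fields $X,Y$ on $M$, and Sasakian if the almost complex structure $J(X,f\partial_t)=(\phi X-f\xi,\eta(X)\partial_t)$ on $M\times\mathbb R$ is integrable (its Nijenhuis tensor vanishes). For $t\in\mathbb R$ put $\eta_t=e^{2t}\eta$, $\xi_t=e^{-2t}\xi$, $g_t=e^{2t}g+e^{2t}(e^{2t}-1)\,\eta\otimes\eta$. The metric symplectization of $M$ is $M\times\mathbb R$ with the metric $\bar g=g_t+dt^2$; let $\bar R$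 be its curvature tensor and $\mathcal V$ the projection of its tangent vectors to the component tangent to $M$. For $t,\tilde\kappa,\tilde\mu\in\mathbb R$ consider the relation $$\mathcal V\big(\bar R(X,Y)\xi_t\big)=(\tilde\kappa I+\tilde\mu h)\big(\eta_t(Y)X-\eta_t(X)Y\big)\quad\text{on } M\times\{t\},\ \text{for all vector fields } X,Y \text{ on } M.\tag{$*$}$$ 1. $M$ is a $(\kappa,\mu)$-manifold for some $\kappa,\mu\in\mathbb R$ if and only if $(*)$ holds for some $t,\tilde\kappa,\tilde\mu\in\mathbb R$. 2. $M$ is a non-Sasakian $(\kappa,\mu)$-manifold for some $\kappa,\mu\in\mathbb R$ if and only if $(*)$ holds for some $t,\tilde\kappa,\tilde\mu\in\mathbb R$ with $\tilde\kappa\neq-1$. 3. If $(*)$ holds for some $t$ with constants $\tilde\kappa,\tilde\mu$, then for every $s\in\mathbb R$ it holds with $s$ in place of $t$ and suitable constants depending on $s$; if $\tilde\kappa\ne-1$, the constant replacing $\tilde\kappa$ can also be chosen different from $-1$. -/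

import Mathlib

open scoped Manifold ContDiff Bundle

noncomputable section

namespace ContactMetric

section General

variable {E : Type*} [NormedAddCommGroup E] [NormedSpace ℝ E]
  {H : Type*} [TopologicalSpace H] (I : ModelWithCorners ℝ E H)
  {M : Type*} [TopologicalSpace M] [ChartedSpace H M]

/-- A vector field on `M` (no regularity is built in; see `SmoothAt`). -/
abbrev VField : Type _ := (x : M) → TangentSpace I x

variable {I}

/-- The vector field `X` is smooth near `p`.  The tensors below depend only on the germs of
their arguments, so tensorial identities are required for all fields that are smooth near the
point under consideration. -/
def SmoothAt [IsManifold I ∞ M] (X : VField I (M := M)) (p : M) : Prop :=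
  ContMDiffAt I I.tangent ∞ (fun x ↦ (⟨x, X x⟩ : TangentBundle I M)) p

/-- The derivative `X(f)` at `p` of a function `f` along a vector field `X`. -/
def dirDeriv (X : VField I (M := M)) (f : M → ℝ) (p : M) : ℝ :=
  mvfderiv I f p (X p)

/-- The Lie bracket of vector fields. -/
def bracket (X Y : VField I (M := M)) : VField I (M := M) :=
  VectorField.mlieBracket I X Y

/-- The exterior derivative of a `1`-form, in the normalization customary in contact metric
geometry: `2 dη(X, Y) = X(η(Y)) - Y(η(X)) - η([X, Y])`. -/
def dOneForm (η : (x : M) → TangentSpace I x →L[ℝ] ℝ) (X Y : VField I (M := M)) (p : M) : ℝ :=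
  (1 / 2) * (dirDeriv X (fun x ↦ η x (Y x)) p - dirDeriv Y (fun x ↦ η x (X x)) p
    - η p (bracket X Y p))

/-- The right-hand side of the Koszul formula for a field `g` of bilinear forms. -/
def koszul (g : (x : M) → TangentSpace I x → TangentSpace I x → ℝ)
    (X Y Z : VField I (M := M)) (p : M) : ℝ :=
  dirDeriv X (fun x ↦ g x (Y x) (Z x)) p + dirDeriv Y (fun x ↦ g x (Z x) (X x)) p
    - dirDeriv Z (fun x ↦ g x (X x) (Y x)) p
    + g p (bracket X Y p) (Z p) - g p (bracket Y Z p) (X p) + g p (bracket Z X p) (Y p)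

/-- The Levi-Civita connection `∇_X Y` of the Riemannian metric `g`: the vector field
characterized by the Koszul formula. -/
def leviCivita [IsManifold I ∞ M] (g : (x : M) → TangentSpace I x → TangentSpace I x → ℝ)
    (X Y : VField I (M := M)) : VField I (M := M) := fun p ↦
  Classical.epsilon fun v : TangentSpace I p ↦
    ∀ Z : VField I (M := M), SmoothAt Z p → 2 * g p v (Z p) = koszul g X Y Z p

/-- The curvature `R(X, Y) Z = ∇_X ∇_Y Z - ∇_Y ∇_X Z - ∇_[X, Y] Z` of the Levi-Civita
connection of `g`. -/
def curvature [IsManifold I ∞ M] (g : (x : M) → TangentSpace I x → TangentSpace I x → ℝ)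
    (X Y Z : VField I (M := M)) : VField I (M := M) := fun p ↦
  leviCivita g X (leviCivita g Y Z) p - leviCivita g Y (leviCivita g X Z) p
    - leviCivita g (bracket X Y) Z p

/-- The Nijenhuis tensor `J²[X, Y] + [JX, JY] - J[JX, Y] - J[X, JY]`. -/
def nijenhuis (J : (x : M) → TangentSpace I x → TangentSpace I x)
    (X Y : VField I (M := M)) : VField I (M := M) := fun p ↦
  J p (J p (bracket X Y p)) + bracket (fun x ↦ J x (X x)) (fun x ↦ J x (Y x)) p
    - J p (bracket (fun x ↦ J x (X x)) Y p) - J p (bracket X (fun x ↦ J x (Y x)) p)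

end General

/-- The model `ℝ^(2n+1)`. -/
abbrev Model (n : ℕ) : Type := EuclideanSpace ℝ (Fin (2 * n + 1))

section Contact

/-- The tangent space of the `(2n+1)`-manifold `M` at `x`. -/
abbrev Tan (n : ℕ) (M : Type*) [TopologicalSpace M] [ChartedSpace (Model n) M] (x : M) : Type :=
  TangentSpace (𝓡 (2 * n + 1)) x

/-- The tangent space of `M × ℝ` at `x`; it is the product of the tangent spaces of the factors. -/
abbrev TanProd (n : ℕ) (M : Type*) [TopologicalSpace M] [ChartedSpace (Model n) M]
    (x : M × ℝ) : Type :=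
  TangentSpace ((𝓡 (2 * n + 1)).prod 𝓘(ℝ, ℝ)) x

variable (n : ℕ) (M : Type*) [TopologicalSpace M] [ChartedSpace (Model n) M]
  [IsManifold (𝓡 (2 * n + 1)) ∞ M]

/-- A contact metric structure `(η, g, φ)`, with Reeb vector field `ξ`, on a manifold `M` of
dimension `2n+1`. -/
structure ContactMetricStructure where
  /-- the contact form -/
  η : (x : M) → Tan n M x →L[ℝ] ℝ
  /-- the Riemannian metric -/
  g : Bundle.ContMDiffRiemannianMetric (𝓡 (2 * n + 1)) ∞ (Model n) (Tan n M)
  /-- the `(1,1)`-tensor field -/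
  φ : (x : M) → Tan n M x →L[ℝ] Tan n M x
  /-- the Reeb vector field -/
  ξ : (x : M) → Tan n M x
  smooth_η : ContMDiff (𝓡 (2 * n + 1)) ((𝓡 (2 * n + 1)).prod 𝓘(ℝ, Model n →L[ℝ] ℝ)) ∞
    (fun x ↦ Bundle.TotalSpace.mk' (Model n →L[ℝ] ℝ)
      (E := fun x ↦ Tan n M x →L[ℝ] Bundle.Trivial M ℝ x) x (η x))
  smooth_φ : ContMDiff (𝓡 (2 * n + 1)) ((𝓡 (2 * n + 1)).prod 𝓘(ℝ, Model n →L[ℝ] Model n)) ∞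
    (fun x ↦ Bundle.TotalSpace.mk' (Model n →L[ℝ] Model n)
      (E := fun x ↦ Tan n M x →L[ℝ] Tan n M x) x (φ x))
  smooth_ξ : ∀ x, SmoothAt ξ x
  /-- `η ∧ (dη)^n` vanishes nowhere: up to a positive constant, the sum below is the value of
  this form on `X 0, …, X (2n)`. -/
  contact : ∀ p : M, ∃ X : Fin (2 * n + 1) → (x : M) → Tan n M x, (∀ i, SmoothAt (X i) p) ∧
    ∑ σ : Equiv.Perm (Fin (2 * n + 1)), ((Equiv.Perm.sign σ : ℤ) : ℝ) *
      (η p (X (σ 0) p) * ∏ i : Fin n,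
        dOneForm η (X (σ ⟨2 * i + 1, by omega⟩)) (X (σ ⟨2 * i + 2, by omega⟩)) p) ≠ 0
  η_ξ : ∀ p, η p (ξ p) = 1
  dη_ξ : ∀ p (X : (x : M) → Tan n M x), SmoothAt X p → dOneForm η ξ X p = 0
  g_ξ : ∀ p (v : Tan n M p), g.inner p v (ξ p) = η p v
  φ_sq : ∀ p (v : Tan n M p), φ p (φ p v) = -v + η p v • ξ p
  dη_eq : ∀ p (X Y : (x : M) → Tan n M x), SmoothAt X p → SmoothAt Y p →
    dOneForm η X Y p = g.inner p (X p) (φ p (Y p))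

variable {n M}

namespace ContactMetricStructure

variable (S : ContactMetricStructure n M)

/-- The tensor field `h = ½ 𝓛_ξ φ`, that is, `hX = ½ ([ξ, φX] - φ[ξ, X])`. -/
def h (X : (x : M) → Tan n M x) : (x : M) → Tan n M x := fun p ↦
  (1 / 2 : ℝ) • (bracket S.ξ (fun x ↦ S.φ x (X x)) p - S.φ p (bracket S.ξ X p))

/-- The condition `R(X, Y)ξ = (κ I + μ h)(η(Y) X - η(X) Y)` for the constants `κ` and `μ`. -/
def Nullity (κ μ : ℝ) : Prop :=
  ∀ (p : M) (X Y : (x : M) → Tan n M x), SmoothAt X p → SmoothAt Y p →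
    curvature (fun x v w ↦ S.g.inner x v w) X Y S.ξ p
      = κ • (S.η p (Y p) • X p - S.η p (X p) • Y p)
        + μ • S.h (fun x ↦ S.η x (Y x) • X x - S.η x (X x) • Y x) p

/-- `M` is a `(κ, μ)`-manifold for some constants `κ` and `μ`. -/
def IsKappaMu : Prop := ∃ κ μ : ℝ, S.Nullity κ μ

/-- The natural almost complex structure `J(X, f ∂ₜ) = (φX - f ξ, η(X) ∂ₜ)` on the
symplectization `M × ℝ`. -/
def naturalJ (x : M × ℝ) (v : TanProd n M x) : TanProd n M x :=
  ((S.φ x.1 v.1 - (show ℝ from v.2) • S.ξ x.1 : Tan n M x.1), S.η x.1 v.1)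

/-- `M` is Sasakian: the natural almost complex structure on the symplectization is integrable,
that is, its Nijenhuis tensor vanishes. -/
def IsSasakian : Prop :=
  ∀ (x : M × ℝ) (X Y : (x : M × ℝ) → TanProd n M x), SmoothAt X x → SmoothAt Y x →
    nijenhuis S.naturalJ X Y x = 0

/-- The form `η_t = e^{2t} η`. -/
def ηt (t : ℝ) (x : M) (v : Tan n M x) : ℝ := Real.exp (2 * t) * S.η x v

/-- The metric `g_t = e^{2t} g + e^{2t} (e^{2t} - 1) η ⊗ η`. -/
def gt (t : ℝ) (x : M) (v w : Tan n M x) : ℝ :=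
  Real.exp (2 * t) * S.g.inner x v w
    + Real.exp (2 * t) * (Real.exp (2 * t) - 1) * (S.η x v * S.η x w)

/-- The Riemannian metric `g_t + dt²` of the metric symplectization `M × ℝ`. -/
def sympMetric (x : M × ℝ) (v w : TanProd n M x) : ℝ :=
  S.gt x.2 x.1 v.1 w.1 + (show ℝ from v.2) * (show ℝ from w.2)

/-- A vector field on `M`, regarded as a vector field on `M × ℝ`. -/
def lift (X : (x : M) → Tan n M x) : (x : M × ℝ) → TanProd n M x := fun x ↦ (X x.1, (0 : ℝ))

/-- The vector field on `M × ℝ` that is equal to `ξ_t = e^{-2t} ξ` on `M × {t}`. -/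
def ξt : (x : M × ℝ) → TanProd n M x := fun x ↦
  ((Real.exp (-2 * x.2) • S.ξ x.1 : Tan n M x.1), (0 : ℝ))

/-- The relation `𝒱(R̄(X, Y) ξ_t) = (κ I + μ h)(η_t(Y) X - η_t(X) Y)` along the slice `M × {t}` of
the metric symplectization, for all vector fields `X`, `Y` on `M`; `𝒱` is the component
tangent to `M`. -/
def SympNullity (t κ μ : ℝ) : Prop :=
  ∀ (p : M) (X Y : (x : M) → Tan n M x), SmoothAt X p → SmoothAt Y p →
    (curvature S.sympMetric (lift X) (lift Y) S.ξt (p, t)).1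
      = κ • (S.ηt t p (Y p) • X p - S.ηt t p (X p) • Y p)
        + μ • S.h (fun x ↦ S.ηt t x (Y x) • X x - S.ηt t x (X x) • Y x) p

end ContactMetricStructure

end Contact

end ContactMetric

end

/-! One has ∇_X ξ = -φX - TX, where T is g-symmetric, kills ξ and anticommutes with φ; moreover h =
Tφ. Put F = ∇φ and G = ∇T. Then R(X,Y)ξ is the alternation of -F - G in X, Y (`curvature_ξ`). The
Koszul formula for g_t + dt² shows that the tangential part of R̄(X,Y)ξ_t is the alternation of -F -
e^{-2t}G, up to multiples of w and Tφw, where w = η(Y)X - η(X)Y (`curvature_ξt`). Both nullity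
conditions are therefore instances of one pointwise relation `NullityRel`, with c = 1 on M and c =
e^{-2t} on a slice (`nullity_iff`, `sympNullity_iff`).

The heart of the matter is that this relation for one c ≠ 0 implies it for every other c
(`nullityRel_change`), because it determines F. Setting Y = ξ and separating what commutes with φ
from what anticommutes with it gives cT² = 1 - α on ker η (`T_sq_eq`). Four further instances on ker
η, combined with the almost Kähler type symmetries of F, show that F_{hx} has no component on ker η
(`F_h_horizontal`). If α ≠ 1, then h² = T² is invertible on ker η, so the same is true of every F_x.
If α = 1, then T = 0 everywhere, hence G = 0, and the relation together with dη being closed gives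
the same conclusion. The components of F along ξ are known for every contact metric structure, so F
is given by `F_eq` and its alternation is w + Tφw. The alternation of cG is then (α-1)w + (β-1)Tφw,
and c may be rescaled at will.

Rescaling preserves whether α = 1, and α = 1 characterizes the Sasakian case (`Rel.isSasakian_iff`):
it forces T = 0 and (∇_Xφ)Y = g(X,Y)ξ - η(Y)X, which makes the Nijenhuis tensor vanish, while
conversely N(A, ∂ₜ) = 2hA shows that a Sasakian structure has T = 0. On a slice, α = 1 means exactly
κ̃ = -1 (`coeff_eq_one_iff`). -/

noncomputable section

set_option linter.unusedSectionVars false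

open scoped Topology

namespace ContactMetric

open Set Filter VectorField

/-! ### Vector fields as derivations, computed in charts. -/

section Calculus

variable {E : Type*} [NormedAddCommGroup E] [NormedSpace ℝ E] [FiniteDimensional ℝ E]
  {H : Type*} [TopologicalSpace H] {I : ModelWithCorners ℝ E H} [I.Boundaryless]
  {M : Type*} [TopologicalSpace M] [ChartedSpace H M] [IsManifold I ∞ M]
  {F : Type*} [NormedAddCommGroup F] [NormedSpace ℝ F]

/-- Differentiability of a vector field at a point. -/
def DiffAt (X : VField I (M := M)) (p : M) : Prop :=
  MDifferentiableAt I I.tangent (fun x ↦ (⟨x, X x⟩ : TangentBundle I M)) p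

theorem SmoothAt.diffAt {X : VField I (M := M)} {p : M} (h : SmoothAt X p) : DiffAt X p :=
  ContMDiffAt.mdifferentiableAt h (by simp)

theorem SmoothAt.eventually_diffAt {X : VField I (M := M)} {p : M} (h : SmoothAt X p) :
    ∀ᶠ x in 𝓝 p, DiffAt X x := by
  have h1 : ContMDiffAt I I.tangent 1 (fun x ↦ (⟨x, X x⟩ : TangentBundle I M)) p :=
    ContMDiffAt.of_le h (by simp)
  filter_upwards [(contMDiffAt_iff_contMDiffAt_nhds (by simp)).1 h1] with x hx
  exact ContMDiffAt.mdifferentiableAt hx one_ne_zero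

/-- The vector field `X` read in the preferred chart at `p`. -/
def chartField (p : M) (X : VField I (M := M)) : E → E :=
  mpullbackWithin 𝓘(ℝ, E) I (extChartAt I p).symm X (range I)

theorem chartField_self (p : M) (X : VField I (M := M)) :
    chartField p X (extChartAt I p p) = X p := by
  have := mfderivWithin_extChartAt_symm_inverse_apply (I := I) (x := p)
    (X ((extChartAt I p).symm (extChartAt I p p)))
  rw [extChartAt_to_inv] at this
  unfold chartField
  rw [mpullbackWithin_apply, extChartAt_to_inv]
  exact this

theorem DiffAt.differentiableAt_chartField {X : VField I (M := M)} {p : M} (h : DiffAt X p) :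
    DifferentiableAt ℝ (chartField p X) (extChartAt I p p) := by
  have h' := MDifferentiableWithinAt.differentiableWithinAt_mpullbackWithin_vectorField
    (s := univ) (mdifferentiableWithinAt_univ.2 h)
  change DifferentiableWithinAt ℝ (chartField p X) _ _ at h'
  rwa [I.range_eq_univ, preimage_univ, inter_univ, differentiableWithinAt_univ] at h'

/-- The preferred chart at `p` has the identity as its derivative at `p`, so no pushforward
survives. -/
theorem bracket_eq_chart (X Y : VField I (M := M)) (p : M) :
    bracket X Y p = lieBracket ℝ (chartField p X) (chartField p Y) (extChartAt I p p) := by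
  have h1 : (extChartAt I p).symm ⁻¹' univ ∩ range I = univ := by simp [I.range_eq_univ]
  have h := mlieBracketWithin_apply (I := I) (V := X) (W := Y) (s := univ) (x₀ := p)
  have h2 : (mfderiv I 𝓘(ℝ, E) (extChartAt I p) p).inverse = ContinuousLinearMap.id ℝ E := by
    rw [mfderiv_extChartAt_self]
    exact ContinuousLinearMap.inverse_id
  rw [h1] at h
  refine h.trans ?_
  change ((mfderiv I 𝓘(ℝ, E) (extChartAt I p) p).inverse : E →L[ℝ] E)
    (lieBracketWithin ℝ (E := E) (chartField p X) (chartField p Y) univ _) = _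
  rw [h2, lieBracketWithin_univ]
  rfl

theorem fderiv_chart {f : M → F} {p : M} {y : E} (hy : y ∈ (extChartAt I p).target)
    (hf : MDifferentiableAt I 𝓘(ℝ, F) f ((extChartAt I p).symm y)) (X : VField I (M := M)) :
    fderiv ℝ (f ∘ (extChartAt I p).symm) y (chartField p X y)
      = mvfderiv I f ((extChartAt I p).symm y) (X ((extChartAt I p).symm y)) := by
  have h1 : MDifferentiableWithinAt 𝓘(ℝ, E) I (extChartAt I p).symm (range I) y :=
    mdifferentiableWithinAt_extChartAt_symm hy
  have h2 := mfderiv_comp_mfderivWithin (I := 𝓘(ℝ, E)) (I' := I) (I'' := 𝓘(ℝ, F)) (s := range I)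
    (x := y) (f := (extChartAt I p).symm) (g := f) hf h1 (by
      rw [I.range_eq_univ]; exact uniqueMDiffWithinAt_univ _)
  have h3 := isInvertible_mfderivWithin_extChartAt_symm hy
  have h4 : mfderivWithin 𝓘(ℝ, E) 𝓘(ℝ, F) (f ∘ (extChartAt I p).symm) (range I) y
      = fderiv ℝ (f ∘ (extChartAt I p).symm) y := by
    rw [I.range_eq_univ, mfderivWithin_univ, mfderiv_eq_fderiv]
  rw [← h4, h2]
  unfold chartField mvfderiv
  rw [mpullbackWithin_apply]
  have h5 := h3.self_apply_inverse (X ((extChartAt I p).symm y))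
  change (mfderiv I 𝓘(ℝ, F) f ((extChartAt I p).symm y)) ((mfderivWithin 𝓘(ℝ, E) I (extChartAt I p).symm (range I) y)
    ((mfderivWithin 𝓘(ℝ, E) I (extChartAt I p).symm (range I) y).inverse _)) = _
  rw [h5]
  rfl

/-- Equality of germs is needed because the derivative Xf is about to be differentiated again. -/
theorem eventually_fderiv_chart {f : M → F} {p : M} (hf : ContMDiffAt I 𝓘(ℝ, F) 2 f p)
    (X : VField I (M := M)) :
    (fun x ↦ mvfderiv I f x (X x)) ∘ (extChartAt I p).symm =ᶠ[𝓝 (extChartAt I p p)]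
      fun y ↦ fderiv ℝ (f ∘ (extChartAt I p).symm) y (chartField p X y) := by
  have h1 : ∀ᶠ x in 𝓝 p, MDifferentiableAt I 𝓘(ℝ, F) f x := by
    filter_upwards [(contMDiffAt_iff_contMDiffAt_nhds (by simp)).1 hf] with x hx
    exact hx.mdifferentiableAt two_ne_zero
  have h2 : Tendsto (extChartAt I p).symm (𝓝 (extChartAt I p p)) (𝓝 p) := by
    have := (continuousAt_extChartAt_symm (I := I) p).tendsto
    rwa [extChartAt_to_inv] at this
  filter_upwards [h2.eventually h1, extChartAt_target_mem_nhds (I := I) p] with y hy hy'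
  exact (fderiv_chart hy' hy X).symm

theorem contDiffAt_chart {f : M → F} {p : M} {n : WithTop ℕ∞} (hf : ContMDiffAt I 𝓘(ℝ, F) n f p) :
    ContDiffAt ℝ n (f ∘ (extChartAt I p).symm) (extChartAt I p p) := by
  have := (contMDiffAt_iff.1 hf).2
  rw [I.range_eq_univ, contDiffWithinAt_univ] at this
  exact this

theorem differentiableAt_fderiv_chart {f : M → F} {p : M} (hf : ContMDiffAt I 𝓘(ℝ, F) 2 f p)
    {X : VField I (M := M)} (hX : DiffAt X p) :
    DifferentiableAt ℝ (fun y ↦ fderiv ℝ (f ∘ (extChartAt I p).symm) y (chartField p X y))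
      (extChartAt I p p) :=
  (((contDiffAt_chart hf).fderiv_right (m := 1) (by norm_num)).differentiableAt
    one_ne_zero).clm_apply hX.differentiableAt_chartField

theorem mdifferentiableAt_mvfderiv {f : M → F} {p : M} (hf : ContMDiffAt I 𝓘(ℝ, F) 2 f p)
    {X : VField I (M := M)} (hX : DiffAt X p) :
    MDifferentiableAt I 𝓘(ℝ, F) (fun x ↦ mvfderiv I f x (X x)) p := by
  have h1 := (differentiableAt_fderiv_chart hf hX).mdifferentiableAt.comp p
    (mdifferentiableAt_extChartAt (I := I) (mem_chart_source H p))
  refine h1.congr_of_eventuallyEq ?_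
  have h2 := (continuousAt_extChartAt (I := I) p).tendsto.eventually (eventually_fderiv_chart hf X)
  filter_upwards [h2, extChartAt_source_mem_nhds (I := I) p] with x hx hx'
  simp only [Function.comp_apply] at hx ⊢
  rw [← hx, (extChartAt I p).left_inv hx']

/-- Product rule in the chart. The Hessian term is symmetric in the two fields, so the commutator of
X and Y retains only the first-order term, which is the derivative along the bracket. -/
theorem mvfderiv_mvfderiv {f : M → F} {p : M} (hf : ContMDiffAt I 𝓘(ℝ, F) 2 f p)
    (X : VField I (M := M)) {Y : VField I (M := M)} (hY : DiffAt Y p) :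
    mvfderiv I (fun x ↦ mvfderiv I f x (Y x)) p (X p)
      = fderiv ℝ (fderiv ℝ (f ∘ (extChartAt I p).symm)) (extChartAt I p p) (X p) (Y p)
        + fderiv ℝ (f ∘ (extChartAt I p).symm) (extChartAt I p p)
          (fderiv ℝ (chartField p Y) (extChartAt I p p) (X p)) := by
  have h1 := fderiv_chart (f := fun x ↦ mvfderiv I f x (Y x)) (mem_extChartAt_target (I := I) p)
    (by rw [extChartAt_to_inv]; exact mdifferentiableAt_mvfderiv hf hY) X
  rw [(eventually_fderiv_chart hf Y).fderiv_eq, chartField_self] at h1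
  rw [extChartAt_to_inv] at h1
  rw [← h1]
  have h2 : DifferentiableAt ℝ (fderiv ℝ (f ∘ (extChartAt I p).symm)) (extChartAt I p p) :=
    ((contDiffAt_chart hf).fderiv_right (m := 1) (by norm_num)).differentiableAt one_ne_zero
  have key (v : E) : fderiv ℝ (fun y ↦ fderiv ℝ (f ∘ (extChartAt I p).symm) y (chartField p Y y))
      (extChartAt I p p) v
      = fderiv ℝ (fderiv ℝ (f ∘ (extChartAt I p).symm)) (extChartAt I p p) v
          (chartField p Y (extChartAt I p p))
        + fderiv ℝ (f ∘ (extChartAt I p).symm) (extChartAt I p p)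
          (fderiv ℝ (chartField p Y) (extChartAt I p p) v) := by
    rw [fderiv_clm_apply h2 hY.differentiableAt_chartField]
    simp [add_comm]
  refine (key (X p)).trans ?_
  rw [chartField_self]

/-- Vector fields act on functions as derivations, and the Lie bracket as their commutator. -/
theorem mvfderiv_bracket {f : M → F} {p : M} (hf : ContMDiffAt I 𝓘(ℝ, F) 2 f p)
    {X Y : VField I (M := M)} (hX : DiffAt X p) (hY : DiffAt Y p) :
    mvfderiv I f p (bracket X Y p)
      = mvfderiv I (fun x ↦ mvfderiv I f x (Y x)) p (X p)
        - mvfderiv I (fun x ↦ mvfderiv I f x (X x)) p (Y p) := by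
  rw [mvfderiv_mvfderiv hf X hY, mvfderiv_mvfderiv hf Y hX]
  have h1 := fderiv_chart (f := f) (mem_extChartAt_target (I := I) p)
    (by rw [extChartAt_to_inv]; exact hf.mdifferentiableAt two_ne_zero) (bracket X Y)
  rw [chartField_self] at h1
  rw [extChartAt_to_inv] at h1
  rw [← h1, bracket_eq_chart, lieBracket_eq]
  have h3 := (contDiffAt_chart hf).isSymmSndFDerivAt (by simp [minSmoothness_of_isRCLikeNormedField])
  have h4 : ((fderiv ℝ (fderiv ℝ (f ∘ (extChartAt I p).symm)) (extChartAt I p p)) (X p)) (Y p)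
    = ((fderiv ℝ (fderiv ℝ (f ∘ (extChartAt I p).symm)) (extChartAt I p p)) (Y p)) (X p) :=
    h3 (X p) (Y p)
  simp only [map_sub, chartField_self]
  rw [h4]
  abel

end Calculus

/-! ### Differentiable fields, directional derivatives and brackets. -/

section Fields

variable {E : Type*} [NormedAddCommGroup E] [NormedSpace ℝ E] [FiniteDimensional ℝ E]
  {H : Type*} [TopologicalSpace H] {I : ModelWithCorners ℝ E H} [I.Boundaryless]
  {M : Type*} [TopologicalSpace M] [ChartedSpace H M] [IsManifold I ∞ M]

theorem DiffAt.add {X Y : VField I (M := M)} {p : M} (hX : DiffAt X p) (hY : DiffAt Y p) :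
    DiffAt (X + Y) p :=
  mdifferentiableAt_add_section hX hY

theorem DiffAt.smul {X : VField I (M := M)} {f : M → ℝ} {p : M}
    (hf : MDifferentiableAt I 𝓘(ℝ, ℝ) f p) (hX : DiffAt X p) : DiffAt (fun x ↦ f x • X x) p :=
  MDifferentiableAt.smul_section hf hX

theorem DiffAt.const_smul {X : VField I (M := M)} {p : M} (c : ℝ) (hX : DiffAt X p) :
    DiffAt (fun x ↦ c • X x) p :=
  DiffAt.smul mdifferentiableAt_const hX

theorem DiffAt.neg {X : VField I (M := M)} {p : M} (hX : DiffAt X p) :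
    DiffAt (fun x ↦ -X x) p := by
  simpa using hX.const_smul (-1)

theorem DiffAt.sub {X Y : VField I (M := M)} {p : M} (hX : DiffAt X p) (hY : DiffAt Y p) :
    DiffAt (fun x ↦ X x - Y x) p := by
  simpa [sub_eq_add_neg] using! hX.add hY.neg

theorem DiffAt.congr {X Y : VField I (M := M)} {p : M} (hX : DiffAt X p) (h : Y =ᶠ[𝓝 p] X) :
    DiffAt Y p :=
  MDifferentiableAt.congr_of_eventuallyEq hX (h.mono fun x hx ↦ by simp [hx])

theorem SmoothAt.bracket {X Y : VField I (M := M)} {p : M} (hX : SmoothAt X p)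
    (hY : SmoothAt Y p) : SmoothAt (bracket X Y) p := by
  have : IsManifold I ((⊤ : ℕ∞) + 1) M := by simpa using! (inferInstance : IsManifold I ∞ M)
  have : IsManifold I (minSmoothness ℝ 2) M := by
    rw [minSmoothness_of_isRCLikeNormedField]; infer_instance
  exact ContMDiffAt.mlieBracket_vectorField (n := ⊤) (m := ⊤) hX hY
    (by simp [minSmoothness_of_isRCLikeNormedField])

/-- A vector field which is smooth near `p` and takes the value `v` at `p`. -/
def extend {p : M} (v : TangentSpace I p) : VField I (M := M) :=
  FiberBundle.extend E v

@[simp] theorem extend_self {p : M} (v : TangentSpace I p) : extend v p = v :=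
  FiberBundle.extend_apply_self E v

theorem smoothAt_extend {p : M} (v : TangentSpace I p) : SmoothAt (extend v) p :=
  FiberBundle.contMDiffAt_extend I E v

theorem diffAt_extend {p : M} (v : TangentSpace I p) : DiffAt (extend v) p :=
  (smoothAt_extend v).diffAt

theorem dirDeriv_add {X : VField I (M := M)} {f g : M → ℝ} {p : M}
    (hf : MDifferentiableAt I 𝓘(ℝ, ℝ) f p) (hg : MDifferentiableAt I 𝓘(ℝ, ℝ) g p) :
    dirDeriv X (fun x ↦ f x + g x) p = dirDeriv X f p + dirDeriv X g p := by
  have := mvfderiv_add hf hg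
  exact congrArg (fun L ↦ L (X p)) this

theorem dirDeriv_sub {X : VField I (M := M)} {f g : M → ℝ} {p : M}
    (hf : MDifferentiableAt I 𝓘(ℝ, ℝ) f p) (hg : MDifferentiableAt I 𝓘(ℝ, ℝ) g p) :
    dirDeriv X (fun x ↦ f x - g x) p = dirDeriv X f p - dirDeriv X g p := by
  have := mvfderiv_sub hf hg
  exact congrArg (fun L ↦ L (X p)) this

theorem dirDeriv_mul {X : VField I (M := M)} {f g : M → ℝ} {p : M}
    (hf : MDifferentiableAt I 𝓘(ℝ, ℝ) f p) (hg : MDifferentiableAt I 𝓘(ℝ, ℝ) g p) :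
    dirDeriv X (fun x ↦ f x * g x) p = f p * dirDeriv X g p + dirDeriv X f p * g p := by
  have := congrArg (fun L ↦ L (X p)) (mvfderiv_mul hf hg)
  refine this.trans ?_
  simp [dirDeriv, mul_comm]

@[simp] theorem dirDeriv_const {X : VField I (M := M)} (c : ℝ) {p : M} :
    dirDeriv X (fun _ ↦ c) p = 0 := by
  simp [dirDeriv, mvfderiv_const]

theorem dirDeriv_congr {X : VField I (M := M)} {f g : M → ℝ} {p : M} (h : f =ᶠ[𝓝 p] g) :
    dirDeriv X f p = dirDeriv X g p := by
  unfold dirDeriv mvfderiv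
  rw [h.mfderiv_eq, h.eq_of_nhds]

theorem dirDeriv_bracket {f : M → ℝ} {p : M} (hf : ContMDiffAt I 𝓘(ℝ, ℝ) 2 f p)
    {X Y : VField I (M := M)} (hX : DiffAt X p) (hY : DiffAt Y p) :
    dirDeriv (bracket X Y) f p = dirDeriv X (dirDeriv Y f) p - dirDeriv Y (dirDeriv X f) p :=
  mvfderiv_bracket hf hX hY

theorem bracket_swap (X Y : VField I (M := M)) (p : M) : bracket X Y p = -bracket Y X p :=
  mlieBracket_swap_apply

theorem bracket_add_right {X Y Z : VField I (M := M)} {p : M} (hY : DiffAt Y p)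
    (hZ : DiffAt Z p) : bracket X (Y + Z) p = bracket X Y p + bracket X Z p :=
  mlieBracket_add_right hY hZ

theorem bracket_add_left {X Y Z : VField I (M := M)} {p : M} (hX : DiffAt X p)
    (hY : DiffAt Y p) : bracket (X + Y) Z p = bracket X Z p + bracket Y Z p :=
  mlieBracket_add_left hX hY

theorem bracket_smul_right {X Y : VField I (M := M)} {f : M → ℝ} {p : M}
    (hf : MDifferentiableAt I 𝓘(ℝ, ℝ) f p) (hY : DiffAt Y p) :
    bracket X (fun x ↦ f x • Y x) p = dirDeriv X f p • Y p + f p • bracket X Y p :=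
  mlieBracket_smul_right hf hY

theorem bracket_smul_left {X Y : VField I (M := M)} {f : M → ℝ} {p : M}
    (hf : MDifferentiableAt I 𝓘(ℝ, ℝ) f p) (hX : DiffAt X p) :
    bracket (fun x ↦ f x • X x) Y p = -(dirDeriv Y f p • X p) + f p • bracket X Y p := by
  rw [← neg_smul]
  exact mlieBracket_smul_left hf hX

theorem bracket_congr {X X' Y Y' : VField I (M := M)} {p : M} (hX : X =ᶠ[𝓝 p] X')
    (hY : Y =ᶠ[𝓝 p] Y') : bracket X Y p = bracket X' Y' p :=
  hX.mlieBracket_vectorField_eq hY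

theorem bracket_jacobi {X Y Z : VField I (M := M)} {p : M} (hX : SmoothAt X p)
    (hY : SmoothAt Y p) (hZ : SmoothAt Z p) :
    bracket X (bracket Y Z) p + bracket Y (bracket Z X) p + bracket Z (bracket X Y) p = 0 := by
  have h2 {W : VField I (M := M)} (hW : SmoothAt W p) :
      ContMDiffAt I I.tangent (minSmoothness ℝ 2) (fun x ↦ (⟨x, W x⟩ : TangentBundle I M)) p :=
    ContMDiffAt.of_le hW (by rw [minSmoothness_of_isRCLikeNormedField]; exact ENat.LEInfty.out)
  have : IsManifold I (minSmoothness ℝ 3) M :=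
    IsManifold.of_le (n := ∞) (by rw [minSmoothness_of_isRCLikeNormedField]; exact ENat.LEInfty.out)
  have h := leibniz_identity_mlieBracket_apply (h2 hX) (h2 hY) (h2 hZ)
  have e1 : bracket Z (bracket X Y) p = -bracket (bracket X Y) Z p := bracket_swap _ _ _
  have e2 : bracket Y (bracket Z X) p = -bracket Y (bracket X Z) p := by
    have h3 : bracket Z X = fun x ↦ (-1 : ℝ) • bracket X Z x := by
      funext x; rw [bracket_swap]; simp
    rw [h3, bracket_smul_right mdifferentiableAt_const (hX.bracket hZ).diffAt]
    simp
  rw [e1, e2]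
  change bracket X (bracket Y Z) p = bracket (bracket X Y) Z p + bracket Y (bracket X Z) p at h
  rw [h]
  abel

end Fields

/-! ### Brackets of related vector fields. -/

section Related

variable {E : Type*} [NormedAddCommGroup E] [NormedSpace ℝ E] [FiniteDimensional ℝ E]
  {H : Type*} [TopologicalSpace H] {I : ModelWithCorners ℝ E H} [I.Boundaryless]
  {M : Type*} [TopologicalSpace M] [ChartedSpace H M] [IsManifold I ∞ M]
  {E' : Type*} [NormedAddCommGroup E'] [NormedSpace ℝ E'] [FiniteDimensional ℝ E']
  {H' : Type*} [TopologicalSpace H'] {I' : ModelWithCorners ℝ E' H'} [I'.Boundaryless]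
  {M' : Type*} [TopologicalSpace M'] [ChartedSpace H' M'] [IsManifold I' ∞ M']

theorem mvfderiv_congr {V : Type*} [NormedAddCommGroup V] [NormedSpace ℝ V] {f g : M → V} {x : M}
    (h : f =ᶠ[𝓝 x] g) : mvfderiv I f x = mvfderiv I g x := by
  unfold mvfderiv
  rw [h.mfderiv_eq, h.eq_of_nhds]

theorem mvfderiv_comp_mfderiv {V : Type*} [NormedAddCommGroup V] [NormedSpace ℝ V] {F : M → M'}
    {f : M' → V} {x : M} (hf : MDifferentiableAt I' 𝓘(ℝ, V) f (F x))
    (hF : MDifferentiableAt I I' F x) (v : TangentSpace I x) :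
    mvfderiv I (f ∘ F) x v = mvfderiv I' f (F x) (mfderiv I I' F x v) :=
  mfderiv_comp_apply x hf hF v

/-- The Lie bracket is natural with respect to related vector fields. -/
theorem mfderiv_bracket_of_related {F : M → M'} (hF : ContMDiff I I' ∞ F)
    {X Y : VField I (M := M)} {X' Y' : VField I' (M := M')}
    (hX : ∀ x, mfderiv I I' F x (X x) = X' (F x)) (hY : ∀ x, mfderiv I I' F x (Y x) = Y' (F x))
    {p : M} (dX : DiffAt X p) (dY : DiffAt Y p) (dX' : DiffAt X' (F p)) (dY' : DiffAt Y' (F p)) :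
    mfderiv I I' F p (bracket X Y p) = bracket X' Y' (F p) := by
  -- A chart serves as a single vector-valued test function: its derivative at `F p` is injective,
  -- so two tangent vectors there agree as soon as they act equally on it.
  set f : M' → E' := ⇑(extChartAt I' (F p)) with hf_def
  have hf : ContMDiffAt I' 𝓘(ℝ, E') 2 f (F p) := contMDiffAt_extChartAt
  have hfF : ContMDiffAt I 𝓘(ℝ, E') 2 (f ∘ F) p :=
    hf.comp p (hF.contMDiffAt.of_le ENat.LEInfty.out)
  have key {Z : VField I (M := M)} {Z' : VField I' (M := M')}
      (hZ : ∀ x, mfderiv I I' F x (Z x) = Z' (F x)) :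
      (fun x ↦ mvfderiv I (f ∘ F) x (Z x)) =ᶠ[𝓝 p] (fun y ↦ mvfderiv I' f y (Z' y)) ∘ F := by
    have h1 : ∀ᶠ y in 𝓝 (F p), MDifferentiableAt I' 𝓘(ℝ, E') f y := by
      filter_upwards [(contMDiffAt_iff_contMDiffAt_nhds (by simp)).1 hf] with x hx
      exact hx.mdifferentiableAt two_ne_zero
    filter_upwards [hF.continuous.continuousAt.eventually h1] with x hx
    rw [mvfderiv_comp_mfderiv hx (hF.mdifferentiableAt (by simp)), hZ]
    rfl
  have key2 {Z W : VField I (M := M)} {Z' W' : VField I' (M := M')} (dW' : DiffAt W' (F p))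
      (hZ : ∀ x, mfderiv I I' F x (Z x) = Z' (F x))
      (hW : ∀ x, mfderiv I I' F x (W x) = W' (F x)) :
      mvfderiv I (fun x ↦ mvfderiv I (f ∘ F) x (W x)) p (Z p)
        = mvfderiv I' (fun y ↦ mvfderiv I' f y (W' y)) (F p) (Z' (F p)) := by
    rw [mvfderiv_congr (key hW), mvfderiv_comp_mfderiv (mdifferentiableAt_mvfderiv hf dW')
      (hF.mdifferentiableAt (by simp)), hZ]
  have h1 := mvfderiv_bracket hfF dX dY
  rw [key2 dY' hX hY, key2 dX' hY hX, ← mvfderiv_bracket hf dX' dY',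
    mvfderiv_comp_mfderiv (hf.mdifferentiableAt two_ne_zero) (hF.mdifferentiableAt (by simp))] at h1
  have h2 : Function.Injective (mfderiv I' 𝓘(ℝ, E') f (F p)) :=
    (isInvertible_mfderiv_extChartAt (mem_extChartAt_source (F p))).injective
  exact h2 h1

end Related

/-! ### The Levi-Civita connection from the Koszul formula. -/

section LeviCivita

variable {E : Type*} [NormedAddCommGroup E] [NormedSpace ℝ E] [FiniteDimensional ℝ E]
  {H : Type*} [TopologicalSpace H] {I : ModelWithCorners ℝ E H} [I.Boundaryless]
  {M : Type*} [TopologicalSpace M] [ChartedSpace H M] [IsManifold I ∞ M]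

/-- `g` is a differentiable Riemannian metric. -/
structure IsRiemannian (g : (x : M) → TangentSpace I x → TangentSpace I x → ℝ) : Prop where
  add_left : ∀ x u v w, g x (u + v) w = g x u w + g x v w
  smul_left : ∀ x (c : ℝ) u v, g x (c • u) v = c * g x u v
  symm : ∀ x u v, g x u v = g x v u
  pos : ∀ x v, v ≠ 0 → 0 < g x v v
  mdiff : ∀ {X Y : VField I (M := M)} {p : M}, DiffAt X p → DiffAt Y p →
    MDifferentiableAt I 𝓘(ℝ, ℝ) (fun x ↦ g x (X x) (Y x)) p

variable {g : (x : M) → TangentSpace I x → TangentSpace I x → ℝ}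

namespace IsRiemannian

variable (hg : IsRiemannian g)
include hg

theorem add_right (x : M) (u v w : TangentSpace I x) : g x u (v + w) = g x u v + g x u w := by
  rw [hg.symm, hg.add_left, hg.symm, hg.symm x w]

theorem smul_right (x : M) (c : ℝ) (u v : TangentSpace I x) : g x u (c • v) = c * g x u v := by
  rw [hg.symm, hg.smul_left, hg.symm]

theorem neg_left (x : M) (u v : TangentSpace I x) : g x (-u) v = -g x u v := by
  rw [← neg_one_smul ℝ u, hg.smul_left]; ring

theorem sub_left (x : M) (u v w : TangentSpace I x) : g x (u - v) w = g x u w - g x v w := by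
  rw [sub_eq_add_neg, hg.add_left, hg.neg_left]; ring

theorem ext {x : M} {u v : TangentSpace I x} (h : ∀ w, g x u w = g x v w) : u = v := by
  by_contra hne
  have h1 := hg.pos x (u - v) (sub_ne_zero.2 hne)
  rw [hg.sub_left, h, sub_self] at h1
  exact lt_irrefl _ h1

/-- Every linear form on a tangent space is represented by a tangent vector. -/
theorem exists_rep {x : M} (ℓ : TangentSpace I x →ₗ[ℝ] ℝ) :
    ∃ v : TangentSpace I x, ∀ w, g x v w = ℓ w := by
  have : FiniteDimensional ℝ (TangentSpace I x) := inferInstanceAs (FiniteDimensional ℝ E)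
  let B : TangentSpace I x →ₗ[ℝ] Module.Dual ℝ (TangentSpace I x) :=
    LinearMap.mk₂ ℝ (g x) (hg.add_left x) (hg.smul_left x) (hg.add_right x)
      (fun c u v ↦ hg.smul_right x c u v)
  have hB : Function.Injective B := by
    intro u v huv
    exact hg.ext fun w ↦ congrArg (fun L ↦ L w) huv
  have hB' : Function.Surjective B :=
    (LinearMap.injective_iff_surjective_of_finrank_eq_finrank
      (Subspace.dual_finrank_eq (K := ℝ) (V := TangentSpace I x)).symm).1 hB
  obtain ⟨v, hv⟩ := hB' ℓ
  exact ⟨v, fun w ↦ congrArg (fun L ↦ L w) hv⟩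

/-- Replacing Z by fZ, the terms X(f) g(Y,Z) and Y(f) g(Z,X) from the metric derivatives cancel
those from the brackets [fZ,X] and [Y,fZ]. -/
theorem tensorialAt_koszul {X Y : VField I (M := M)} {p : M} (hX : DiffAt X p)
    (hY : DiffAt Y p) : TensorialAt I E (fun Z ↦ koszul g X Y Z p) p where
  smul {f Z} hf hZ := by
    have hZ : DiffAt Z p := hZ
    have e1 : (fun x ↦ g x (Y x) ((f • Z) x)) = fun x ↦ f x * g x (Y x) (Z x) := by
      funext x; exact hg.smul_right x (f x) (Y x) (Z x)
    have e2 : (fun x ↦ g x ((f • Z) x) (X x)) = fun x ↦ f x * g x (Z x) (X x) := by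
      funext x; exact hg.smul_left x (f x) (Z x) (X x)
    have e3 : (f • Z) p = f p • Z p := rfl
    have e4 : bracket Y (f • Z) p = _ := bracket_smul_right hf hZ
    have e5 : bracket (f • Z) X p = _ := bracket_smul_left hf hZ
    have e6 : dirDeriv (f • Z) (fun x ↦ g x (X x) (Y x)) p
        = f p * dirDeriv Z (fun x ↦ g x (X x) (Y x)) p := by
      simp [dirDeriv, e3]
    unfold koszul
    rw [e1, e2, e4, e5, e6, e3, dirDeriv_mul hf (hg.mdiff hY hZ),
      dirDeriv_mul hf (hg.mdiff hZ hX), hg.smul_right, hg.add_left, hg.add_left, hg.neg_left,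
      hg.smul_left, hg.smul_left, hg.smul_left, hg.smul_left, smul_eq_mul, hg.symm p (Z p) (Y p)]
    ring
  add {Z Z'} hZ hZ' := by
    have hZ : DiffAt Z p := hZ
    have hZ' : DiffAt Z' p := hZ'
    have e1 : (fun x ↦ g x (Y x) ((Z + Z') x)) = fun x ↦ g x (Y x) (Z x) + g x (Y x) (Z' x) := by
      funext x; exact hg.add_right x _ _ _
    have e2 : (fun x ↦ g x ((Z + Z') x) (X x)) = fun x ↦ g x (Z x) (X x) + g x (Z' x) (X x) := by
      funext x; exact hg.add_left x _ _ _
    have e3 : (Z + Z') p = Z p + Z' p := rfl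
    have e6 : dirDeriv (Z + Z') (fun x ↦ g x (X x) (Y x)) p
        = dirDeriv Z (fun x ↦ g x (X x) (Y x)) p + dirDeriv Z' (fun x ↦ g x (X x) (Y x)) p := by
      simp [dirDeriv, e3]
    unfold koszul
    rw [e1, e2, e6, e3, bracket_add_right hZ hZ', bracket_add_left hZ hZ',
      dirDeriv_add (hg.mdiff hY hZ) (hg.mdiff hY hZ'),
      dirDeriv_add (hg.mdiff hZ hX) (hg.mdiff hZ' hX), hg.add_right, hg.add_left, hg.add_left]
    ring

/-- This gives the choice in `leviCivita` its meaning: the Koszul expression is a linear form in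
Z(p), and the metric represents it. -/
theorem exists_leviCivita {X Y : VField I (M := M)} {p : M} (hX : DiffAt X p)
    (hY : DiffAt Y p) : ∃ v : TangentSpace I p, ∀ Z : VField I (M := M), SmoothAt Z p →
      2 * g p v (Z p) = koszul g X Y Z p := by
  have hT := hg.tensorialAt_koszul hX hY
  obtain ⟨v, hv⟩ := hg.exists_rep (((1 / 2 : ℝ) • TensorialAt.mkHom _ p hT :
    TangentSpace I p →L[ℝ] ℝ) : TangentSpace I p →ₗ[ℝ] ℝ)
  refine ⟨v, fun Z hZ ↦ ?_⟩
  have h1 := TensorialAt.mkHom_apply hT hZ.diffAt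
  rw [hv, ← h1]
  simp

/-- The Koszul formula. -/
theorem leviCivita_koszul {X Y Z : VField I (M := M)} {p : M} (hX : DiffAt X p)
    (hY : DiffAt Y p) (hZ : DiffAt Z p) :
    2 * g p (leviCivita g X Y p) (Z p) = koszul g X Y Z p := by
  -- The defining property tests smooth fields only. Both sides depend on Z through its value at
  -- `p`, so a smooth extension of `Z p` replaces the merely differentiable Z.
  have h1 := Classical.epsilon_spec (hg.exists_leviCivita hX hY) (extend (Z p)) (smoothAt_extend _)
  rw [extend_self] at h1
  refine h1.trans ?_
  exact (hg.tensorialAt_koszul hX hY).pointwise (diffAt_extend _) hZ (extend_self _)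

/-- The test field Z may be chosen separately for each vector `w`; this freedom allows adapted
fields on the product. -/
theorem leviCivita_unique {X Y : VField I (M := M)} {p : M} (hX : DiffAt X p)
    (hY : DiffAt Y p) {v : TangentSpace I p}
    (hv : ∀ w : TangentSpace I p, ∃ Z : VField I (M := M), DiffAt Z p ∧ Z p = w ∧
      2 * g p v w = koszul g X Y Z p) : leviCivita g X Y p = v := by
  refine hg.ext fun w ↦ ?_
  obtain ⟨Z, hZ, rfl, h⟩ := hv w
  have := hg.leviCivita_koszul hX hY hZ
  linarith

theorem leviCivita_congr {X X' Y Y' : VField I (M := M)} {p : M} (hX : X =ᶠ[𝓝 p] X')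
    (hY : Y =ᶠ[𝓝 p] Y') : leviCivita g X Y p = leviCivita g X' Y' p := by
  unfold leviCivita
  congr 1
  funext v
  have : ∀ Z, koszul g X Y Z p = koszul g X' Y' Z p := by
    intro Z
    unfold koszul
    have e1 : (fun x ↦ g x (Y x) (Z x)) =ᶠ[𝓝 p] fun x ↦ g x (Y' x) (Z x) :=
      hY.mono fun x hx ↦ by simp only [hx]
    have e2 : (fun x ↦ g x (Z x) (X x)) =ᶠ[𝓝 p] fun x ↦ g x (Z x) (X' x) :=
      hX.mono fun x hx ↦ by simp only [hx]
    have e3 : (fun x ↦ g x (X x) (Y x)) =ᶠ[𝓝 p] fun x ↦ g x (X' x) (Y' x) := by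
      filter_upwards [hX, hY] with x hx hy
      simp only [hx, hy]
    rw [dirDeriv_congr e1, dirDeriv_congr e2, dirDeriv_congr e3,
      bracket_congr hX hY, bracket_congr hY (EventuallyEq.refl _ Z),
      bracket_congr (EventuallyEq.refl _ Z) hX, hX.eq_of_nhds, hY.eq_of_nhds]
    simp only [dirDeriv, hX.eq_of_nhds, hY.eq_of_nhds]
  simp only [this]

theorem leviCivita_add {X Y Y' : VField I (M := M)} {p : M} (hX : DiffAt X p)
    (hY : DiffAt Y p) (hY' : DiffAt Y' p) :
    leviCivita g X (Y + Y') p = leviCivita g X Y p + leviCivita g X Y' p := by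
  refine hg.leviCivita_unique hX (hY.add hY') fun w ↦ ⟨extend w, diffAt_extend w, extend_self w, ?_⟩
  have hw := diffAt_extend w
  have k1 := hg.leviCivita_koszul hX hY hw
  have k2 := hg.leviCivita_koszul hX hY' hw
  rw [extend_self] at k1 k2
  rw [hg.add_left, mul_add, k1, k2]
  have e1 : (fun x ↦ g x ((Y + Y') x) (extend w x))
      = fun x ↦ g x (Y x) (extend w x) + g x (Y' x) (extend w x) := by
    funext x; exact hg.add_left x _ _ _
  have e2 : (fun x ↦ g x (X x) ((Y + Y') x)) = fun x ↦ g x (X x) (Y x) + g x (X x) (Y' x) := by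
    funext x; exact hg.add_right x _ _ _
  have e3 : (Y + Y') p = Y p + Y' p := rfl
  have e6 : dirDeriv (Y + Y') (fun x ↦ g x (extend w x) (X x)) p
      = dirDeriv Y (fun x ↦ g x (extend w x) (X x)) p
        + dirDeriv Y' (fun x ↦ g x (extend w x) (X x)) p := by
    simp [dirDeriv, e3]
  unfold koszul
  rw [e1, e2, e6, e3, bracket_add_right hY hY', bracket_add_left hY hY',
    dirDeriv_add (hg.mdiff hY hw) (hg.mdiff hY' hw),
    dirDeriv_add (hg.mdiff hX hY) (hg.mdiff hX hY'), hg.add_right, hg.add_left, hg.add_left]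
  ring

theorem leviCivita_smul {X Y : VField I (M := M)} {f : M → ℝ} {p : M} (hX : DiffAt X p)
    (hf : MDifferentiableAt I 𝓘(ℝ, ℝ) f p) (hY : DiffAt Y p) :
    leviCivita g X (fun x ↦ f x • Y x) p = dirDeriv X f p • Y p + f p • leviCivita g X Y p := by
  refine hg.leviCivita_unique hX (hY.smul hf) fun w ↦ ⟨extend w, diffAt_extend w, extend_self w, ?_⟩
  have hw := diffAt_extend w
  have k1 := hg.leviCivita_koszul hX hY hw
  rw [extend_self] at k1
  rw [hg.add_left, hg.smul_left, hg.smul_left]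
  have e1 : (fun x ↦ g x (f x • Y x) (extend w x)) = fun x ↦ f x * g x (Y x) (extend w x) := by
    funext x; exact hg.smul_left x _ _ _
  have e2 : (fun x ↦ g x (X x) (f x • Y x)) = fun x ↦ f x * g x (X x) (Y x) := by
    funext x; exact hg.smul_right x _ _ _
  have e6 : dirDeriv (fun x ↦ f x • Y x) (fun x ↦ g x (extend w x) (X x)) p
      = f p * dirDeriv Y (fun x ↦ g x (extend w x) (X x)) p := by
    simp [dirDeriv]
  have k2 : 2 * (f p * g p (leviCivita g X Y p) w) = f p * koszul g X Y (extend w) p := by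
    rw [← k1]; ring
  rw [mul_add, k2]
  unfold koszul
  rw [e1, e2, e6, bracket_smul_right hf hY, bracket_smul_left hf hY,
    dirDeriv_mul hf (hg.mdiff hY hw), dirDeriv_mul hf (hg.mdiff hX hY), hg.add_left, hg.add_left,
    hg.neg_left, hg.smul_left, hg.smul_left, hg.smul_left, hg.smul_left, hg.smul_right,
    extend_self, hg.symm p (X p) (Y p)]
  ring

theorem leviCivita_neg {X Y : VField I (M := M)} {p : M} (hX : DiffAt X p) (hY : DiffAt Y p) :
    leviCivita g X (fun x ↦ -Y x) p = -leviCivita g X Y p := by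
  have := hg.leviCivita_smul hX (f := fun _ ↦ (-1 : ℝ)) mdifferentiableAt_const hY
  simpa using this

theorem leviCivita_sub {X Y Y' : VField I (M := M)} {p : M} (hX : DiffAt X p)
    (hY : DiffAt Y p) (hY' : DiffAt Y' p) :
    leviCivita g X (fun x ↦ Y x - Y' x) p = leviCivita g X Y p - leviCivita g X Y' p := by
  have h := hg.leviCivita_add hX hY hY'.neg
  rw [hg.leviCivita_neg hX hY'] at h
  rw [sub_eq_add_neg, ← h]
  congr 1
  funext x
  exact sub_eq_add_neg _ _

/-- The Levi-Civita connection is torsion-free. -/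
theorem leviCivita_sub_swap {X Y : VField I (M := M)} {p : M} (hX : DiffAt X p)
    (hY : DiffAt Y p) : leviCivita g X Y p - leviCivita g Y X p = bracket X Y p := by
  refine hg.ext fun w ↦ ?_
  have hw := diffAt_extend w
  have k1 := hg.leviCivita_koszul hX hY hw
  have k2 := hg.leviCivita_koszul hY hX hw
  unfold koszul at k1 k2
  rw [bracket_swap (extend w) X, hg.neg_left, funext fun x ↦ hg.symm x (extend w x) (X x)] at k1
  rw [bracket_swap Y X, bracket_swap (extend w) Y, hg.neg_left, hg.neg_left,
    funext fun x ↦ hg.symm x (extend w x) (Y x), funext fun x ↦ hg.symm x (Y x) (X x)] at k2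
  rw [extend_self] at k1 k2
  rw [hg.sub_left]
  linarith

/-- The Levi-Civita connection is compatible with the metric. -/
theorem dirDeriv_metric {X Y Z : VField I (M := M)} {p : M} (hX : DiffAt X p)
    (hY : DiffAt Y p) (hZ : DiffAt Z p) :
    dirDeriv X (fun x ↦ g x (Y x) (Z x)) p
      = g p (leviCivita g X Y p) (Z p) + g p (Y p) (leviCivita g X Z p) := by
  have k1 := hg.leviCivita_koszul hX hY hZ
  have k2 := hg.leviCivita_koszul hX hZ hY
  unfold koszul at k1 k2
  rw [hg.symm p (Y p)]
  rw [bracket_swap Z Y, bracket_swap Y X, bracket_swap X Z, hg.neg_left, hg.neg_left, hg.neg_left,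
    funext fun x ↦ hg.symm x (Z x) (Y x), funext fun x ↦ hg.symm x (Y x) (X x),
    funext fun x ↦ hg.symm x (X x) (Z x)] at k2
  linarith

/-- In ∇_X Y = ∇_Y X + [X,Y] the derivatives of a factor of X cancel. -/
theorem tensorialAt_leviCivita {Y : VField I (M := M)} {p : M} (hY : DiffAt Y p) :
    TensorialAt I E (fun X ↦ leviCivita g X Y p) p where
  smul {f X} hf hX := by
    have hX : DiffAt X p := hX
    have hfX : DiffAt (f • X) p := hX.smul hf
    have h1 := hg.leviCivita_sub_swap hfX hY
    have h2 := hg.leviCivita_sub_swap hX hY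
    have h3 : leviCivita g Y (f • X) p = _ := hg.leviCivita_smul hY hf hX
    have h4 : bracket (f • X) Y p = _ := bracket_smul_left hf hX
    rw [h3, h4, ← h2] at h1
    rw [sub_eq_iff_eq_add.1 h1]
    module
  add {X X'} hX hX' := by
    have hX : DiffAt X p := hX
    have hX' : DiffAt X' p := hX'
    have h1 := hg.leviCivita_sub_swap (hX.add hX') hY
    have h2 := hg.leviCivita_sub_swap hX hY
    have h3 := hg.leviCivita_sub_swap hX' hY
    rw [bracket_add_left hX hX', hg.leviCivita_add hY hX hX', ← h2, ← h3] at h1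
    rw [sub_eq_iff_eq_add.1 h1]
    abel

/-- The value of `∇_X Y` at `p` depends on `X` only through its value at `p`. -/
theorem leviCivita_congr_left {X X' Y : VField I (M := M)} {p : M} (hX : DiffAt X p)
    (hX' : DiffAt X' p) (hY : DiffAt Y p) (h : X p = X' p) :
    leviCivita g X Y p = leviCivita g X' Y p :=
  (hg.tensorialAt_leviCivita hY).pointwise hX hX' h

end IsRiemannian

end LeviCivita

/-! ### Linear algebra of φ, T, ∇φ and ∇T on one tangent space. -/

section Algebra

variable {V : Type*} [AddCommGroup V] [Module ℝ V] [TopologicalSpace V]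
  [IsTopologicalAddGroup V] [ContinuousSMul ℝ V]

/-- The data `(g, η, φ, ξ)` of a contact metric structure on one tangent space. -/
structure IsAlmostContactMetric (g : V →L[ℝ] V →L[ℝ] ℝ) (η : V →L[ℝ] ℝ) (φ : V →L[ℝ] V) (ξ : V) :
    Prop where
  symm : ∀ u v, g u v = g v u
  pos : ∀ v, v ≠ 0 → 0 < g v v
  g_ξ : ∀ v, g v ξ = η v
  η_ξ : η ξ = 1
  φ_sq : ∀ v, φ (φ v) = -v + η v • ξ
  skew : ∀ u v, g (φ u) v = -g u (φ v)

variable {g : V →L[ℝ] V →L[ℝ] ℝ} {η : V →L[ℝ] ℝ} {φ T : V →L[ℝ] V} {ξ : V}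
  {F G : V →L[ℝ] V →L[ℝ] V}

namespace IsAlmostContactMetric

section Basic

variable (hc : IsAlmostContactMetric g η φ ξ)
include hc

theorem ext {u v : V} (h : ∀ w, g u w = g v w) : u = v := by
  by_contra hne
  have h1 := hc.pos (u - v) (sub_ne_zero.2 hne)
  simp [h] at h1

theorem φ_ξ : φ ξ = 0 := by
  have h1 : φ (φ ξ) = 0 := by simp [hc.φ_sq, hc.η_ξ]
  by_contra hne
  have h2 := hc.pos _ hne
  rw [hc.skew, h1] at h2
  simp at h2

theorem η_φ (v : V) : η (φ v) = 0 := by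
  rw [← hc.g_ξ, hc.skew, hc.φ_ξ]; simp

theorem ξ_g (v : V) : g ξ v = η v := by rw [hc.symm, hc.g_ξ]

end Basic

end IsAlmostContactMetric

/-- The properties of the symmetric operator `T = -∇ξ - φ` and of `F = ∇φ` which follow
at once from the definitions. -/
structure IsFirstOrder (g : V →L[ℝ] V →L[ℝ] ℝ) (η : V →L[ℝ] ℝ) (φ : V →L[ℝ] V) (ξ : V)
    (T : V →L[ℝ] V) (F : V →L[ℝ] V →L[ℝ] V) : Prop extends IsAlmostContactMetric g η φ ξ where
  T_symm : ∀ u v, g (T u) v = g u (T v)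
  T_ξ : T ξ = 0
  F_skew : ∀ x y z, g (F x y) z = -g y (F x z)
  F_cyclic : ∀ x y z, g (F x y) z + g (F y z) x + g (F z x) y = 0
  F_φ : ∀ x y, F x (φ y) + φ (F x y) = -g (φ x + T x) y • ξ - η y • (φ x + T x)
  F_ξ : ∀ x, F x ξ = φ (φ x + T x)

namespace IsFirstOrder

variable (h : IsFirstOrder g η φ ξ T F)
include h

theorem η_T (v : V) : η (T v) = 0 := by
  rw [← h.g_ξ, h.T_symm, h.T_ξ]; simp

/-- The cyclic identity with one entry ξ expresses F_ξ through values F_y ξ and F_z ξ, which are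
known. -/
theorem F_ξ_left_eq (y : V) : F ξ y = φ (T y) + T (φ y) := by
  refine h.toIsAlmostContactMetric.ext fun z ↦ ?_
  have h1 := h.F_cyclic ξ y z
  have h2 := h.F_skew y z ξ
  have h3 := h.F_ξ y
  have h4 := h.F_ξ z
  have h5 := h.skew (φ z) y
  have h6 := h.skew z (φ y)
  have h7 := h.skew (T z) y
  have h8 := h.T_symm z (φ y)
  have h9 := h.symm z (φ (T y))
  have h10 := h.symm z (T (φ y))
  have h11 := h.symm z (φ (φ y))
  rw [h3] at h2
  rw [h2, h4] at h1
  simp only [map_add, add_apply] at h1 ⊢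
  linarith

/-- At x = ξ the right side of `F_φ` vanishes, while by `F_ξ_left_eq` the left side is 2(φTφy - Ty).
Thus T anticommutes with φ, and then F_ξ = 0. -/
theorem φ_T_φ (y : V) : φ (T (φ y)) = T y := by
  have h1 := h.F_φ ξ y
  have e : φ ξ = 0 := h.toIsAlmostContactMetric.φ_ξ
  rw [h.F_ξ_left_eq, h.F_ξ_left_eq, e, h.T_ξ] at h1
  simp only [map_add, h.φ_sq, h.η_T, map_neg, map_smul, h.T_ξ, add_zero, map_zero, smul_zero,
    zero_smul, zero_apply, neg_zero, sub_zero] at h1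
  have h2 : (2 : ℝ) • φ (T (φ y)) = (2 : ℝ) • T y := by
    rw [← sub_eq_zero, ← h1]; module
  exact smul_right_injective V (two_ne_zero (α := ℝ)) h2

theorem φ_T (y : V) : φ (T y) = -T (φ y) := by
  have h1 := congrArg φ (h.φ_T_φ y)
  rw [h.φ_sq, h.η_T] at h1
  simpa using h1.symm

theorem F_ξ_left (y : V) : F ξ y = 0 := by
  rw [h.F_ξ_left_eq, h.φ_T]; simp

theorem F_ξ_right (x : V) : F x ξ = -x + η x • ξ - T (φ x) := by
  rw [h.F_ξ, map_add, h.φ_sq, h.φ_T]; module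

theorem h_symm (x y : V) : g (T (φ x)) y = g x (T (φ y)) := by
  rw [h.T_symm, h.skew, h.φ_T]; simp

/-- F_x anticommutes with φ modulo ξ and η, and φ is skew. -/
theorem F_φ_horizontal {x y z : V} (hy : η y = 0) (hz : η z = 0) :
    g (F x (φ y)) z = g (F x y) (φ z) := by
  have h1 := congrArg (fun v ↦ g v z) (h.F_φ x y)
  have h2 := h.skew (F x y) z
  simp only [map_add, add_apply, hy, zero_smul, sub_zero, map_smul,
    smul_apply, smul_eq_mul, h.toIsAlmostContactMetric.ξ_g, hz, mul_zero]
    at h1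
  linarith

/-- On ker η the structure behaves like an almost Kähler one. Adding the cyclic identities at
(a,b,c) and (φa,φb,c) makes one pair of terms cancel, so the defect P(a,b,c) = g(F_a b, c) +
g(F_{φa} φb, c) satisfies P(a,b,c) + P(b,c,a) = 0. Three cyclic shifts of this force P = 0. -/
theorem F_φ_φ_horizontal {x y z : V} (hx : η x = 0) (hy : η y = 0) (hz : η z = 0) :
    g (F (φ x) (φ y)) z = -g (F x y) z := by
  have hφ := h.toIsAlmostContactMetric.η_φ
  have key : ∀ {a b c : V}, η a = 0 → η b = 0 → η c = 0 →
      (g (F a b) c + g (F (φ a) (φ b)) c) + (g (F b c) a + g (F (φ b) (φ c)) a) = 0 := by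
    intro a b c ha hb hc
    have h1 := h.F_cyclic a b c
    have h2 := h.F_cyclic (φ a) (φ b) c
    have h3 : g (F c (φ a)) (φ b) = -g (F c a) b := by
      rw [h.F_φ_horizontal ha (hφ b), h.φ_sq, hb]; simp
    have h4 : g (F (φ b) c) (φ a) = g (F (φ b) (φ c)) a := (h.F_φ_horizontal hc ha).symm
    linarith
  have k1 := key hx hy hz
  have k2 := key hy hz hx
  have k3 := key hz hx hy
  linarith

end IsFirstOrder

/-- The properties of `F = ∇φ` and `G = ∇T` on one tangent space, for `T = -∇ξ - φ`. -/
structure IsSecondOrder (g : V →L[ℝ] V →L[ℝ] ℝ) (η : V →L[ℝ] ℝ) (φ : V →L[ℝ] V) (ξ : V)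
    (T : V →L[ℝ] V) (F G : V →L[ℝ] V →L[ℝ] V) : Prop extends IsFirstOrder g η φ ξ T F where
  G_symm : ∀ x y z, g (G x y) z = g y (G x z)
  G_φ : ∀ x y, G x (φ y) + T (F x y) + F x (T y) + φ (G x y) = 0
  G_ξ : ∀ x, G x ξ = T (φ x + T x)

/-- The relation between `F = ∇φ` and `G = ∇T` by which the nullity conditions are expressed. -/
def NullityRel (η : V →L[ℝ] ℝ) (φ T : V →L[ℝ] V) (F G : V →L[ℝ] V →L[ℝ] V) (c α β : ℝ) : Prop :=
  ∀ x y, -F x y + F y x + c • (-G x y + G y x)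
    = α • (η y • x - η x • y) + β • T (φ (η y • x - η x • y))

namespace IsSecondOrder

variable (h : IsSecondOrder g η φ ξ T F G) {c α β : ℝ}
include h

/-- The relation at (x, ξ) is a linear identity between x, Tφx, T²x and G_ξ x. On ker η the first
and third operators commute with φ, the other two anticommute, so these two groups vanish
separately. -/
theorem T_sq_eq (hR : NullityRel η φ T F G c α β) {x : V} (hx : η x = 0) :
    c • T (T x) = (1 - α) • x := by
  have h0 := h.toIsFirstOrder
  have hφ := h.toIsAlmostContactMetric.η_φ
  have key : ∀ {x : V}, η x = 0 →
      (1 - α) • x + (1 - c - β) • T (φ x) - c • T (T x) + c • G ξ x = 0 := by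
    intro x hx
    have h1 := hR x ξ
    rw [h.G_ξ, h0.F_ξ_right, h0.F_ξ_left, hx, h.η_ξ] at h1
    simp only [map_add, zero_smul, one_smul, sub_zero, add_zero] at h1
    rw [← sub_eq_zero] at h1
    rw [← h1]
    module
  have k1 := key hx
  -- Conjugation by φ reverses the sign of the part commuting with φ and fixes the anticommuting
  -- part; subtracting isolates the former.
  have k2 := congrArg φ (key (hφ x))
  have e1 : φ (G ξ (φ x)) = G ξ x := by
    have h1 := h.G_φ ξ x
    rw [h0.F_ξ_left, h0.F_ξ_left] at h1
    have h2 : G ξ (φ x) = -φ (G ξ x) := by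
      rw [← sub_eq_zero, ← h1]; simp
    have h3 : η (G ξ x) = 0 := by
      rw [← h.g_ξ, h.G_symm, h.G_ξ, h.T_ξ, h.toIsAlmostContactMetric.φ_ξ]; simp
    rw [h2, map_neg, h.φ_sq, h3]; simp
  have e3 : φ (T (T (φ x))) = -T (T x) := by
    have e2 : T (φ (φ x)) = -T x := by rw [h.φ_sq, hx]; simp
    rw [h0.φ_T, h0.φ_T, ← map_neg, neg_neg, e2, map_neg]
  simp only [map_add, map_sub, map_smul, map_zero, e1, e3, h.φ_sq, hx, map_neg,
    zero_smul, add_zero, h0.φ_T] at k2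
  have e4 : (2 : ℝ) • (c • T (T x)) = (2 : ℝ) • ((1 - α) • x) := by
    have : (2 : ℝ) • (c • T (T x)) - (2 : ℝ) • ((1 - α) • x) = 0 := by
      rw [← sub_zero (0 : V)]
      nth_rewrite 1 [← k2]
      rw [← k1]
      module
    exact sub_eq_zero.1 this
  exact smul_right_injective V (two_ne_zero (α := ℝ)) e4

/-- If `α = 1` then `T = 0`. -/
theorem T_eq_zero (hR : NullityRel η φ T F G c 1 β) (hc : c ≠ 0) : T = 0 := by
  have key : ∀ {x : V}, η x = 0 → T x = 0 := by
    intro x hx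
    have h1 := h.T_sq_eq hR hx
    rw [sub_self, zero_smul, smul_eq_zero] at h1
    have h2 := h1.resolve_left hc
    by_contra hne
    have h3 := h.pos _ hne
    rw [h.T_symm, h2] at h3
    simp at h3
  ext x
  have h1 : η (x - η x • ξ) = 0 := by simp [h.η_ξ]
  have h2 := key h1
  simpa [h.T_ξ] using h2

/-- The relation is used at (x,y,z), (x,φy,φz), (φx,y,φz), (φx,φy,z) with signs +, -, +, +. The
plain F-terms cancel by type. The derivative of φT + Tφ = 0 turns the G-terms into terms combining F
and T, and the cyclic identity collects these into a multiple of g(F_{Tφx} y, z). -/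
theorem F_h_horizontal (hR : NullityRel η φ T F G c α β) (hc : c ≠ 0) {x y z : V}
    (hx : η x = 0) (hy : η y = 0) (hz : η z = 0) : g (F (T (φ x)) y) z = 0 := by
  have h0 := h.toIsFirstOrder
  have hφ := h.toIsAlmostContactMetric.η_φ
  have hT := h0.η_T
  -- On ker η the right side of the relation is zero. Cyclicity and skewness convert the alternation
  -- of F in y, z, paired with x, into g(F_x y, z).
  have rel : ∀ {x y z : V}, η x = 0 → η y = 0 → η z = 0 →
      g (F x y) z + c * (-g (G y z) x + g (G z y) x) = 0 := by
    intro x y z hx hy hz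
    have h1 := congrArg (fun v ↦ g v x) (hR y z)
    have h2 := h.F_cyclic x y z
    have h3 := h.F_skew z x y
    have h4 := h.symm x (F z y)
    simp only [hy, hz, zero_smul, sub_zero, map_zero, smul_zero, add_zero, map_add, map_neg,
      map_smul, add_apply, neg_apply,
      smul_apply, smul_eq_mul, zero_apply] at h1
    linarith
  have anti : ∀ (a b d : V), g (G a (φ b)) d + g (F a b) (T d) + g (F a (T b)) d
      - g (G a b) (φ d) = 0 := by
    intro a b d
    have h1 := congrArg (fun v ↦ g v d) (h.G_φ a b)
    have h2 := h.T_symm (F a b) d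
    have h3 := h.skew (G a b) d
    simp only [map_add, add_apply, map_zero,
      zero_apply] at h1
    linarith
  have r1 := rel hx hy hz
  have r2 := rel hx (hφ y) (hφ z)
  have r3 := rel (hφ x) hy (hφ z)
  have r4 := rel (hφ x) (hφ y) hz
  have sq : ∀ {v : V}, η v = 0 → φ (φ v) = -v := by
    intro v hv
    rw [h.φ_sq, hv]; simp
  -- the terms involving `G`
  have a1 := anti y z (φ x)
  have a2 := anti z y (φ x)
  have a3 := anti (φ y) z x
  have a4 := anti (φ z) y x
  rw [sq hx, map_neg] at a1 a2
  -- the terms involving `F`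
  have b1 : g (F (φ y) z) (T x) = -g (F y z) (T (φ x)) := by
    have e1 := h0.F_φ_φ_horizontal hy (hφ z) (hT x)
    rw [sq hz] at e1
    have e2 := h0.F_φ_horizontal (x := y) hz (hT x)
    rw [h0.φ_T] at e2
    simp only [map_neg, neg_apply] at e1 e2
    linarith
  have b2 : g (F (φ z) y) (T x) = -g (F z y) (T (φ x)) := by
    have e1 := h0.F_φ_φ_horizontal hz (hφ y) (hT x)
    rw [sq hy] at e1
    have e2 := h0.F_φ_horizontal (x := z) hy (hT x)
    rw [h0.φ_T] at e2
    simp only [map_neg, neg_apply] at e1 e2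
    linarith
  have b3 : g (F (φ y) (T z)) x = g (F y (T z)) (φ x) := by
    have e1 := h0.F_φ_φ_horizontal hy (hφ (T z)) hx
    rw [sq (hT z)] at e1
    have e2 := h0.F_φ_horizontal (x := y) (hT z) hx
    simp only [map_neg, neg_apply] at e1 e2
    linarith
  have b4 : g (F (φ z) (T y)) x = g (F z (T y)) (φ x) := by
    have e1 := h0.F_φ_φ_horizontal hz (hφ (T y)) hx
    rw [sq (hT y)] at e1
    have e2 := h0.F_φ_horizontal (x := z) (hT y) hx
    simp only [map_neg, neg_apply] at e1 e2
    linarith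
  have c2 : g (F x (φ y)) (φ z) = -g (F x y) z := by
    rw [h0.F_φ_horizontal hy (hφ z), sq hz]; simp
  have c3 : g (F (φ x) y) (φ z) = -g (F x y) z := by
    rw [← h0.F_φ_horizontal hy hz, h0.F_φ_φ_horizontal hx hy hz]
  have c4 := h0.F_φ_φ_horizontal hx hy hz
  have d1 := h.F_cyclic (T (φ x)) y z
  have d2 := h.F_skew z (T (φ x)) y
  have d3 := h.symm (T (φ x)) (F z y)
  have : c * g (F (T (φ x)) y) z = 0 := by
    linear_combination (-1 / 2) * (r1 - r2 + r3 + r4 + c * (a1 - a2 - a3 + a4) + c2 - c3 - c4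
      + c * (b1 + b3 - b2 - b4) - 2 * c * (d1 - d2 + d3))
  exact (mul_eq_zero.1 this).resolve_left hc

/-- For α ≠ 1 every horizontal x is a multiple of h(hx), so `F_h_horizontal` applies. For α = 1 the
relation loses its G-terms and the cyclic identity finishes. The hypothesis `hG` is separate because
vanishing of T at one point says nothing about its derivative. -/
theorem F_horizontal (hR : NullityRel η φ T F G c α β) (hc : c ≠ 0) (hG : α = 1 → T = 0 → G = 0)
    {x y z : V} (hx : η x = 0) (hy : η y = 0) (hz : η z = 0) : g (F x y) z = 0 := by
  have h0 := h.toIsFirstOrder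
  by_cases hα : α = 1
  · have hT : T = 0 := h.T_eq_zero (hα ▸ hR) hc
    have h1 := congrArg (fun v ↦ g v x) (hR y z)
    have h2 := h.F_cyclic x y z
    have h3 := h.F_skew z x y
    have h4 := h.symm x (F z y)
    simp only [hG hα hT, hy, hz, zero_smul, sub_zero, map_zero, smul_zero, add_zero, map_add,
      map_neg, add_apply, neg_apply, zero_apply, neg_zero] at h1
    linarith
  · have hα' : 1 - α ≠ 0 := sub_ne_zero.2 (Ne.symm hα)
    have e1 : T (φ (T (φ x))) = T (T x) := by
      rw [h0.φ_T, h.φ_sq, hx]; simp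
    have h1 := h.F_h_horizontal hR hc (h0.η_T (φ x)) hy hz
    rw [e1] at h1
    have h2 := h.T_sq_eq hR hx
    have h3 : x = ((1 - α)⁻¹ * c) • T (T x) := by
      rw [mul_smul, h2, inv_smul_smul₀ hα']
    rw [h3]
    simp [h1]

/-- The covariant derivative of `φ` under a nullity condition. -/
theorem F_eq (hR : NullityRel η φ T F G c α β) (hc : c ≠ 0) (hG : α = 1 → T = 0 → G = 0)
    (x y : V) : F x y = g (x + T (φ x)) y • ξ - η y • (x + T (φ x)) := by
  have h0 := h.toIsFirstOrder
  have hξ := h.toIsAlmostContactMetric.ξ_g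
  have hor (v : V) : η (v - η v • ξ) = 0 := by simp [h.η_ξ]
  refine h.toIsAlmostContactMetric.ext fun z ↦ ?_
  -- Splitting each argument along ξ leaves only F_ξ = 0, the known F_x ξ, and its mirror image
  -- under skewness.
  have h1 := h.F_horizontal hR hc hG (hor x) (hor y) (hor z)
  have h2 : F (x - η x • ξ) = F x := by
    ext v; simp [h0.F_ξ_left]
  have h3 := h.F_skew x y ξ
  rw [h2] at h1
  rw [h0.F_ξ_right] at h3
  have h4 := h.symm y x
  have h5 := h.symm y (T (φ x))
  have h6 : η (T (φ x)) = 0 := h0.η_T _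
  simp only [map_sub, map_smul, sub_apply, smul_apply, smul_eq_mul, h0.F_ξ_right, map_add,
    map_neg, add_apply, neg_apply, h.g_ξ, hξ, h.η_ξ, h6] at h1 h3 ⊢
  rw [h3, h4, h5] at h1
  linear_combination h1

/-- The ξ-component in `F_eq` is symmetric in x and y because h = Tφ is g-symmetric, so it drops
out. -/
theorem F_sub_F (hR : NullityRel η φ T F G c α β) (hc : c ≠ 0) (hG : α = 1 → T = 0 → G = 0)
    (x y : V) : -F x y + F y x = (η y • x - η x • y) + T (φ (η y • x - η x • y)) := by
  rw [h.F_eq hR hc hG, h.F_eq hR hc hG]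
  have h1 : g (x + T (φ x)) y = g (y + T (φ y)) x := by
    simp only [map_add, add_apply]
    rw [h.symm x y, h.toIsFirstOrder.h_symm, h.symm x]
  rw [h1]
  simp only [map_sub, map_smul]
  module

/-- A nullity condition determines `∇φ` and the alternation of `∇T`, so that one such condition
implies all others. -/
theorem nullityRel_change (hR : NullityRel η φ T F G c α β) (hc : c ≠ 0)
    (hG : α = 1 → T = 0 → G = 0) (c' : ℝ) :
    NullityRel η φ T F G c' (1 + c' / c * (α - 1)) (1 + c' / c * (β - 1)) := by
  intro x y
  have h1 := hR x y
  have h2 := h.F_sub_F hR hc hG x y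
  rw [h2] at h1 ⊢
  set w := η y • x - η x • y
  have h3 : c • (-G x y + G y x) = (α - 1) • w + (β - 1) • T (φ w) := by
    rw [eq_sub_of_add_eq' h1]; module
  have h4 : c' • (-G x y + G y x) = (c' / c) • (c • (-G x y + G y x)) := by
    rw [smul_smul, div_mul_cancel₀ _ hc]
  rw [h4, h3]
  module

end IsSecondOrder

end Algebra

/-! ### Covariant derivatives of endomorphism fields. -/

section Tensor

variable {E : Type*} [NormedAddCommGroup E] [NormedSpace ℝ E] [FiniteDimensional ℝ E]
  {H : Type*} [TopologicalSpace H] {I : ModelWithCorners ℝ E H} [I.Boundaryless]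
  {M : Type*} [TopologicalSpace M] [ChartedSpace H M] [IsManifold I ∞ M]

/-- A field of endomorphisms of the tangent spaces is differentiable: it maps differentiable
vector fields to differentiable vector fields. -/
def IsTensor (K : (x : M) → TangentSpace I x →L[ℝ] TangentSpace I x) : Prop :=
  ∀ {X : VField I (M := M)} {p : M}, DiffAt X p → DiffAt (fun x ↦ K x (X x)) p

variable {K : (x : M) → TangentSpace I x →L[ℝ] TangentSpace I x}

/-- A differentiable field has differentiable coefficients in a smooth local frame, so smooth fields
suffice as tests. -/
theorem IsTensor.of_smoothAt
    (hK : ∀ {X : VField I (M := M)} {p : M}, SmoothAt X p → DiffAt (fun x ↦ K x (X x)) p) :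
    IsTensor K := by
  intro X p hX
  let t := trivializationAt E (TangentSpace I) p
  have hp : p ∈ t.baseSet := FiberBundle.mem_baseSet_trivializationAt E (TangentSpace I) p
  let b := Module.Basis.ofVectorSpace ℝ E
  have hs (i) : SmoothAt (t.localFrame b i) p :=
    contMDiffAt_localFrame_of_mem ∞ t b i hp
  have hc (i) := mdifferentiableAt_localFrameCoeff (I := I) b hp hX i
  have h1 : DiffAt (fun x ↦ ∑ i, t.localFrameCoeff I b i x (X x) • K x (t.localFrame b i x)) p :=
    MDifferentiableAt.sum_section fun i _ ↦ (hc i).smul_section (hK (hs i))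
  refine h1.congr ?_
  filter_upwards [t.eventually_eq_localFrame_sum_coeff_smul (I := I) (s := X) b hp] with x hx
  conv_lhs => rw [hx]
  simp only [map_sum, map_smul]
  congr!

namespace IsRiemannian

variable {g : (x : M) → TangentSpace I x → TangentSpace I x → ℝ} (hg : IsRiemannian g)
include hg

theorem tensorialAt_nablaEnd_left (hK : IsTensor K) {p : M} (Y : VField I (M := M))
    (hY : DiffAt Y p) :
    TensorialAt I E (fun X ↦ leviCivita g X (fun x ↦ K x (Y x)) p - K p (leviCivita g X Y p)) p where
  smul {f X} hf hX := by
    have h1 : leviCivita g (f • X) Y p = _ := (hg.tensorialAt_leviCivita hY).smul hf hX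
    have h2 : leviCivita g (f • X) (fun x ↦ K x (Y x)) p = _ :=
      (hg.tensorialAt_leviCivita (hK hY)).smul hf hX
    rw [h1, h2, map_smul, smul_sub]
  add {X X'} hX hX' := by
    have h1 : leviCivita g (X + X') Y p = _ := (hg.tensorialAt_leviCivita hY).add hX hX'
    have h2 : leviCivita g (X + X') (fun x ↦ K x (Y x)) p = _ :=
      (hg.tensorialAt_leviCivita (hK hY)).add hX hX'
    rw [h1, h2, map_add]
    abel

theorem tensorialAt_nablaEnd_right (hK : IsTensor K) {p : M} (X : VField I (M := M))
    (hX : DiffAt X p) :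
    TensorialAt I E (fun Y ↦ leviCivita g X (fun x ↦ K x (Y x)) p - K p (leviCivita g X Y p)) p where
  smul {f Y} hf hY := by
    have hY : DiffAt Y p := hY
    have h1 : leviCivita g X (f • Y) p = _ := hg.leviCivita_smul hX hf hY
    have e : (fun x ↦ K x ((f • Y) x)) = fun x ↦ f x • K x (Y x) := by
      funext x; exact map_smul (K x) (f x) (Y x)
    have h2 : leviCivita g X (fun x ↦ K x ((f • Y) x)) p = _ :=
      e ▸ hg.leviCivita_smul hX hf (hK hY)
    rw [h1, h2, map_add, map_smul, map_smul, smul_sub]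
    abel
  add {Y Y'} hY hY' := by
    have hY : DiffAt Y p := hY
    have hY' : DiffAt Y' p := hY'
    have e : (fun x ↦ K x ((Y + Y') x)) = (fun x ↦ K x (Y x)) + fun x ↦ K x (Y' x) := by
      funext x; exact map_add (K x) (Y x) (Y' x)
    rw [e, hg.leviCivita_add hX hY hY', hg.leviCivita_add hX (hK hY) (hK hY'), map_add]
    abel

/-- The covariant derivative `(∇_X K) Y = ∇_X (K Y) - K (∇_X Y)` of a field of endomorphisms. -/
def nablaEnd (hK : IsTensor K) (p : M) :
    TangentSpace I p →L[ℝ] TangentSpace I p →L[ℝ] TangentSpace I p :=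
  TensorialAt.mkHom₂ (I := I) (F := E) (F' := E)
    (fun X Y ↦ leviCivita g X (fun x ↦ K x (Y x)) p - K p (leviCivita g X Y p)) p
    (hg.tensorialAt_nablaEnd_left hK) (hg.tensorialAt_nablaEnd_right hK)

theorem nablaEnd_apply (hK : IsTensor K) {X Y : VField I (M := M)} {p : M} (hX : DiffAt X p)
    (hY : DiffAt Y p) : hg.nablaEnd hK p (X p) (Y p)
      = leviCivita g X (fun x ↦ K x (Y x)) p - K p (leviCivita g X Y p) :=
  TensorialAt.mkHom₂_apply (hg.tensorialAt_nablaEnd_left hK) (hg.tensorialAt_nablaEnd_right hK) hX hY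

/-- The covariant derivative `v ↦ ∇_v Y` of a vector field. -/
def nabla {Y : VField I (M := M)} {p : M} (hY : DiffAt Y p) :
    TangentSpace I p →L[ℝ] TangentSpace I p :=
  TensorialAt.mkHom _ p (hg.tensorialAt_leviCivita hY)

theorem nabla_apply {X Y : VField I (M := M)} {p : M} (hX : DiffAt X p) (hY : DiffAt Y p) :
    hg.nabla hY (X p) = leviCivita g X Y p :=
  TensorialAt.mkHom_apply (hg.tensorialAt_leviCivita hY) hX

end IsRiemannian

end Tensor

/-! ### Regularity of the contact metric tensors. -/

section Contact

variable {n : ℕ} {M : Type*} [TopologicalSpace M] [ChartedSpace (Model n) M]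
  [IsManifold (𝓡 (2 * n + 1)) ∞ M]

namespace ContactMetricStructure

variable (S : ContactMetricStructure n M)

/-- The metric as a family of functions. -/
abbrev metric (x : M) (v w : Tan n M x) : ℝ := S.g.inner x v w

theorem contMDiffAt_metric {k : WithTop ℕ∞} (hk : k ≤ ∞) {X Y : (x : M) → Tan n M x} {p : M}
    (hX : ContMDiffAt (𝓡 (2 * n + 1)) (𝓡 (2 * n + 1)).tangent k
      (fun x ↦ (⟨x, X x⟩ : TangentBundle (𝓡 (2 * n + 1)) M)) p)
    (hY : ContMDiffAt (𝓡 (2 * n + 1)) (𝓡 (2 * n + 1)).tangent k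
      (fun x ↦ (⟨x, Y x⟩ : TangentBundle (𝓡 (2 * n + 1)) M)) p) :
    ContMDiffAt (𝓡 (2 * n + 1)) 𝓘(ℝ, ℝ) k (fun x ↦ S.metric x (X x) (Y x)) p := by
  have h1 : ContMDiffAt (𝓡 (2 * n + 1)) ((𝓡 (2 * n + 1)).prod 𝓘(ℝ, ℝ)) k
      (fun m ↦ Bundle.TotalSpace.mk' ℝ (E := Bundle.Trivial M ℝ) m (S.g.inner m (X m) (Y m))) p := by
    apply ContMDiffAt.clm_bundle_apply₂ (F₁ := Model n) (F₂ := Model n)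
    · exact (S.g.contMDiff.contMDiffAt).of_le hk
    · exact hX
    · exact hY
  simp only [Bundle.contMDiffAt_totalSpace] at h1
  exact h1.2

theorem mdifferentiableAt_metric {X Y : (x : M) → Tan n M x} {p : M} (hX : DiffAt X p)
    (hY : DiffAt Y p) :
    MDifferentiableAt (𝓡 (2 * n + 1)) 𝓘(ℝ, ℝ) (fun x ↦ S.metric x (X x) (Y x)) p := by
  have h1 : MDifferentiableAt (𝓡 (2 * n + 1)) ((𝓡 (2 * n + 1)).prod 𝓘(ℝ, ℝ))
      (fun m ↦ Bundle.TotalSpace.mk' ℝ (E := Bundle.Trivial M ℝ) m (S.g.inner m (X m) (Y m))) p := by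
    apply MDifferentiableAt.clm_bundle_apply₂ (F₁ := Model n) (F₂ := Model n)
    · exact S.g.contMDiff.mdifferentiableAt (by simp)
    · exact hX
    · exact hY
  simp only [mdifferentiableAt_totalSpace] at h1
  exact h1.2

theorem isRiemannian : IsRiemannian S.metric where
  add_left x u v w := by simp [metric]
  smul_left x c u v := by simp [metric]
  symm x u v := S.g.symm x u v
  pos x v hv := S.g.pos x v hv
  mdiff := S.mdifferentiableAt_metric

theorem isTensor_φ : IsTensor S.φ := by
  intro X p hX
  have h1 := S.smooth_φ.mdifferentiableAt (x := p) (by simp)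
  exact MDifferentiableAt.clm_bundle_apply (F₁ := Model n) (F₂ := Model n) h1 hX

theorem smoothAt_φ {X : (x : M) → Tan n M x} {p : M} (hX : SmoothAt X p) :
    SmoothAt (fun x ↦ S.φ x (X x)) p :=
  ContMDiffAt.clm_bundle_apply (F₁ := Model n) (F₂ := Model n) S.smooth_φ.contMDiffAt hX

theorem diffAt_ξ (p : M) : DiffAt S.ξ p := (S.smooth_ξ p).diffAt

theorem mdifferentiableAt_η {X : (x : M) → Tan n M x} {p : M} (hX : DiffAt X p) :
    MDifferentiableAt (𝓡 (2 * n + 1)) 𝓘(ℝ, ℝ) (fun x ↦ S.η x (X x)) p := by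
  simpa only [metric, S.g_ξ] using S.mdifferentiableAt_metric hX (S.diffAt_ξ p)

theorem contMDiffAt_η {X : (x : M) → Tan n M x} {p : M} (hX : SmoothAt X p) :
    ContMDiffAt (𝓡 (2 * n + 1)) 𝓘(ℝ, ℝ) ∞ (fun x ↦ S.η x (X x)) p := by
  simpa only [metric, S.g_ξ] using S.contMDiffAt_metric le_rfl hX (S.smooth_ξ p)

end ContactMetricStructure

end Contact

/-! ### First-order identities: ∇ξ, ∇φ and the closedness of dη. -/

section Contact

variable {n : ℕ} {M : Type*} [TopologicalSpace M] [ChartedSpace (Model n) M]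
  [IsManifold (𝓡 (2 * n + 1)) ∞ M]

namespace ContactMetricStructure

variable (S : ContactMetricStructure n M)

/-- The Levi-Civita connection of a contact metric structure. -/
abbrev conn (X Y : (x : M) → Tan n M x) : (x : M) → Tan n M x := leviCivita S.metric X Y

theorem dOneForm_eq_conn {X Y : (x : M) → Tan n M x} {p : M} (hX : DiffAt X p)
    (hY : DiffAt Y p) : dOneForm S.η X Y p
      = (1 / 2) * (S.metric p (S.conn X S.ξ p) (Y p) - S.metric p (S.conn Y S.ξ p) (X p)) := by
  have hg := S.isRiemannian
  have h1 := hg.dirDeriv_metric hX hY (S.diffAt_ξ p)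
  have h2 := hg.dirDeriv_metric hY hX (S.diffAt_ξ p)
  have h3 := hg.leviCivita_sub_swap hX hY
  have h4 := hg.sub_left p (S.conn X Y p) (S.conn Y X p) (S.ξ p)
  have e : ∀ X : (x : M) → Tan n M x, (fun x ↦ S.metric x (X x) (S.ξ x)) = fun x ↦ S.η x (X x) := by
    intro X; funext x; exact S.g_ξ x (X x)
  rw [h3] at h4
  rw [e] at h1 h2
  have h5 : S.metric p (bracket X Y p) (S.ξ p) = S.η p (bracket X Y p) := S.g_ξ p _
  unfold dOneForm
  rw [h1, h2, ← h5, h4, hg.symm p (Y p), hg.symm p (X p)]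
  ring

/-- Written through ∇ξ, the value of dη depends only on the vectors at `p`; this passes the
structure identity from smooth to differentiable fields. -/
theorem dOneForm_eq {X Y : (x : M) → Tan n M x} {p : M} (hX : DiffAt X p) (hY : DiffAt Y p) :
    dOneForm S.η X Y p = S.metric p (X p) (S.φ p (Y p)) := by
  have hg := S.isRiemannian
  have h1 := S.dη_eq p (extend (X p)) (extend (Y p)) (smoothAt_extend _) (smoothAt_extend _)
  rw [S.dOneForm_eq_conn (diffAt_extend _) (diffAt_extend _)] at h1
  rw [S.dOneForm_eq_conn hX hY]
  have e1 : S.conn (extend (X p)) S.ξ p = S.conn X S.ξ p :=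
    hg.leviCivita_congr_left (diffAt_extend _) hX (S.diffAt_ξ p) (extend_self _)
  have e2 : S.conn (extend (Y p)) S.ξ p = S.conn Y S.ξ p :=
    hg.leviCivita_congr_left (diffAt_extend _) hY (S.diffAt_ξ p) (extend_self _)
  rw [e1, e2, extend_self, extend_self] at h1
  exact h1

theorem dOneForm_swap (X Y : (x : M) → Tan n M x) (p : M) :
    dOneForm S.η X Y p = -dOneForm S.η Y X p := by
  unfold dOneForm
  rw [bracket_swap Y X, map_neg]
  ring

theorem isAlmostContactMetric (p : M) :
    IsAlmostContactMetric (S.g.inner p) (S.η p) (S.φ p) (S.ξ p) where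
  symm := S.g.symm p
  pos := S.g.pos p
  g_ξ := S.g_ξ p
  η_ξ := S.η_ξ p
  φ_sq := S.φ_sq p
  skew u v := by
    have h1 := S.dOneForm_eq (diffAt_extend u) (diffAt_extend v)
    have h2 := S.dOneForm_eq (diffAt_extend v) (diffAt_extend u)
    rw [S.dOneForm_swap, h2, extend_self, extend_self] at h1
    rw [S.g.symm]
    simp only [metric] at h1
    linarith

/-- The fundamental form `dη` is closed. -/
theorem fundamental_closed {X Y Z : (x : M) → Tan n M x} {p : M} (hX : SmoothAt X p)
    (hY : SmoothAt Y p) (hZ : SmoothAt Z p) :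
    dirDeriv X (fun x ↦ S.metric x (Y x) (S.φ x (Z x))) p
      + dirDeriv Y (fun x ↦ S.metric x (Z x) (S.φ x (X x))) p
      + dirDeriv Z (fun x ↦ S.metric x (X x) (S.φ x (Y x))) p
      + S.metric p (X p) (S.φ p (bracket Y Z p)) + S.metric p (Y p) (S.φ p (bracket Z X p))
      + S.metric p (Z p) (S.φ p (bracket X Y p)) = 0 := by
  have two {W : (x : M) → Tan n M x} (hW : SmoothAt W p) :
      ContMDiffAt (𝓡 (2 * n + 1)) 𝓘(ℝ, ℝ) 2 (fun x ↦ S.η x (W x)) p :=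
    (S.contMDiffAt_η hW).of_le ENat.LEInfty.out
  have key : ∀ {X Y Z : (x : M) → Tan n M x}, SmoothAt X p → SmoothAt Y p → SmoothAt Z p →
      2 * dirDeriv X (fun x ↦ S.metric x (Y x) (S.φ x (Z x))) p
        = dirDeriv X (dirDeriv Y fun x ↦ S.η x (Z x)) p
          - dirDeriv X (dirDeriv Z fun x ↦ S.η x (Y x)) p
          - dirDeriv X (fun x ↦ S.η x (bracket Y Z x)) p := by
    intro X Y Z hX hY hZ
    have e1 : (fun x ↦ 2 * S.metric x (Y x) (S.φ x (Z x))) =ᶠ[𝓝 p]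
        fun x ↦ (dirDeriv Y (fun x ↦ S.η x (Z x)) x - dirDeriv Z (fun x ↦ S.η x (Y x)) x)
          - S.η x (bracket Y Z x) := by
      filter_upwards [hY.eventually_diffAt, hZ.eventually_diffAt] with x hx hx'
      rw [← S.dOneForm_eq hx hx']
      unfold dOneForm
      ring
    have e2 := dirDeriv_congr (X := X) e1
    have m1 : MDifferentiableAt (𝓡 (2 * n + 1)) 𝓘(ℝ, ℝ) (dirDeriv Y fun x ↦ S.η x (Z x)) p :=
      mdifferentiableAt_mvfderiv (two hZ) hY.diffAt
    have m2 : MDifferentiableAt (𝓡 (2 * n + 1)) 𝓘(ℝ, ℝ) (dirDeriv Z fun x ↦ S.η x (Y x)) p :=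
      mdifferentiableAt_mvfderiv (two hY) hZ.diffAt
    have m3 : MDifferentiableAt (𝓡 (2 * n + 1)) 𝓘(ℝ, ℝ)
        (fun x ↦ dirDeriv Y (fun x ↦ S.η x (Z x)) x - dirDeriv Z (fun x ↦ S.η x (Y x)) x) p :=
      m1.sub m2
    rw [dirDeriv_mul mdifferentiableAt_const
      (S.mdifferentiableAt_metric hY.diffAt (S.isTensor_φ hZ.diffAt)), dirDeriv_const, zero_mul,
      add_zero] at e2
    rw [e2, dirDeriv_sub m3
      (S.mdifferentiableAt_η (hY.bracket hZ).diffAt), dirDeriv_sub m1 m2]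
  have key2 : ∀ {X Y Z : (x : M) → Tan n M x}, SmoothAt X p → SmoothAt Y p → SmoothAt Z p →
      2 * S.metric p (X p) (S.φ p (bracket Y Z p))
        = dirDeriv X (fun x ↦ S.η x (bracket Y Z x)) p
          - (dirDeriv Y (dirDeriv Z fun x ↦ S.η x (X x)) p
            - dirDeriv Z (dirDeriv Y fun x ↦ S.η x (X x)) p)
          - S.η p (bracket X (bracket Y Z) p) := by
    intro X Y Z hX hY hZ
    rw [← S.dOneForm_eq hX.diffAt (hY.bracket hZ).diffAt,
      ← dirDeriv_bracket (two hX) hY.diffAt hZ.diffAt]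
    unfold dOneForm
    ring
  -- This is d(dη) = 0: second derivatives of η(X), η(Y), η(Z) cancel by the commutator formula, the
  -- double brackets by the Jacobi identity.
  have h1 := congrArg (S.η p) (bracket_jacobi hX hY hZ)
  rw [map_add, map_add, map_zero] at h1
  have a1 := key hX hY hZ
  have a2 := key hY hZ hX
  have a3 := key hZ hX hY
  have b1 := key2 hX hY hZ
  have b2 := key2 hY hZ hX
  have b3 := key2 hZ hX hY
  linarith

/-- The tensor field `T = -∇ξ - φ`, so that `∇_X ξ = -φ X - T X`. -/
def T (p : M) : Tan n M p →L[ℝ] Tan n M p :=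
  -S.isRiemannian.nabla (S.diffAt_ξ p) - S.φ p

theorem conn_ξ {X : (x : M) → Tan n M x} {p : M} (hX : DiffAt X p) :
    S.conn X S.ξ p = -S.φ p (X p) - S.T p (X p) := by
  have h1 := S.isRiemannian.nabla_apply hX (S.diffAt_ξ p)
  rw [T, sub_apply, neg_apply, h1]
  abel

/-- The covariant derivative of `φ`. -/
def nablaφ (p : M) : Tan n M p →L[ℝ] Tan n M p →L[ℝ] Tan n M p :=
  S.isRiemannian.nablaEnd S.isTensor_φ p

theorem nablaφ_apply {X Y : (x : M) → Tan n M x} {p : M} (hX : DiffAt X p) (hY : DiffAt Y p) :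
    S.nablaφ p (X p) (Y p) = S.conn X (fun x ↦ S.φ x (Y x)) p - S.φ p (S.conn X Y p) :=
  S.isRiemannian.nablaEnd_apply S.isTensor_φ hX hY

theorem conn_φ {X Y : (x : M) → Tan n M x} {p : M} (hX : DiffAt X p) (hY : DiffAt Y p) :
    S.conn X (fun x ↦ S.φ x (Y x)) p = S.nablaφ p (X p) (Y p) + S.φ p (S.conn X Y p) := by
  rw [S.nablaφ_apply hX hY, sub_add_cancel]

/-- The skew part of -∇ξ is φ, since dη(X,Y) = g(X,φY); T is the remaining symmetric part. -/
theorem T_symm (p : M) (u v : Tan n M p) : S.metric p (S.T p u) v = S.metric p u (S.T p v) := by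
  have hc := S.isAlmostContactMetric p
  have h1 := S.dOneForm_eq_conn (diffAt_extend u) (diffAt_extend v)
  rw [S.dOneForm_eq (diffAt_extend u) (diffAt_extend v), S.conn_ξ (diffAt_extend u),
    S.conn_ξ (diffAt_extend v)] at h1
  simp only [extend_self] at h1
  have h2 := hc.skew u v
  have h3 := hc.symm u (S.φ p v)
  have h4 := hc.symm u (S.T p v)
  simp only [metric, map_sub, map_neg, sub_apply, neg_apply] at h1 ⊢
  linarith

theorem metric_conn_ξ_ξ {X : (x : M) → Tan n M x} {p : M} (hX : DiffAt X p) :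
    S.metric p (S.conn X S.ξ p) (S.ξ p) = 0 := by
  have h1 := S.isRiemannian.dirDeriv_metric hX (S.diffAt_ξ p) (S.diffAt_ξ p)
  have e : (fun x ↦ S.metric x (S.ξ x) (S.ξ x)) = fun _ ↦ (1 : ℝ) := by
    funext x; simp [metric, S.g_ξ, S.η_ξ]
  rw [e, dirDeriv_const, S.isRiemannian.symm p (S.ξ p)] at h1
  simp only [conn]
  linarith

theorem T_ξ (p : M) : S.T p (S.ξ p) = 0 := by
  have hc := S.isAlmostContactMetric p
  have h1 : S.T p (S.ξ p) = -S.conn S.ξ S.ξ p := by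
    rw [S.conn_ξ (S.diffAt_ξ p), hc.φ_ξ]; simp
  rw [h1, neg_eq_zero]
  refine S.isRiemannian.ext fun w ↦ ?_
  have h2 := S.dOneForm_eq_conn (S.diffAt_ξ p) (diffAt_extend w)
  rw [S.dη_ξ p _ (smoothAt_extend w), S.metric_conn_ξ_ξ (diffAt_extend w), extend_self] at h2
  have h3 : S.metric p 0 w = 0 := by simp [metric]
  rw [h3]
  linarith

theorem nablaφ_skew (p : M) (x y z : Tan n M p) :
    S.g.inner p (S.nablaφ p x y) z = -S.g.inner p y (S.nablaφ p x z) := by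
  have hc := S.isAlmostContactMetric
  have hx := diffAt_extend x
  have hy := diffAt_extend y
  have hz := diffAt_extend z
  have h1 := S.isRiemannian.dirDeriv_metric hx (S.isTensor_φ hy) hz
  have h2 := S.isRiemannian.dirDeriv_metric hx hy (S.isTensor_φ hz)
  have e : (fun q ↦ S.metric q (S.φ q (extend y q)) (extend z q))
      = fun q ↦ (-1 : ℝ) * S.metric q (extend y q) (S.φ q (extend z q)) := by
    funext q
    simp only [metric]
    rw [(hc q).skew]
    ring
  have h3 := S.conn_φ hx hy
  have h4 := S.conn_φ hx hz
  simp only [conn] at h3 h4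
  rw [e, dirDeriv_mul mdifferentiableAt_const
    (S.mdifferentiableAt_metric hy (S.isTensor_φ hz)), h2, h3, h4] at h1
  have h5 := (hc p).skew (leviCivita S.metric (extend x) (extend y) p) z
  have h6 := (hc p).skew y (leviCivita S.metric (extend x) (extend z) p)
  simp only [dirDeriv_const, extend_self, metric, map_add, add_apply] at h1 h5 h6
  linarith

/-- `F_cyclic` is dη being closed, rewritten with ∇; `F_φ` and `F_ξ` come from differentiating φ² =
-I + η⊗ξ and φξ = 0. -/
theorem isFirstOrder (p : M) :
    IsFirstOrder (S.g.inner p) (S.η p) (S.φ p) (S.ξ p) (S.T p) (S.nablaφ p) where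
  toIsAlmostContactMetric := S.isAlmostContactMetric p
  T_symm := S.T_symm p
  T_ξ := S.T_ξ p
  F_skew := S.nablaφ_skew p
  F_cyclic x y z := by
    have hc := S.isAlmostContactMetric
    have hx := smoothAt_extend x
    have hy := smoothAt_extend y
    have hz := smoothAt_extend z
    have h1 := S.fundamental_closed hx hy hz
    rw [S.isRiemannian.dirDeriv_metric hx.diffAt hy.diffAt (S.isTensor_φ hz.diffAt),
      S.isRiemannian.dirDeriv_metric hy.diffAt hz.diffAt (S.isTensor_φ hx.diffAt),
      S.isRiemannian.dirDeriv_metric hz.diffAt hx.diffAt (S.isTensor_φ hy.diffAt),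
      ← S.isRiemannian.leviCivita_sub_swap hx.diffAt hy.diffAt,
      ← S.isRiemannian.leviCivita_sub_swap hy.diffAt hz.diffAt,
      ← S.isRiemannian.leviCivita_sub_swap hz.diffAt hx.diffAt] at h1
    have k1 := S.conn_φ hx.diffAt hz.diffAt
    have k2 := S.conn_φ hy.diffAt hx.diffAt
    have k3 := S.conn_φ hz.diffAt hy.diffAt
    simp only [conn] at k1 k2 k3
    rw [k1, k2, k3] at h1
    have s1 := (hc p).skew
    have s2 := (hc p).symm
    simp only [extend_self, metric, map_add, map_sub] at h1
    have t1 := s1 (leviCivita S.metric (extend x) (extend y) p) z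
    have t2 := s1 (leviCivita S.metric (extend y) (extend z) p) x
    have t3 := s1 (leviCivita S.metric (extend z) (extend x) p) y
    have u1 := s2 (S.φ p (leviCivita S.metric (extend x) (extend y) p)) z
    have u2 := s2 (S.φ p (leviCivita S.metric (extend y) (extend z) p)) x
    have u3 := s2 (S.φ p (leviCivita S.metric (extend z) (extend x) p)) y
    have v1 := s2 (S.nablaφ p x z) y
    have v2 := s2 (S.nablaφ p y x) z
    have v3 := s2 (S.nablaφ p z y) x
    have w1 := S.nablaφ_skew p x y z
    have w2 := S.nablaφ_skew p y z x
    have w3 := S.nablaφ_skew p z x y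
    linarith
  F_φ x y := by
    have hc := S.isAlmostContactMetric
    have hx := diffAt_extend x
    have hy := diffAt_extend y
    have h1 := S.conn_φ hx (S.isTensor_φ hy)
    rw [S.conn_φ hx hy] at h1
    have e : (fun q ↦ S.φ q (S.φ q (extend y q)))
        = (fun q ↦ -extend y q) + fun q ↦ S.η q (extend y q) • S.ξ q := by
      funext q
      exact S.φ_sq q _
    have e2 : (fun q ↦ S.metric q (extend y q) (S.ξ q)) = fun q ↦ S.η q (extend y q) := by
      funext q; exact S.g_ξ q _
    have h2 := S.isRiemannian.dirDeriv_metric hx hy (S.diffAt_ξ p)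
    have h3 := S.conn_ξ hx
    rw [e2] at h2
    simp only [conn] at h1 h3
    rw [e, S.isRiemannian.leviCivita_add hx hy.neg ((S.diffAt_ξ p).smul (S.mdifferentiableAt_η hy)),
      S.isRiemannian.leviCivita_neg hx hy,
      S.isRiemannian.leviCivita_smul hx (S.mdifferentiableAt_η hy) (S.diffAt_ξ p), h2, h3] at h1
    simp only [extend_self, metric, map_add, S.φ_sq, S.g_ξ] at h1
    rw [← sub_eq_zero] at h1 ⊢
    rw [(hc p).symm _ y, ← neg_eq_zero, ← h1]
    simp only [map_add, map_sub, map_neg]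
    module
  F_ξ x := by
    have hc := S.isAlmostContactMetric
    have hx := diffAt_extend x
    have h1 := S.conn_φ hx (S.diffAt_ξ p)
    have e : (fun q ↦ S.φ q (S.ξ q)) = fun q ↦ (0 : ℝ) • S.ξ q := by
      funext q
      rw [(hc q).φ_ξ, zero_smul]
    rw [e] at h1
    have h3 := S.conn_ξ hx
    simp only [conn] at h1 h3
    rw [S.isRiemannian.leviCivita_smul hx mdifferentiableAt_const (S.diffAt_ξ p), h3] at h1
    simp only [dirDeriv_const, zero_smul, add_zero, extend_self] at h1
    rw [eq_comm, ← eq_neg_iff_add_eq_zero] at h1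
    rw [h1, ← map_neg]
    congr 1
    abel

end ContactMetricStructure

end Contact

/-! ### Second-order identities and the curvature R(X,Y)ξ. -/

section Contact

variable {n : ℕ} {M : Type*} [TopologicalSpace M] [ChartedSpace (Model n) M]
  [IsManifold (𝓡 (2 * n + 1)) ∞ M]

namespace ContactMetricStructure

variable (S : ContactMetricStructure n M)

theorem bracket_eq {X Y : (x : M) → Tan n M x} {p : M} (hX : DiffAt X p) (hY : DiffAt Y p) :
    bracket X Y p = S.conn X Y p - S.conn Y X p :=
  (S.isRiemannian.leviCivita_sub_swap hX hY).symm

/-- Since ∇_ξ φ = 0, the Lie derivative of φ along ξ is the commutator of φ with ∇ξ, in which only T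
contributes. -/
theorem h_apply {X : (x : M) → Tan n M x} {p : M} (hX : DiffAt X p) :
    S.h X p = S.T p (S.φ p (X p)) := by
  have h0 := S.isFirstOrder p
  unfold h
  rw [S.bracket_eq (S.diffAt_ξ p) (S.isTensor_φ hX), S.bracket_eq (S.diffAt_ξ p) hX,
    S.conn_φ (S.diffAt_ξ p) hX, S.conn_ξ (S.isTensor_φ hX), S.conn_ξ hX, h0.F_ξ_left]
  simp only [map_sub, map_neg, h0.φ_T]
  module

/-- T is defined pointwise from ∇ξ, with no regularity at hand. But TX = -h(φX), and h is built from
brackets of smooth fields. -/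
theorem isTensor_T : IsTensor S.T := by
  refine IsTensor.of_smoothAt fun {X p} hX ↦ ?_
  have h1 : DiffAt (S.h fun x ↦ S.φ x (X x)) p := by
    have a1 := S.smoothAt_φ hX
    have a2 := (S.smooth_ξ p).bracket (S.smoothAt_φ a1)
    have a3 := S.smoothAt_φ ((S.smooth_ξ p).bracket a1)
    exact (a2.diffAt.sub a3.diffAt).const_smul _
  refine h1.neg.congr ?_
  filter_upwards [hX.eventually_diffAt] with x hx
  rw [S.h_apply (S.isTensor_φ hx), S.φ_sq, map_add, map_smul, S.T_ξ]
  simp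
  rfl

/-- The covariant derivative of `T`. -/
def nablaT (p : M) : Tan n M p →L[ℝ] Tan n M p →L[ℝ] Tan n M p :=
  S.isRiemannian.nablaEnd S.isTensor_T p

theorem nablaT_apply {X Y : (x : M) → Tan n M x} {p : M} (hX : DiffAt X p) (hY : DiffAt Y p) :
    S.nablaT p (X p) (Y p) = S.conn X (fun x ↦ S.T x (Y x)) p - S.T p (S.conn X Y p) :=
  S.isRiemannian.nablaEnd_apply S.isTensor_T hX hY

theorem conn_T {X Y : (x : M) → Tan n M x} {p : M} (hX : DiffAt X p) (hY : DiffAt Y p) :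
    S.conn X (fun x ↦ S.T x (Y x)) p = S.nablaT p (X p) (Y p) + S.T p (S.conn X Y p) := by
  rw [S.nablaT_apply hX hY, sub_add_cancel]

theorem nablaT_eq_zero (hT : ∀ x, S.T x = 0) (p : M) : S.nablaT p = 0 := by
  ext x y
  have hx := diffAt_extend x
  have hy := diffAt_extend y
  have h1 := S.nablaT_apply hx hy
  have e : (fun q ↦ S.T q (extend y q)) = fun q ↦ (0 : ℝ) • S.ξ q := by
    funext q
    rw [hT, zero_smul]; rfl
  rw [extend_self, extend_self] at h1
  rw [h1, e]
  simp only [conn]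
  rw [S.isRiemannian.leviCivita_smul hx mdifferentiableAt_const (S.diffAt_ξ p), hT]
  simp

/-- Obtained by differentiating the symmetry of T, φT + Tφ = 0 and Tξ = 0. -/
theorem isSecondOrder (p : M) :
    IsSecondOrder (S.g.inner p) (S.η p) (S.φ p) (S.ξ p) (S.T p) (S.nablaφ p) (S.nablaT p) where
  toIsFirstOrder := S.isFirstOrder p
  G_symm x y z := by
    have hx := diffAt_extend x
    have hy := diffAt_extend y
    have hz := diffAt_extend z
    have h1 := S.isRiemannian.dirDeriv_metric hx (S.isTensor_T hy) hz
    have h2 := S.isRiemannian.dirDeriv_metric hx hy (S.isTensor_T hz)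
    have e : (fun q ↦ S.metric q (S.T q (extend y q)) (extend z q))
        = fun q ↦ S.metric q (extend y q) (S.T q (extend z q)) := by
      funext q
      exact S.T_symm q _ _
    have h3 := S.conn_T hx hy
    have h4 := S.conn_T hx hz
    simp only [conn] at h3 h4
    rw [e, h2, h3, h4] at h1
    have h5 := S.T_symm p (leviCivita S.metric (extend x) (extend y) p) z
    have h6 := S.T_symm p y (leviCivita S.metric (extend x) (extend z) p)
    simp only [extend_self, metric, map_add, add_apply] at h1 h5 h6
    linarith
  G_φ x y := by
    have hx := diffAt_extend x
    have hy := diffAt_extend y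
    have h1 := S.conn_T hx (S.isTensor_φ hy)
    have h2 := S.conn_φ hx (S.isTensor_T hy)
    have e : (fun q ↦ S.φ q (S.T q (extend y q))) = fun q ↦ -S.T q (S.φ q (extend y q)) := by
      funext q
      exact (S.isFirstOrder q).φ_T _
    rw [e] at h2
    have h3 : S.conn (extend x) (fun q ↦ -S.T q (S.φ q (extend y q))) p = _ :=
      S.isRiemannian.leviCivita_neg hx (S.isTensor_T (S.isTensor_φ hy))
    have h4 := (S.isFirstOrder p).φ_T (S.conn (extend x) (extend y) p)
    rw [h3] at h2
    simp only [conn] at h1 h2 h4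
    have h5 := S.conn_T hx hy
    have h6 := S.conn_φ hx hy
    simp only [conn] at h5 h6
    rw [h1, h5, h6] at h2
    simp only [extend_self, map_add, h4] at h2
    rw [← sub_eq_zero] at h2
    rw [← neg_eq_zero, ← h2]
    abel
  G_ξ x := by
    have hx := diffAt_extend x
    have h1 := S.conn_T hx (S.diffAt_ξ p)
    have e : (fun q ↦ S.T q (S.ξ q)) = fun q ↦ (0 : ℝ) • S.ξ q := by
      funext q
      rw [S.T_ξ, zero_smul]
    rw [e] at h1
    have h3 := S.conn_ξ hx
    simp only [conn] at h1 h3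
    rw [S.isRiemannian.leviCivita_smul hx mdifferentiableAt_const (S.diffAt_ξ p), h3] at h1
    simp only [dirDeriv_const, zero_smul, add_zero, extend_self] at h1
    rw [eq_comm, ← eq_neg_iff_add_eq_zero] at h1
    rw [h1, ← map_neg]
    congr 1
    abel

/-- The curvature in the direction of the Reeb vector field. -/
theorem curvature_ξ {X Y : (x : M) → Tan n M x} {p : M} (hX : SmoothAt X p) (hY : SmoothAt Y p) :
    curvature S.metric X Y S.ξ p
      = -S.nablaφ p (X p) (Y p) + S.nablaφ p (Y p) (X p)
        + (-S.nablaT p (X p) (Y p) + S.nablaT p (Y p) (X p)) := by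
  have hg := S.isRiemannian
  have key : ∀ {X Y : (x : M) → Tan n M x}, SmoothAt X p → SmoothAt Y p →
      S.conn X (S.conn Y S.ξ) p = -S.nablaφ p (X p) (Y p) - S.φ p (S.conn X Y p)
        - S.nablaT p (X p) (Y p) - S.T p (S.conn X Y p) := by
    intro X Y hX hY
    have h1 : S.conn Y S.ξ =ᶠ[𝓝 p] fun x ↦ -S.φ x (Y x) - S.T x (Y x) := by
      filter_upwards [hY.eventually_diffAt] with x hx
      exact S.conn_ξ hx
    have h2 := S.conn_φ hX.diffAt hY.diffAt
    have h3 := S.conn_T hX.diffAt hY.diffAt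
    simp only [conn] at h1 h2 h3 ⊢
    rw [hg.leviCivita_congr (EventuallyEq.refl _ X) h1,
      hg.leviCivita_sub hX.diffAt (S.isTensor_φ hY.diffAt).neg (S.isTensor_T hY.diffAt),
      hg.leviCivita_neg hX.diffAt (S.isTensor_φ hY.diffAt), h2, h3]
    abel
  have k1 := key hX hY
  have k2 := key hY hX
  -- As the connection is torsion-free, this cancels the terms φ(∇_X Y), T(∇_X Y) and their mirror
  -- images.
  have k3 := S.conn_ξ (hX.bracket hY).diffAt
  rw [S.bracket_eq hX.diffAt hY.diffAt] at k3
  simp only [conn] at k1 k2 k3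
  unfold curvature
  rw [k1, k2, k3]
  simp only [map_sub]
  abel

theorem nullity_iff (κ μ : ℝ) : S.Nullity κ μ ↔ ∀ p,
    NullityRel (S.η p) (S.φ p) (S.T p) (S.nablaφ p) (S.nablaT p) 1 κ μ := by
  have key : ∀ {p : M} {X Y : (x : M) → Tan n M x}, SmoothAt X p → SmoothAt Y p →
      S.h (fun x ↦ S.η x (Y x) • X x - S.η x (X x) • Y x) p
        = S.T p (S.φ p (S.η p (Y p) • X p - S.η p (X p) • Y p)) := fun hX hY ↦
    S.h_apply ((hX.diffAt.smul (S.mdifferentiableAt_η hY.diffAt)).sub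
      (hY.diffAt.smul (S.mdifferentiableAt_η hX.diffAt)))
  constructor
  · intro h p x y
    have h1 := h p (extend x) (extend y) (smoothAt_extend x) (smoothAt_extend y)
    rw [key (smoothAt_extend x) (smoothAt_extend y)] at h1
    have h2 := S.curvature_ξ (smoothAt_extend x) (smoothAt_extend y)
    rw [h2] at h1
    simpa only [extend_self, one_smul] using h1
  · intro h p X Y hX hY
    have h2 := S.curvature_ξ hX hY
    rw [key hX hY, h2, ← h p (X p) (Y p), one_smul]

end ContactMetricStructure

end Contact

/-! ### Tangent vectors and fields on M × ℝ. -/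

section Product

variable {n : ℕ} {M : Type*} [TopologicalSpace M] [ChartedSpace (Model n) M]
  [IsManifold (𝓡 (2 * n + 1)) ∞ M]

/-- The vector field `∂ₜ` on `M × ℝ`. -/
def timeField : (x : M × ℝ) → TanProd n M x := fun _ ↦ (0, (1 : ℝ))

/-- The `M`-component of a tangent vector of `M × ℝ`. -/
def horizontal {x : M × ℝ} (v : TanProd n M x) : Tan n M x.1 := v.1

/-- The `ℝ`-component of a tangent vector of `M × ℝ`. -/
def vertical {x : M × ℝ} (v : TanProd n M x) : ℝ := v.2

/-- The tangent vector of `M × ℝ` with given components. -/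
def tanMk {x : M × ℝ} (v : Tan n M x.1) (r : ℝ) : TanProd n M x := (v, r)

section Components

variable {x : M × ℝ}

@[simp] theorem horizontal_tanMk (v : Tan n M x.1) (r : ℝ) : horizontal (tanMk v r) = v := rfl
@[simp] theorem vertical_tanMk (v : Tan n M x.1) (r : ℝ) : vertical (tanMk v r) = r := rfl
@[simp] theorem horizontal_add (v w : TanProd n M x) :
    horizontal (v + w) = horizontal v + horizontal w := rfl
@[simp] theorem vertical_add (v w : TanProd n M x) :
    vertical (v + w) = vertical v + vertical w := rfl
@[simp] theorem horizontal_sub (v w : TanProd n M x) :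
    horizontal (v - w) = horizontal v - horizontal w := rfl
@[simp] theorem vertical_sub (v w : TanProd n M x) :
    vertical (v - w) = vertical v - vertical w := rfl
@[simp] theorem horizontal_neg (v : TanProd n M x) : horizontal (-v) = -horizontal v := rfl
@[simp] theorem vertical_neg (v : TanProd n M x) : vertical (-v) = -vertical v := rfl
@[simp] theorem horizontal_smul (c : ℝ) (v : TanProd n M x) :
    horizontal (c • v) = c • horizontal v := rfl
@[simp] theorem vertical_smul (c : ℝ) (v : TanProd n M x) :
    vertical (c • v) = c * vertical v := rfl
@[simp] theorem horizontal_zero : horizontal (0 : TanProd n M x) = 0 := rfl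
@[simp] theorem vertical_zero : vertical (0 : TanProd n M x) = 0 := rfl

theorem tanProd_ext {v w : TanProd n M x} (h : horizontal v = horizontal w)
    (h' : vertical v = vertical w) : v = w := Prod.ext h h'

@[simp] theorem horizontal_lift (X : (x : M) → Tan n M x) :
    horizontal (ContactMetricStructure.lift X x) = X x.1 := rfl
@[simp] theorem vertical_lift (X : (x : M) → Tan n M x) :
    vertical (ContactMetricStructure.lift X x) = 0 := rfl
@[simp] theorem horizontal_timeField : horizontal (timeField x : TanProd n M x) = 0 := rfl
@[simp] theorem vertical_timeField : vertical (timeField x : TanProd n M x) = 1 := rfl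

end Components

open ContactMetricStructure (lift)

theorem mfderiv_fst_apply (x : M × ℝ) (v : TanProd n M x) :
    mfderiv ((𝓡 (2 * n + 1)).prod 𝓘(ℝ, ℝ)) (𝓡 (2 * n + 1)) Prod.fst x v = horizontal v := by
  rw [mfderiv_fst]; rfl

theorem mfderiv_snd_apply (x : M × ℝ) (v : TanProd n M x) :
    mfderiv ((𝓡 (2 * n + 1)).prod 𝓘(ℝ, ℝ)) 𝓘(ℝ, ℝ) Prod.snd x v = vertical v := by
  rw [mfderiv_snd]; rfl

theorem smoothAt_lift {X : (x : M) → Tan n M x} {x : M × ℝ} (hX : SmoothAt X x.1) :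
    SmoothAt (lift X) x := by
  have h1 : ContMDiffAt ((𝓡 (2 * n + 1)).prod 𝓘(ℝ, ℝ)) (𝓡 (2 * n + 1)).tangent ∞
      (fun x : M × ℝ ↦ (⟨x.1, X x.1⟩ : TangentBundle (𝓡 (2 * n + 1)) M)) x :=
    ContMDiffAt.comp x hX contMDiffAt_fst
  have h2 : ContMDiffAt ((𝓡 (2 * n + 1)).prod 𝓘(ℝ, ℝ)) 𝓘(ℝ, ℝ).tangent ∞
      (fun x : M × ℝ ↦ (⟨x.2, (0 : ℝ)⟩ : TangentBundle 𝓘(ℝ, ℝ) ℝ)) x :=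
    ContMDiffAt.comp x (contMDiffAt_vectorSpace_iff_contDiffAt.2 contDiffAt_const) contMDiffAt_snd
  exact ContMDiffAt.comp x
    (contMDiff_equivTangentBundleProd_symm (I := 𝓡 (2 * n + 1)) (I' := 𝓘(ℝ, ℝ))).contMDiffAt
    (h1.prodMk h2)

theorem diffAt_lift {X : (x : M) → Tan n M x} {x : M × ℝ} (hX : DiffAt X x.1) :
    DiffAt (lift X) x := by
  have h1 : MDifferentiableAt ((𝓡 (2 * n + 1)).prod 𝓘(ℝ, ℝ)) (𝓡 (2 * n + 1)).tangent
      (fun x : M × ℝ ↦ (⟨x.1, X x.1⟩ : TangentBundle (𝓡 (2 * n + 1)) M)) x :=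
    MDifferentiableAt.comp x hX mdifferentiableAt_fst
  have h2 : ContMDiffAt ((𝓡 (2 * n + 1)).prod 𝓘(ℝ, ℝ)) 𝓘(ℝ, ℝ).tangent ∞
      (fun x : M × ℝ ↦ (⟨x.2, (0 : ℝ)⟩ : TangentBundle 𝓘(ℝ, ℝ) ℝ)) x :=
    ContMDiffAt.comp x (contMDiffAt_vectorSpace_iff_contDiffAt.2 contDiffAt_const) contMDiffAt_snd
  exact MDifferentiableAt.comp x
    ((contMDiff_equivTangentBundleProd_symm (I := 𝓡 (2 * n + 1)) (I' := 𝓘(ℝ, ℝ))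
      (n := ∞)).mdifferentiableAt (by simp))
    (h1.prodMk (h2.mdifferentiableAt (by simp)))

theorem smoothAt_timeField (x : M × ℝ) : SmoothAt (timeField (n := n) (M := M)) x := by
  have h0 : ContMDiffAt (𝓡 (2 * n + 1)) (𝓡 (2 * n + 1)).tangent ∞
      (fun x : M ↦ (⟨x, 0⟩ : TangentBundle (𝓡 (2 * n + 1)) M)) x.1 :=
    (Bundle.contMDiff_zeroSection ℝ (TangentSpace (𝓡 (2 * n + 1)) (M := M))).contMDiffAt
  have h1 : ContMDiffAt ((𝓡 (2 * n + 1)).prod 𝓘(ℝ, ℝ)) (𝓡 (2 * n + 1)).tangent ∞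
      (fun x : M × ℝ ↦ (⟨x.1, 0⟩ : TangentBundle (𝓡 (2 * n + 1)) M)) x :=
    ContMDiffAt.comp x h0 contMDiffAt_fst
  have h2 : ContMDiffAt ((𝓡 (2 * n + 1)).prod 𝓘(ℝ, ℝ)) 𝓘(ℝ, ℝ).tangent ∞
      (fun x : M × ℝ ↦ (⟨x.2, (1 : ℝ)⟩ : TangentBundle 𝓘(ℝ, ℝ) ℝ)) x :=
    ContMDiffAt.comp x (contMDiffAt_vectorSpace_iff_contDiffAt.2 contDiffAt_const) contMDiffAt_snd
  exact ContMDiffAt.comp x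
    (contMDiff_equivTangentBundleProd_symm (I := 𝓡 (2 * n + 1)) (I' := 𝓘(ℝ, ℝ))).contMDiffAt
    (h1.prodMk h2)

theorem diffAt_timeField (x : M × ℝ) : DiffAt (timeField (n := n) (M := M)) x :=
  (smoothAt_timeField x).diffAt

theorem DiffAt.horizontal {Z : (x : M × ℝ) → TanProd n M x} {x : M × ℝ} (hZ : DiffAt Z x) :
    MDifferentiableAt ((𝓡 (2 * n + 1)).prod 𝓘(ℝ, ℝ)) (𝓡 (2 * n + 1)).tangent
      (fun x ↦ (⟨x.1, horizontal (Z x)⟩ : TangentBundle (𝓡 (2 * n + 1)) M)) x := by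
  have h1 := (contMDiff_fst (I := 𝓡 (2 * n + 1)) (J := 𝓘(ℝ, ℝ)) (M := M) (N := ℝ)
    (n := ∞)).contMDiff_tangentMap (m := ∞) (by simp)
  have h2 := MDifferentiableAt.comp x (h1.mdifferentiableAt (by simp)) hZ
  refine h2.congr_of_eventuallyEq (Eventually.of_forall fun y ↦ ?_)
  simp only [Function.comp, tangentMap_prodFst]
  rfl

theorem DiffAt.vertical {Z : (x : M × ℝ) → TanProd n M x} {x : M × ℝ} (hZ : DiffAt Z x) :
    MDifferentiableAt ((𝓡 (2 * n + 1)).prod 𝓘(ℝ, ℝ)) 𝓘(ℝ, ℝ) (fun x ↦ vertical (Z x)) x := by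
  have h1 : ContMDiffAt ((𝓡 (2 * n + 1)).prod 𝓘(ℝ, ℝ)) 𝓘(ℝ, ℝ) 2 (Prod.snd : M × ℝ → ℝ) x :=
    contMDiffAt_snd
  refine (mdifferentiableAt_mvfderiv h1 hZ).congr_of_eventuallyEq
    (Eventually.of_forall fun y ↦ ?_)
  exact (mfderiv_snd_apply y (Z y)).symm

theorem mdifferentiableAt_comp_fst {f : M → ℝ} {x : M × ℝ}
    (hf : MDifferentiableAt (𝓡 (2 * n + 1)) 𝓘(ℝ, ℝ) f x.1) :
    MDifferentiableAt ((𝓡 (2 * n + 1)).prod 𝓘(ℝ, ℝ)) 𝓘(ℝ, ℝ) (fun x : M × ℝ ↦ f x.1) x :=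
  MDifferentiableAt.comp x hf mdifferentiableAt_fst

theorem mdifferentiableAt_comp_snd {c : ℝ → ℝ} {x : M × ℝ} (hc : DifferentiableAt ℝ c x.2) :
    MDifferentiableAt ((𝓡 (2 * n + 1)).prod 𝓘(ℝ, ℝ)) 𝓘(ℝ, ℝ) (fun x : M × ℝ ↦ c x.2) x :=
  MDifferentiableAt.comp x hc.mdifferentiableAt mdifferentiableAt_snd

theorem dirDeriv_comp_fst (Z : (x : M × ℝ) → TanProd n M x) {f : M → ℝ} {x : M × ℝ}
    (hf : MDifferentiableAt (𝓡 (2 * n + 1)) 𝓘(ℝ, ℝ) f x.1) :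
    dirDeriv Z (fun x : M × ℝ ↦ f x.1) x = mvfderiv (𝓡 (2 * n + 1)) f x.1 (horizontal (Z x)) := by
  have h1 := mvfderiv_comp_mfderiv (I := (𝓡 (2 * n + 1)).prod 𝓘(ℝ, ℝ)) (F := Prod.fst) (x := x) hf
    mdifferentiableAt_fst (Z x)
  rw [mfderiv_fst_apply] at h1
  exact h1

theorem dirDeriv_comp_snd (Z : (x : M × ℝ) → TanProd n M x) {c : ℝ → ℝ} {x : M × ℝ} {c' : ℝ}
    (hc : HasDerivAt c c' x.2) : dirDeriv Z (fun x : M × ℝ ↦ c x.2) x = vertical (Z x) * c' := by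
  have h1 := mvfderiv_comp_mfderiv (I := (𝓡 (2 * n + 1)).prod 𝓘(ℝ, ℝ)) (F := Prod.snd) (x := x)
    hc.differentiableAt.mdifferentiableAt mdifferentiableAt_snd (Z x)
  rw [mfderiv_snd_apply] at h1
  refine h1.trans ?_
  have h2 : mvfderiv 𝓘(ℝ, ℝ) c x.2 = fderiv ℝ c x.2 := by
    unfold mvfderiv
    rw [mfderiv_eq_fderiv]
    rfl
  rw [h2, hc.hasFDerivAt.fderiv]
  rfl

/-- The first projection is no diffeomorphism, so the fields must be projectable; then they are
related to their projections. -/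
theorem horizontal_bracket {Z W : (x : M × ℝ) → TanProd n M x} {Z' W' : (x : M) → Tan n M x}
    {x : M × ℝ} (hZ : ∀ x, horizontal (Z x) = Z' x.1) (hW : ∀ x, horizontal (W x) = W' x.1)
    (dZ : DiffAt Z x) (dW : DiffAt W x) (dZ' : DiffAt Z' x.1) (dW' : DiffAt W' x.1) :
    horizontal (bracket Z W x) = bracket Z' W' x.1 := by
  rw [← mfderiv_fst_apply]
  refine mfderiv_bracket_of_related contMDiff_fst (fun y ↦ ?_) (fun y ↦ ?_) dZ dW dZ' dW'
  · rw [mfderiv_fst_apply, hZ]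
  · rw [mfderiv_fst_apply, hW]

theorem bracket_vectorSpace {V W : (x : ℝ) → TangentSpace 𝓘(ℝ, ℝ) x} (t : ℝ) :
    bracket V W t = fderiv ℝ W t (V t) - fderiv ℝ V t (W t) := by
  unfold bracket
  rw [← VectorField.mlieBracketWithin_univ, VectorField.mlieBracketWithin_eq_lieBracketWithin]
  exact congrFun (VectorField.lieBracketWithin_univ (𝕜 := ℝ) (E := ℝ)) t

theorem bracket_const (r s : ℝ) (t : ℝ) :
    bracket (I := 𝓘(ℝ, ℝ)) (M := ℝ) (fun _ ↦ r) (fun _ ↦ s) t = (0 : ℝ) := by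
  refine (bracket_vectorSpace t).trans ?_
  have h1 (r t : ℝ) : fderiv ℝ (fun _ : ℝ ↦ r) t = 0 := by simp
  have h2 : fderiv ℝ (fun _ : ℝ ↦ s) t r - fderiv ℝ (fun _ : ℝ ↦ r) t s = 0 := by
    rw [h1, h1]; simp
  exact h2

theorem vertical_bracket {Z W : (x : M × ℝ) → TanProd n M x} {r s : ℝ}
    {x : M × ℝ} (hZ : ∀ x, vertical (Z x) = r) (hW : ∀ x, vertical (W x) = s)
    (dZ : DiffAt Z x) (dW : DiffAt W x) :
    vertical (bracket Z W x) = 0 := by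
  rw [← mfderiv_snd_apply]
  have hd (r : ℝ) (t : ℝ) : DiffAt (I := 𝓘(ℝ, ℝ)) (M := ℝ) (fun _ ↦ r) t :=
    (contMDiffAt_vectorSpace_iff_contDiffAt (n := ∞).2 contDiffAt_const).mdifferentiableAt
      (by simp)
  rw [mfderiv_bracket_of_related (X' := fun _ ↦ r) (Y' := fun _ ↦ s) contMDiff_snd
    (fun y ↦ ?_) (fun y ↦ ?_) dZ dW (hd _ _) (hd _ _)]
  · exact bracket_const r s x.2
  · rw [mfderiv_snd_apply, hZ]
  · rw [mfderiv_snd_apply, hW]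

theorem bracket_lift {X Y : (x : M) → Tan n M x} {x : M × ℝ} (hX : DiffAt X x.1)
    (hY : DiffAt Y x.1) : bracket (lift X) (lift Y) x = lift (bracket X Y) x :=
  tanProd_ext
    (horizontal_bracket (fun _ ↦ rfl) (fun _ ↦ rfl) (diffAt_lift hX) (diffAt_lift hY) hX hY)
    (vertical_bracket (fun _ ↦ rfl) (fun _ ↦ rfl) (diffAt_lift hX) (diffAt_lift hY))

theorem bracket_lift_timeField {X : (x : M) → Tan n M x} {x : M × ℝ} (hX : DiffAt X x.1) :
    bracket (lift X) timeField x = 0 := by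
  have h0 : DiffAt (0 : (x : M) → Tan n M x) x.1 := by
    simpa using! hX.const_smul 0
  refine tanProd_ext ?_
    (vertical_bracket (fun _ ↦ rfl) (fun _ ↦ rfl) (diffAt_lift hX) (diffAt_timeField x))
  rw [horizontal_bracket (Z := lift X) (W := timeField) (W' := 0) (fun _ ↦ rfl) (fun _ ↦ rfl) (diffAt_lift hX) (diffAt_timeField x)
    hX h0]
  unfold bracket
  rw [VectorField.mlieBracket_zero_right]
  rfl

theorem bracket_timeField_lift {X : (x : M) → Tan n M x} {x : M × ℝ} (hX : DiffAt X x.1) :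
    bracket timeField (lift X) x = 0 := by
  rw [bracket_swap, bracket_lift_timeField hX, neg_zero]

end Product

/-! ### The metric g_t + dt² and its derivatives. -/

section Symplectization

variable {n : ℕ} {M : Type*} [TopologicalSpace M] [ChartedSpace (Model n) M]
  [IsManifold (𝓡 (2 * n + 1)) ∞ M]

namespace ContactMetricStructure

variable (S : ContactMetricStructure n M)

theorem sympMetric_eq (x : M × ℝ) (v w : TanProd n M x) : S.sympMetric x v w
    = Real.exp (2 * x.2) * S.metric x.1 (horizontal v) (horizontal w)
      + Real.exp (2 * x.2) * (Real.exp (2 * x.2) - 1)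
        * (S.η x.1 (horizontal v) * S.η x.1 (horizontal w)) + vertical v * vertical w := rfl

theorem mdifferentiableAt_metric_horizontal {Z W : (x : M × ℝ) → TanProd n M x} {x : M × ℝ}
    (hZ : DiffAt Z x) (hW : DiffAt W x) :
    MDifferentiableAt ((𝓡 (2 * n + 1)).prod 𝓘(ℝ, ℝ)) 𝓘(ℝ, ℝ)
      (fun x ↦ S.metric x.1 (horizontal (Z x)) (horizontal (W x))) x := by
  have h1 : MDifferentiableAt ((𝓡 (2 * n + 1)).prod 𝓘(ℝ, ℝ)) ((𝓡 (2 * n + 1)).prod 𝓘(ℝ, ℝ))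
      (fun m : M × ℝ ↦ Bundle.TotalSpace.mk' ℝ (E := Bundle.Trivial M ℝ) m.1
        (S.g.inner m.1 (horizontal (Z m)) (horizontal (W m)))) x := by
    apply MDifferentiableAt.clm_bundle_apply₂ (F₁ := Model n) (F₂ := Model n)
    · exact MDifferentiableAt.comp x (S.g.contMDiff.mdifferentiableAt (by simp))
        mdifferentiableAt_fst
    · exact hZ.horizontal
    · exact hW.horizontal
  simp only [mdifferentiableAt_totalSpace] at h1
  exact h1.2

theorem mdifferentiableAt_η_horizontal {Z : (x : M × ℝ) → TanProd n M x} {x : M × ℝ}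
    (hZ : DiffAt Z x) :
    MDifferentiableAt ((𝓡 (2 * n + 1)).prod 𝓘(ℝ, ℝ)) 𝓘(ℝ, ℝ)
      (fun x ↦ S.η x.1 (horizontal (Z x))) x := by
  have h1 := S.mdifferentiableAt_metric_horizontal hZ (diffAt_lift (S.diffAt_ξ x.1))
  simpa only [metric, horizontal_lift, S.g_ξ] using h1

theorem hasDerivAt_exp_two_mul (t : ℝ) :
    HasDerivAt (fun t ↦ Real.exp (2 * t)) (2 * Real.exp (2 * t)) t := by
  have := ((hasDerivAt_id t).const_mul 2).exp
  simpa [mul_comm] using this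

theorem isRiemannian_sympMetric : IsRiemannian S.sympMetric where
  add_left x u v w := by
    simp only [S.sympMetric_eq, horizontal_add, vertical_add, metric, map_add, add_apply]
    ring
  smul_left x c u v := by
    simp only [S.sympMetric_eq, horizontal_smul, vertical_smul, metric, map_smul, smul_apply,
      smul_eq_mul]
    ring
  symm x u v := by
    simp only [S.sympMetric_eq, metric]
    rw [S.g.symm]
    ring
  pos x v hv := by
    rw [S.sympMetric_eq]
    have ha := Real.exp_pos (2 * x.2)
    have hc := S.isAlmostContactMetric x.1
    -- The coefficient e^{2t} - 1 is negative for t < 0. Removing the ξ-component of v gives g(v,v)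
    -- ≥ η(v)², and with a = e^{2t} the form g_t becomes a(g - η²) + (aη)².
    have h1 : S.metric x.1 (horizontal v - S.η x.1 (horizontal v) • S.ξ x.1)
        (horizontal v - S.η x.1 (horizontal v) • S.ξ x.1)
          = S.metric x.1 (horizontal v) (horizontal v) - S.η x.1 (horizontal v) ^ 2 := by
      simp only [metric, map_sub, map_smul, sub_apply, smul_apply, smul_eq_mul, hc.g_ξ, hc.ξ_g,
        hc.η_ξ]
      ring
    have h2 : 0 ≤ S.metric x.1 (horizontal v) (horizontal v) - S.η x.1 (horizontal v) ^ 2 := by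
      rw [← h1]
      by_cases h : horizontal v - S.η x.1 (horizontal v) • S.ξ x.1 = 0
      · rw [h]; simp [metric]
      · exact (S.g.pos x.1 _ h).le
    have e : Real.exp (2 * x.2) * S.metric x.1 (horizontal v) (horizontal v)
      + Real.exp (2 * x.2) * (Real.exp (2 * x.2) - 1)
        * (S.η x.1 (horizontal v) * S.η x.1 (horizontal v)) + vertical v * vertical v
      = Real.exp (2 * x.2) * (S.metric x.1 (horizontal v) (horizontal v)
        - S.η x.1 (horizontal v) ^ 2) + (Real.exp (2 * x.2) * S.η x.1 (horizontal v)) ^ 2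
        + vertical v ^ 2 := by ring
    rw [e]
    have h3 := mul_nonneg ha.le h2
    rcases eq_or_ne (vertical v) 0 with hv' | hv'
    · rcases eq_or_ne (S.η x.1 (horizontal v)) 0 with h4 | h4
      · have h5 : horizontal v ≠ 0 := fun h5 ↦ hv (tanProd_ext h5 hv')
        have h6 := mul_pos ha (S.g.pos x.1 _ h5)
        rw [h4, hv']
        simp only [metric]
        linarith
      · have := pow_pos (mul_pos ha (abs_pos.2 h4)) 2
        rw [mul_pow, sq_abs, ← mul_pow] at this
        positivity
    · positivity
  mdiff {Z W x} hZ hW := by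
    have ha : MDifferentiableAt ((𝓡 (2 * n + 1)).prod 𝓘(ℝ, ℝ)) 𝓘(ℝ, ℝ)
        (fun x : M × ℝ ↦ Real.exp (2 * x.2)) x :=
      mdifferentiableAt_comp_snd (hasDerivAt_exp_two_mul x.2).differentiableAt
    have hb : MDifferentiableAt ((𝓡 (2 * n + 1)).prod 𝓘(ℝ, ℝ)) 𝓘(ℝ, ℝ)
        (fun x : M × ℝ ↦ Real.exp (2 * x.2) * (Real.exp (2 * x.2) - 1)) x :=
      ha.mul (ha.sub mdifferentiableAt_const)
    exact ((ha.mul (S.mdifferentiableAt_metric_horizontal hZ hW)).add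
      (hb.mul ((S.mdifferentiableAt_η_horizontal hZ).mul (S.mdifferentiableAt_η_horizontal hW)))).add
      (hZ.vertical.mul hW.vertical)

section Connection

variable {X Y Z : (x : M) → Tan n M x} {x : M × ℝ}

theorem sympMetric_lift (Y Z : (x : M) → Tan n M x) (x : M × ℝ) :
    S.sympMetric x (lift Y x) (lift Z x) = Real.exp (2 * x.2) * S.metric x.1 (Y x.1) (Z x.1)
      + Real.exp (2 * x.2) * (Real.exp (2 * x.2) - 1) * (S.η x.1 (Y x.1) * S.η x.1 (Z x.1)) := by
  rw [S.sympMetric_eq]; simp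

theorem sympMetric_lift_timeField (Y : (x : M) → Tan n M x) (x : M × ℝ) :
    S.sympMetric x (lift Y x) (timeField x) = 0 := by
  rw [S.sympMetric_eq]; simp [metric]

theorem sympMetric_timeField_lift (Y : (x : M) → Tan n M x) (x : M × ℝ) :
    S.sympMetric x (timeField x) (lift Y x) = 0 := by
  rw [S.sympMetric_eq]; simp [metric]

theorem sympMetric_timeField_timeField (x : M × ℝ) :
    S.sympMetric x (timeField x) (timeField x) = 1 := by
  rw [S.sympMetric_eq]; simp [metric]

theorem mdifferentiableAt_fun_mul {f g : M × ℝ → ℝ} {x : M × ℝ}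
    (hf : MDifferentiableAt ((𝓡 (2 * n + 1)).prod 𝓘(ℝ, ℝ)) 𝓘(ℝ, ℝ) f x)
    (hg : MDifferentiableAt ((𝓡 (2 * n + 1)).prod 𝓘(ℝ, ℝ)) 𝓘(ℝ, ℝ) g x) :
    MDifferentiableAt ((𝓡 (2 * n + 1)).prod 𝓘(ℝ, ℝ)) 𝓘(ℝ, ℝ) (fun y ↦ f y * g y) x :=
  hf.mul hg

/-- With a = e^{2t} one has a' = 2a and (a(a-1))' = 4a² - 2a, which are the coefficients in the ∂ₜ
part. -/
theorem dirDeriv_sympMetric_lift (V : (x : M × ℝ) → TanProd n M x) (hY : DiffAt Y x.1)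
    (hZ : DiffAt Z x.1) :
    dirDeriv V (fun x ↦ S.sympMetric x (lift Y x) (lift Z x)) x
      = Real.exp (2 * x.2) * mvfderiv (𝓡 (2 * n + 1)) (fun x ↦ S.metric x (Y x) (Z x)) x.1
          (horizontal (V x))
        + Real.exp (2 * x.2) * (Real.exp (2 * x.2) - 1)
          * (S.η x.1 (Y x.1) * mvfderiv (𝓡 (2 * n + 1)) (fun x ↦ S.η x (Z x)) x.1 (horizontal (V x))
            + mvfderiv (𝓡 (2 * n + 1)) (fun x ↦ S.η x (Y x)) x.1 (horizontal (V x))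
              * S.η x.1 (Z x.1))
        + vertical (V x) * (2 * Real.exp (2 * x.2) * S.metric x.1 (Y x.1) (Z x.1)
          + (4 * Real.exp (2 * x.2) ^ 2 - 2 * Real.exp (2 * x.2))
            * (S.η x.1 (Y x.1) * S.η x.1 (Z x.1))) := by
  have hc := hasDerivAt_exp_two_mul x.2
  have hc2 : HasDerivAt (fun t ↦ Real.exp (2 * t) * (Real.exp (2 * t) - 1)) _ x.2 :=
    hc.mul (hc.sub_const 1)
  have e1 := dirDeriv_comp_snd V hc
  have e2 := dirDeriv_comp_snd V hc2
  have e3 := dirDeriv_comp_fst V (S.mdifferentiableAt_metric hY hZ)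
  have e4 := dirDeriv_comp_fst V (S.mdifferentiableAt_η hY)
  have e5 := dirDeriv_comp_fst V (S.mdifferentiableAt_η hZ)
  have m1 := mdifferentiableAt_comp_snd (n := n) (M := M) hc.differentiableAt
  have m2 := mdifferentiableAt_comp_snd (n := n) (M := M) hc2.differentiableAt
  have m3 := mdifferentiableAt_comp_fst (S.mdifferentiableAt_metric hY hZ)
  have m4 := mdifferentiableAt_comp_fst (S.mdifferentiableAt_η hY)
  have m5 := mdifferentiableAt_comp_fst (S.mdifferentiableAt_η hZ)
  rw [funext (S.sympMetric_lift Y Z),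
    dirDeriv_add (mdifferentiableAt_fun_mul m1 m3)
      (mdifferentiableAt_fun_mul m2 (mdifferentiableAt_fun_mul m4 m5)),
    dirDeriv_mul m1 m3, dirDeriv_mul m2 (mdifferentiableAt_fun_mul m4 m5), dirDeriv_mul m4 m5, e1, e2, e3, e4, e5]
  ring

/-- To identify `∇_X Y` at a point of the symplectization it suffices to test the Koszul formula
with lifts of fields on `M` and with `∂ₜ`. -/
theorem leviCivita_symp_unique {X Y : (x : M × ℝ) → TanProd n M x} {x : M × ℝ} (hX : DiffAt X x)
    (hY : DiffAt Y x) {v : TanProd n M x}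
    (h1 : ∀ Z : (x : M) → Tan n M x, DiffAt Z x.1 →
      2 * S.sympMetric x v (lift Z x) = koszul S.sympMetric X Y (lift Z) x)
    (h2 : 2 * S.sympMetric x v (timeField x) = koszul S.sympMetric X Y timeField x) :
    leviCivita S.sympMetric X Y x = v := by
  have hg := S.isRiemannian_sympMetric
  refine hg.leviCivita_unique hX hY fun w ↦
    ⟨lift (extend (horizontal w)) + fun y ↦ vertical w • timeField y, ?_, ?_, ?_⟩
  · exact (diffAt_lift (diffAt_extend _)).add ((diffAt_timeField x).const_smul _)
  · refine tanProd_ext ?_ ?_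
    · simp
    · simp
  · have ht := hg.tensorialAt_koszul hX hY
    have a1 := ht.add (diffAt_lift (diffAt_extend (horizontal w)))
      ((diffAt_timeField x).const_smul (vertical w))
    have a2 := ht.smul (f := fun _ ↦ vertical w) mdifferentiableAt_const (diffAt_timeField x)
    have a3 := h1 _ (diffAt_extend (horizontal w))
    refine Eq.trans ?_ a1.symm
    refine Eq.trans ?_ (congrArg₂ (· + ·) a3 a2.symm)
    simp only [smul_eq_mul]
    rw [← h2]
    have e : w = lift (extend (horizontal w)) x + vertical w • timeField x :=
      tanProd_ext (by simp) (by simp)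
    conv_lhs => rw [e]
    rw [hg.add_right, hg.smul_right]
    ring

end Connection

end ContactMetricStructure

end Symplectization

/-! ### The Levi-Civita connection of the metric symplectization. -/

section Symplectization

variable {n : ℕ} {M : Type*} [TopologicalSpace M] [ChartedSpace (Model n) M]
  [IsManifold (𝓡 (2 * n + 1)) ∞ M]

namespace ContactMetricStructure

variable (S : ContactMetricStructure n M)

theorem dirDeriv_η {X Y : (x : M) → Tan n M x} {p : M} (hX : DiffAt X p) (hY : DiffAt Y p) :
    dirDeriv X (fun x ↦ S.η x (Y x)) p = S.η p (S.conn X Y p) - S.metric p (Y p) (S.φ p (X p))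
      - S.metric p (Y p) (S.T p (X p)) := by
  have h1 := S.isRiemannian.dirDeriv_metric hX hY (S.diffAt_ξ p)
  have h2 := S.conn_ξ hX
  have e : (fun x ↦ S.metric x (Y x) (S.ξ x)) = fun x ↦ S.η x (Y x) := by
    funext x; exact S.g_ξ x _
  simp only [conn] at h2 ⊢
  rw [e, h2] at h1
  rw [h1]
  simp only [metric, S.g_ξ, map_sub, map_neg]
  ring

section Connection

variable {X Y : (x : M) → Tan n M x} {x : M × ℝ}

/-- The Levi-Civita connection of the metric symplectization on fields tangent to `M`. -/
theorem leviCivita_lift (hX : DiffAt X x.1) (hY : DiffAt Y x.1) :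
    leviCivita S.sympMetric (lift X) (lift Y) x
      = tanMk (S.conn X Y x.1
          + (1 - Real.exp (2 * x.2)) • (S.η x.1 (Y x.1) • S.φ x.1 (X x.1)
            + S.η x.1 (X x.1) • S.φ x.1 (Y x.1))
          + ((1 - Real.exp (2 * x.2)) / Real.exp (2 * x.2)
            * S.metric x.1 (S.T x.1 (X x.1)) (Y x.1)) • S.ξ x.1)
        (-(Real.exp (2 * x.2) * S.metric x.1 (X x.1) (Y x.1)
          + (2 * Real.exp (2 * x.2) ^ 2 - Real.exp (2 * x.2))
            * (S.η x.1 (X x.1) * S.η x.1 (Y x.1)))) := by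
  refine S.leviCivita_symp_unique (diffAt_lift hX) (diffAt_lift hY) (fun Z hZ ↦ ?_) ?_
  · have hc := S.isAlmostContactMetric x.1
    have h0 := S.isFirstOrder x.1
    have k := S.isRiemannian.leviCivita_koszul hX hY hZ
    have d1 := S.dOneForm_eq hX hY
    have d2 := S.dOneForm_eq hX hZ
    have d3 := S.dOneForm_eq hY hZ
    have d4 := S.dirDeriv_η hX hY
    have b1 := bracket_swap Z X x.1
    have s1 := hc.skew (X x.1) (Y x.1)
    have s2 := hc.symm (S.φ x.1 (X x.1)) (Y x.1)
    have s3 := hc.skew (X x.1) (Z x.1)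
    have s4 := hc.skew (Y x.1) (Z x.1)
    have s5 := hc.symm (S.T x.1 (X x.1)) (Y x.1)
    unfold koszul at k ⊢
    unfold dOneForm at d1 d2 d3
    rw [S.dirDeriv_sympMetric_lift _ hY hZ, S.dirDeriv_sympMetric_lift _ hZ hX,
      S.dirDeriv_sympMetric_lift _ hX hY, bracket_lift hX hY, bracket_lift hY hZ,
      bracket_lift hZ hX, S.sympMetric_lift, S.sympMetric_lift, S.sympMetric_lift, S.sympMetric_eq]
    simp only [horizontal_lift, vertical_lift, horizontal_tanMk, vertical_tanMk, metric, dirDeriv,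
      conn, map_add, map_neg, map_smul, add_apply, smul_apply, smul_eq_mul, hc.ξ_g, hc.η_φ,
      hc.η_ξ, b1, neg_apply] at k d1 d2 d3 d4 s1 s2 s3 s4 s5 ⊢
    -- With the quotient named, ab = 1 - a is all that is needed about it and the identity becomes
    -- polynomial: a times the Koszul formula on M, corrected by multiples of dη.
    obtain ⟨b, hb⟩ : ∃ b, b = (1 - Real.exp (2 * x.2)) / Real.exp (2 * x.2) := ⟨_, rfl⟩
    have hb' : Real.exp (2 * x.2) * b = 1 - Real.exp (2 * x.2) := by
      rw [hb]; field_simp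
    rw [← hb]
    generalize Real.exp (2 * x.2) = a at *
    linear_combination a * k - 2 * a * (a - 1) * (S.η x.1 (Y x.1) * (d2 + s3)
      + S.η x.1 (X x.1) * (d3 + s4) + S.η x.1 (Z x.1) * (d4 - d1 - s1 + s2 + s5))
      + 2 * a * S.η x.1 (Z x.1) * S.g.inner x.1 (S.T x.1 (X x.1)) (Y x.1) * hb'
  · have hg := S.isRiemannian_sympMetric
    unfold koszul
    rw [funext (S.sympMetric_lift_timeField Y), funext (S.sympMetric_timeField_lift X),
      dirDeriv_const, dirDeriv_const, S.dirDeriv_sympMetric_lift _ hX hY, bracket_lift hX hY,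
      bracket_lift_timeField hY, bracket_timeField_lift hX, S.sympMetric_lift_timeField]
    have e (v : TanProd n M x) : S.sympMetric x 0 v = 0 := by simp [S.sympMetric_eq, metric]
    rw [e, e, S.sympMetric_eq]
    simp only [horizontal_tanMk, vertical_tanMk, horizontal_timeField, vertical_timeField,
      metric, map_zero]
    ring

/-- Only the t-derivative of g_t enters the Koszul formula, and ∂ₜ g_t(X,Z) = 2 g_t(X + η(X)ξ, Z).
-/
theorem leviCivita_lift_timeField (hX : DiffAt X x.1) :
    leviCivita S.sympMetric (lift X) timeField x
      = tanMk (X x.1 + S.η x.1 (X x.1) • S.ξ x.1) 0 := by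
  have hc := S.isAlmostContactMetric x.1
  have e (v : TanProd n M x) : S.sympMetric x 0 v = 0 := by simp [S.sympMetric_eq, metric]
  refine S.leviCivita_symp_unique (diffAt_lift hX) (diffAt_timeField x) (fun Z hZ ↦ ?_) ?_
  · unfold koszul
    rw [funext (S.sympMetric_lift_timeField X), funext (S.sympMetric_timeField_lift Z),
      dirDeriv_const, dirDeriv_const, S.dirDeriv_sympMetric_lift _ hZ hX, bracket_lift hZ hX,
      bracket_lift_timeField hX, bracket_timeField_lift hZ, S.sympMetric_lift_timeField, e, e,
      S.sympMetric_eq]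
    simp only [horizontal_lift, vertical_lift, horizontal_tanMk, vertical_tanMk, metric,
      horizontal_timeField, vertical_timeField, map_zero, map_add, map_smul, add_apply, smul_apply,
      smul_eq_mul, hc.ξ_g, hc.η_ξ]
    rw [hc.symm (X x.1)]
    ring
  · unfold koszul
    rw [funext S.sympMetric_timeField_timeField, funext (S.sympMetric_timeField_lift X),
      funext (S.sympMetric_lift_timeField X),
      dirDeriv_const, dirDeriv_const, bracket_lift_timeField hX, bracket_timeField_lift hX]
    have e2 : bracket timeField timeField x = (0 : TanProd n M x) := by
      exact congrFun VectorField.mlieBracket_self x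
    rw [e2, e, e, S.sympMetric_eq]
    simp [metric]

end Connection

end ContactMetricStructure

end Symplectization

/-! ### The curvature of the metric symplectization on ξ_t. -/

section Symplectization

variable {n : ℕ} {M : Type*} [TopologicalSpace M] [ChartedSpace (Model n) M]
  [IsManifold (𝓡 (2 * n + 1)) ∞ M]

namespace ContactMetricStructure

variable (S : ContactMetricStructure n M)

section Curvature

variable {X Y : (x : M) → Tan n M x} {x : M × ℝ}

theorem hasDerivAt_exp_neg_two_mul (t : ℝ) :
    HasDerivAt (fun t ↦ Real.exp (-2 * t)) (-2 * Real.exp (-2 * t)) t := by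
  have := ((hasDerivAt_id t).const_mul (-2)).exp
  simpa [mul_comm] using this

theorem exp_neg_two_mul (t : ℝ) : Real.exp (-2 * t) = (Real.exp (2 * t))⁻¹ := by
  rw [← Real.exp_neg, neg_mul]

/-- Lifts have no ∂ₜ component, so the factor e^{-2t} passes through the derivative. -/
theorem leviCivita_ξt (hY : DiffAt Y x.1) :
    leviCivita S.sympMetric (lift Y) S.ξt x
      = tanMk (-S.φ x.1 (Y x.1) - Real.exp (-2 * x.2) • S.T x.1 (Y x.1))
          (-(2 * Real.exp (2 * x.2) * S.η x.1 (Y x.1))) := by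
  have hg := S.isRiemannian_sympMetric
  have hc := S.isAlmostContactMetric x.1
  have h0 := S.isFirstOrder x.1
  have e : S.ξt = fun x : M × ℝ ↦ Real.exp (-2 * x.2) • lift S.ξ x := by
    funext y
    refine tanProd_ext rfl ?_
    change (0 : ℝ) = Real.exp (-2 * y.2) * 0
    rw [mul_zero]
  have ha := (Real.exp_pos (2 * x.2)).ne'
  have hd := hasDerivAt_exp_neg_two_mul x.2
  rw [e, hg.leviCivita_smul (diffAt_lift hY) (mdifferentiableAt_comp_snd hd.differentiableAt)
    (diffAt_lift (S.diffAt_ξ _)), dirDeriv_comp_snd _ hd, S.leviCivita_lift hY (S.diffAt_ξ _),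
    S.conn_ξ hY, hc.φ_ξ, hc.η_ξ, exp_neg_two_mul]
  simp only [metric, hc.g_ξ, h0.η_T]
  generalize Real.exp (2 * x.2) = a at *
  refine tanProd_ext ?_ ?_
  · simp only [vertical_lift, zero_mul, zero_smul, zero_add, horizontal_smul, horizontal_tanMk]
    match_scalars <;> field_simp <;> ring
  · simp only [vertical_lift, zero_mul, zero_smul, zero_add, vertical_smul, vertical_tanMk]
    field_simp
    ring

/-- The ∂ₜ component of ∇_Y ξ_t contributes -2e^{2t}η(Y)(X + η(X)ξ) to the tangential part. All
multiples of ξ here turn out symmetric in X and Y, so they are harmless for the curvature. -/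
theorem leviCivita_leviCivita_ξt (hX : DiffAt X x.1) (hY : SmoothAt Y x.1) :
    horizontal (leviCivita S.sympMetric (lift X) (leviCivita S.sympMetric (lift Y) S.ξt) x)
      = -S.nablaφ x.1 (X x.1) (Y x.1) - S.φ x.1 (S.conn X Y x.1)
        - Real.exp (-2 * x.2) • (S.nablaT x.1 (X x.1) (Y x.1) + S.T x.1 (S.conn X Y x.1))
        + (1 - Real.exp (2 * x.2)) • S.η x.1 (X x.1) • Y x.1
        - (2 * Real.exp (2 * x.2)) • S.η x.1 (Y x.1) • X x.1
        - ((1 - Real.exp (2 * x.2)) / Real.exp (2 * x.2))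
          • S.η x.1 (X x.1) • S.φ x.1 (S.T x.1 (Y x.1))
        - (((1 - Real.exp (2 * x.2)) / Real.exp (2 * x.2))
            * (S.metric x.1 (S.T x.1 (X x.1)) (S.φ x.1 (Y x.1))
              + Real.exp (-2 * x.2) * S.metric x.1 (S.T x.1 (X x.1)) (S.T x.1 (Y x.1)))
          + (1 + Real.exp (2 * x.2)) * (S.η x.1 (X x.1) * S.η x.1 (Y x.1))) • S.ξ x.1 := by
  have hg := S.isRiemannian_sympMetric
  have hc := S.isAlmostContactMetric x.1
  have h0 := S.isFirstOrder x.1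
  have ha := (Real.exp_pos (2 * x.2)).ne'
  have dY := hY.diffAt
  have dφ := S.isTensor_φ dY
  have dT := S.isTensor_T dY
  have hd := hasDerivAt_exp_neg_two_mul x.2
  have hd2 : HasDerivAt (fun t ↦ 2 * Real.exp (2 * t)) _ x.2 :=
    (hasDerivAt_exp_two_mul x.2).const_mul 2
  have e : ∀ᶠ y in 𝓝 x, leviCivita S.sympMetric (lift Y) S.ξt y =
      (-lift (fun q ↦ S.φ q (Y q)) y - Real.exp (-2 * y.2) • lift (fun q ↦ S.T q (Y q)) y)
        - (2 * Real.exp (2 * y.2) * S.η y.1 (Y y.1)) • timeField y := by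
    filter_upwards [continuousAt_fst.eventually hY.eventually_diffAt] with y hy
    rw [S.leviCivita_ξt hy]
    exact tanProd_ext (by simp) (by simp)
  have m1 := mdifferentiableAt_comp_snd (n := n) (M := M) (x := x) hd.differentiableAt
  have m2 := mdifferentiableAt_fun_mul
    (mdifferentiableAt_comp_snd (n := n) (M := M) (x := x) hd2.differentiableAt)
    (mdifferentiableAt_comp_fst (x := x) (S.mdifferentiableAt_η dY))
  have lX := diffAt_lift hX
  have lφ := diffAt_lift dφ
  have lT := (diffAt_lift dT).smul m1
  have lt := (diffAt_timeField x).smul m2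
  have k1 := S.conn_φ hX dY
  have k2 := S.conn_T hX dY
  simp only [conn] at k1 k2
  rw [hg.leviCivita_congr (X := lift X) (EventuallyEq.refl _ _) e, hg.leviCivita_sub lX (lφ.neg.sub lT) lt,
    hg.leviCivita_sub lX lφ.neg lT, hg.leviCivita_neg lX lφ,
    hg.leviCivita_smul lX m1 (diffAt_lift dT), hg.leviCivita_smul lX m2 (diffAt_timeField x),
    dirDeriv_comp_snd _ hd, S.leviCivita_lift hX dφ, S.leviCivita_lift hX dT,
    S.leviCivita_lift_timeField hX]
  simp only [conn, horizontal_sub, horizontal_neg, horizontal_add, horizontal_smul,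
    horizontal_tanMk, horizontal_lift, horizontal_timeField, vertical_lift, k1, k2, hc.η_φ, h0.η_T,
    S.φ_sq, exp_neg_two_mul, metric]
  generalize Real.exp (2 * x.2) = a at *
  match_scalars <;> field_simp <;> ring

/-- The part tangent to `M` of the curvature of the metric symplectization in the direction of
the Reeb vector field. -/
theorem curvature_ξt {p : M} (t : ℝ) (hX : SmoothAt X p) (hY : SmoothAt Y p) :
    horizontal (curvature S.sympMetric (lift X) (lift Y) S.ξt (p, t))
      = -S.nablaφ p (X p) (Y p) + S.nablaφ p (Y p) (X p)
        + (1 / Real.exp (2 * t)) • (-S.nablaT p (X p) (Y p) + S.nablaT p (Y p) (X p))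
        - (1 + Real.exp (2 * t)) • (S.η p (Y p) • X p - S.η p (X p) • Y p)
        - ((1 - Real.exp (2 * t)) / Real.exp (2 * t))
          • S.T p (S.φ p (S.η p (Y p) • X p - S.η p (X p) • Y p)) := by
  have hg := S.isRiemannian_sympMetric
  have hc := S.isAlmostContactMetric p
  have h0 := S.isFirstOrder p
  have ha := (Real.exp_pos (2 * t)).ne'
  have e : bracket (lift X) (lift Y) =ᶠ[𝓝 (p, t)] lift (bracket X Y) := by
    filter_upwards [continuousAt_fst.eventually hX.eventually_diffAt,
      continuousAt_fst.eventually hY.eventually_diffAt] with y hx hy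
    exact bracket_lift hx hy
  have k1 := S.leviCivita_leviCivita_ξt (x := (p, t)) hX.diffAt hY
  have k2 := S.leviCivita_leviCivita_ξt (x := (p, t)) hY.diffAt hX
  have k3 := S.leviCivita_ξt (x := (p, t)) (hX.bracket hY).diffAt
  -- Symmetry of Tφ, needed for the coefficient of ξ to cancel.
  have s1 : S.metric p (S.T p (Y p)) (S.φ p (X p)) = S.metric p (S.T p (X p)) (S.φ p (Y p)) := by
    have a1 := h0.T_symm (Y p) (S.φ p (X p))
    have a2 := h0.skew (S.T p (X p)) (Y p)
    have a3 := hc.symm (Y p) (S.T p (S.φ p (X p)))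
    rw [h0.φ_T] at a2
    simp only [metric, map_neg, neg_apply] at a1 a2 a3 ⊢
    linarith
  have s2 : S.metric p (S.T p (Y p)) (S.T p (X p)) = S.metric p (S.T p (X p)) (S.T p (Y p)) :=
    hc.symm _ _
  unfold curvature
  rw [hg.leviCivita_congr e (EventuallyEq.refl _ S.ξt), k3, horizontal_sub, horizontal_sub, k1, k2,
    horizontal_tanMk, S.bracket_eq hX.diffAt hY.diffAt]
  simp only [s1, s2, exp_neg_two_mul, map_sub, map_smul, h0.φ_T, conn]
  generalize Real.exp (2 * t) = a at *
  match_scalars <;> field_simp <;> ring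

/-- The factors e^{2t} on κ and μ come from η_t; the additional summands are the last two terms of
`curvature_ξt`, moved to the other side. -/
theorem sympNullity_iff (t κ μ : ℝ) : S.SympNullity t κ μ ↔ ∀ p,
    NullityRel (S.η p) (S.φ p) (S.T p) (S.nablaφ p) (S.nablaT p) (1 / Real.exp (2 * t))
      (κ * Real.exp (2 * t) + (1 + Real.exp (2 * t)))
      (μ * Real.exp (2 * t) + (1 - Real.exp (2 * t)) / Real.exp (2 * t)) := by
  have key : ∀ {p : M} {X Y : (x : M) → Tan n M x}, SmoothAt X p → SmoothAt Y p →
      S.h (fun x ↦ S.ηt t x (Y x) • X x - S.ηt t x (X x) • Y x) p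
        = S.T p (S.φ p (S.ηt t p (Y p) • X p - S.ηt t p (X p) • Y p)) := fun hX hY ↦
    S.h_apply ((hX.diffAt.smul (mdifferentiableAt_const.mul (S.mdifferentiableAt_η hY.diffAt))).sub
      (hY.diffAt.smul (mdifferentiableAt_const.mul (S.mdifferentiableAt_η hX.diffAt))))
  constructor
  · intro h p x y
    have h1 : horizontal (curvature S.sympMetric (lift (extend x)) (lift (extend y)) S.ξt (p, t))
      = _ := h p (extend x) (extend y) (smoothAt_extend x) (smoothAt_extend y)
    rw [key (smoothAt_extend x) (smoothAt_extend y),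
      S.curvature_ξt t (smoothAt_extend x) (smoothAt_extend y)] at h1
    simp only [extend_self, ηt] at h1
    rw [sub_sub] at h1
    rw [sub_eq_iff_eq_add.1 h1]
    simp only [mul_smul, ← smul_sub, map_smul]
    module
  · intro h p X Y hX hY
    rw [key hX hY]
    refine (S.curvature_ξt t hX hY).trans ?_
    rw [h p (X p) (Y p)]
    simp only [ηt, mul_smul, ← smul_sub, map_smul]
    module

end Curvature

end ContactMetricStructure

end Symplectization

/-! ### The Nijenhuis tensor of the natural almost complex structure. -/

section Sasakian

variable {n : ℕ} {M : Type*} [TopologicalSpace M] [ChartedSpace (Model n) M]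
  [IsManifold (𝓡 (2 * n + 1)) ∞ M]

open ContactMetricStructure (lift)

/-- The field `U + f ∂ₜ` on `M × ℝ`, for a field `U` and a function `f` on `M`. -/
def prodField (U : (x : M) → Tan n M x) (f : M → ℝ) : (x : M × ℝ) → TanProd n M x := fun x ↦
  tanMk (U x.1) (f x.1)

theorem prodField_eq (U : (x : M) → Tan n M x) (f : M → ℝ) :
    prodField U f = lift U + fun x : M × ℝ ↦ f x.1 • timeField x := by
  funext x
  refine tanProd_ext ?_ ?_
  · change U x.1 = U x.1 + f x.1 • (0 : Tan n M x.1)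
    simp
  · change f x.1 = 0 + f x.1 * 1
    simp

theorem lift_eq_prodField (U : (x : M) → Tan n M x) : lift U = prodField U fun _ ↦ 0 := rfl

theorem timeField_eq_prodField :
    timeField (n := n) (M := M) = prodField (fun _ ↦ 0) fun _ ↦ 1 := rfl

variable {U V : (x : M) → Tan n M x} {f g : M → ℝ} {x : M × ℝ}

theorem bracket_prodField (hU : DiffAt U x.1) (hV : DiffAt V x.1)
    (hf : MDifferentiableAt (𝓡 (2 * n + 1)) 𝓘(ℝ, ℝ) f x.1)
    (hg : MDifferentiableAt (𝓡 (2 * n + 1)) 𝓘(ℝ, ℝ) g x.1) :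
    bracket (prodField U f) (prodField V g) x
      = tanMk (bracket U V x.1) (dirDeriv U g x.1 - dirDeriv V f x.1) := by
  have lU := diffAt_lift hU
  have lV := diffAt_lift hV
  have mf := mdifferentiableAt_comp_fst hf
  have mg := mdifferentiableAt_comp_fst hg
  have lt := diffAt_timeField (n := n) (M := M) x
  have key {W : (x : M) → Tan n M x} {f : M → ℝ} (hW : DiffAt W x.1)
      (hf : MDifferentiableAt (𝓡 (2 * n + 1)) 𝓘(ℝ, ℝ) f x.1) :
      bracket (lift W) (fun x : M × ℝ ↦ f x.1 • timeField x) x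
        = dirDeriv W f x.1 • timeField x := by
    rw [bracket_smul_right (mdifferentiableAt_comp_fst hf) lt, bracket_lift_timeField hW,
      dirDeriv_comp_fst _ hf, smul_zero, add_zero]
    rfl
  have e0 : bracket timeField timeField x = (0 : TanProd n M x) :=
    congrFun VectorField.mlieBracket_self x
  have e1 (f : M → ℝ) (hf : MDifferentiableAt (𝓡 (2 * n + 1)) 𝓘(ℝ, ℝ) f x.1) :
      dirDeriv (timeField (n := n) (M := M)) (fun x : M × ℝ ↦ f x.1) x = 0 := by
    rw [dirDeriv_comp_fst _ hf, horizontal_timeField, map_zero]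
  rw [prodField_eq, prodField_eq, bracket_add_left lU (lt.smul mf),
    bracket_add_right lV (lt.smul mg), bracket_add_right lV (lt.smul mg), bracket_lift hU hV,
    key hU hg, bracket_swap _ (lift V), key hV hf, bracket_smul_left mf lt,
    bracket_smul_right mg lt, e0]
  have e3 : dirDeriv (fun x : M × ℝ ↦ g x.1 • timeField (n := n) (M := M) x) (fun x : M × ℝ ↦ f x.1) x = 0 := by
    rw [dirDeriv_comp_fst _ hf]
    have : horizontal (g x.1 • timeField (n := n) (M := M) x) = 0 := by simp
    rw [this, map_zero]
  rw [e3, e1 g hg]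
  refine tanProd_ext ?_ ?_
  · simp
  · simp
    ring

/-- A tensor on `M × ℝ` which vanishes on fields tangent to `M` and on `∂ₜ` vanishes. -/
theorem tensorialAt_eq_zero {Φ : ((x : M × ℝ) → TanProd n M x) → TanProd n M x}
    (hΦ : TensorialAt ((𝓡 (2 * n + 1)).prod 𝓘(ℝ, ℝ)) (Model n × ℝ) Φ x)
    (h1 : ∀ U : (x : M) → Tan n M x, DiffAt U x.1 → Φ (lift U) = 0)
    (h2 : Φ timeField = 0) {Z : (x : M × ℝ) → TanProd n M x} (hZ : DiffAt Z x) : Φ Z = 0 := by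
  have lt := diffAt_timeField (n := n) (M := M) x
  have d1 := diffAt_lift (x := x) (diffAt_extend (horizontal (Z x)))
  have d2 := lt.const_smul (vertical (Z x))
  have e : Z x = lift (extend (horizontal (Z x))) x + vertical (Z x) • timeField x :=
    tanProd_ext (by simp) (by simp)
  have a2 := hΦ.smul (f := fun _ ↦ vertical (Z x)) mdifferentiableAt_const lt
  rw [hΦ.pointwise hZ (d1.add d2) e, hΦ.add d1 d2, h1 _ (diffAt_extend _), zero_add]
  refine a2.trans ?_
  rw [h2, smul_zero]

namespace ContactMetricStructure

variable (S : ContactMetricStructure n M)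

theorem naturalJ_tanMk (x : M × ℝ) (v : Tan n M x.1) (r : ℝ) :
    S.naturalJ x (tanMk v r) = tanMk (S.φ x.1 v - r • S.ξ x.1) (S.η x.1 v) := rfl

theorem naturalJ_add (x : M × ℝ) (v w : TanProd n M x) :
    S.naturalJ x (v + w) = S.naturalJ x v + S.naturalJ x w := by
  refine tanProd_ext ?_ ?_
  · change S.φ x.1 (horizontal v + horizontal w) - (vertical v + vertical w) • S.ξ x.1
      = (S.φ x.1 (horizontal v) - vertical v • S.ξ x.1)
        + (S.φ x.1 (horizontal w) - vertical w • S.ξ x.1)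
    rw [map_add]
    module
  · exact map_add (S.η x.1) _ _

theorem naturalJ_smul (x : M × ℝ) (c : ℝ) (v : TanProd n M x) :
    S.naturalJ x (c • v) = c • S.naturalJ x v := by
  refine tanProd_ext ?_ ?_
  · change S.φ x.1 (c • horizontal v) - (c * vertical v) • S.ξ x.1
      = c • (S.φ x.1 (horizontal v) - vertical v • S.ξ x.1)
    rw [map_smul]
    module
  · exact map_smul (S.η x.1) _ _

theorem naturalJ_neg (x : M × ℝ) (v : TanProd n M x) : S.naturalJ x (-v) = -S.naturalJ x v := by
  rw [← neg_one_smul ℝ v, naturalJ_smul, neg_one_smul]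

theorem naturalJ_naturalJ (x : M × ℝ) (v : TanProd n M x) :
    S.naturalJ x (S.naturalJ x v) = -v := by
  have hc := S.isAlmostContactMetric x.1
  refine tanProd_ext ?_ ?_
  · change S.φ x.1 (S.φ x.1 (horizontal v) - vertical v • S.ξ x.1)
      - S.η x.1 (horizontal v) • S.ξ x.1 = -horizontal v
    rw [map_sub, map_smul, hc.φ_ξ, S.φ_sq]
    module
  · change S.η x.1 (S.φ x.1 (horizontal v) - vertical v • S.ξ x.1) = -vertical v
    rw [map_sub, map_smul, hc.η_φ, hc.η_ξ]
    simp

theorem diffAt_naturalJ {Z : (x : M × ℝ) → TanProd n M x} {x : M × ℝ} (hZ : DiffAt Z x) :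
    DiffAt (fun y ↦ S.naturalJ y (Z y)) x := by
  have h1 : MDifferentiableAt ((𝓡 (2 * n + 1)).prod 𝓘(ℝ, ℝ)) (𝓡 (2 * n + 1)).tangent
      (fun x : M × ℝ ↦ (⟨x.1, S.φ x.1 (horizontal (Z x))⟩ : TangentBundle (𝓡 (2 * n + 1)) M)) x := by
    apply MDifferentiableAt.clm_bundle_apply (F₁ := Model n) (F₂ := Model n)
    · exact MDifferentiableAt.comp x (S.smooth_φ.mdifferentiableAt (by simp))
        mdifferentiableAt_fst
    · exact hZ.horizontal
  have h2 : ContMDiffAt ((𝓡 (2 * n + 1)).prod 𝓘(ℝ, ℝ)) 𝓘(ℝ, ℝ).tangent ∞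
      (fun x : M × ℝ ↦ (⟨x.2, (0 : ℝ)⟩ : TangentBundle 𝓘(ℝ, ℝ) ℝ)) x :=
    ContMDiffAt.comp x (contMDiffAt_vectorSpace_iff_contDiffAt.2 contDiffAt_const) contMDiffAt_snd
  have h3 : DiffAt (fun y : M × ℝ ↦ (tanMk (S.φ y.1 (horizontal (Z y))) 0 : TanProd n M y)) x :=
    MDifferentiableAt.comp x
      ((contMDiff_equivTangentBundleProd_symm (I := 𝓡 (2 * n + 1)) (I' := 𝓘(ℝ, ℝ))
        (n := ∞)).mdifferentiableAt (by simp))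
      (h1.prodMk (h2.mdifferentiableAt (by simp)))
  have h4 := (h3.sub ((diffAt_lift (S.diffAt_ξ x.1)).smul hZ.vertical)).add
    ((diffAt_timeField x).smul (S.mdifferentiableAt_η_horizontal hZ))
  refine h4.congr (Eventually.of_forall fun y ↦ tanProd_ext ?_ ?_)
  · change S.φ y.1 (horizontal (Z y)) - vertical (Z y) • S.ξ y.1
      = S.φ y.1 (horizontal (Z y)) - vertical (Z y) • S.ξ y.1
        + S.η y.1 (horizontal (Z y)) • (0 : Tan n M y.1)
    simp
  · change S.η y.1 (horizontal (Z y)) = 0 - vertical (Z y) * 0 + S.η y.1 (horizontal (Z y)) * 1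
    simp

theorem nijenhuis_swap (Z W : (x : M × ℝ) → TanProd n M x) (x : M × ℝ) :
    nijenhuis S.naturalJ Z W x = -nijenhuis S.naturalJ W Z x := by
  unfold nijenhuis
  rw [bracket_swap W Z, bracket_swap (fun x ↦ S.naturalJ x (W x)) (fun x ↦ S.naturalJ x (Z x)),
    bracket_swap (fun x ↦ S.naturalJ x (W x)) Z, bracket_swap W (fun x ↦ S.naturalJ x (Z x))]
  simp only [naturalJ_neg]
  abel

/-- With J² = -1 the derivatives of a scalar factor cancel, so it suffices to test lifts and ∂ₜ. -/
theorem tensorialAt_nijenhuis (W : (x : M × ℝ) → TanProd n M x) (x : M × ℝ) :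
    TensorialAt ((𝓡 (2 * n + 1)).prod 𝓘(ℝ, ℝ)) (Model n × ℝ)
      (fun Z ↦ nijenhuis S.naturalJ Z W x) x where
  smul {f Z} hf hZ := by
    have hZ : DiffAt Z x := hZ
    have e : (fun y ↦ S.naturalJ y ((f • Z) y)) = fun y ↦ f y • S.naturalJ y (Z y) := by
      funext y; exact S.naturalJ_smul y (f y) (Z y)
    have b1 : bracket (f • Z) W x = _ := bracket_smul_left hf hZ
    have b2 : bracket (f • Z) (fun y ↦ S.naturalJ y (W y)) x = _ := bracket_smul_left hf hZ
    unfold nijenhuis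
    rw [e, b1, b2, bracket_smul_left hf (S.diffAt_naturalJ hZ),
      bracket_smul_left hf (S.diffAt_naturalJ hZ)]
    simp only [naturalJ_add, naturalJ_neg, naturalJ_smul, naturalJ_naturalJ]
    module
  add {Z Z'} hZ hZ' := by
    have hZ : DiffAt Z x := hZ
    have hZ' : DiffAt Z' x := hZ'
    have e : (fun y ↦ S.naturalJ y ((Z + Z') y))
        = (fun y ↦ S.naturalJ y (Z y)) + fun y ↦ S.naturalJ y (Z' y) := by
      funext y; exact S.naturalJ_add y (Z y) (Z' y)
    unfold nijenhuis
    rw [e, bracket_add_left hZ hZ', bracket_add_left hZ hZ',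
      bracket_add_left (S.diffAt_naturalJ hZ) (S.diffAt_naturalJ hZ'),
      bracket_add_left (S.diffAt_naturalJ hZ) (S.diffAt_naturalJ hZ')]
    simp only [naturalJ_add, naturalJ_naturalJ]
    abel

theorem naturalJ_prodField (U : (x : M) → Tan n M x) (f : M → ℝ) :
    (fun x ↦ S.naturalJ x (prodField U f x))
      = prodField (fun x ↦ S.φ x (U x) - f x • S.ξ x) fun x ↦ S.η x (U x) := rfl

/-- Because J∂ₜ = -ξ, the tangential part is the Lie derivative of φ along ξ, that is 2hA; the ∂ₜ
part vanishes by dη(ξ, ·) = 0. -/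
theorem nijenhuis_lift_timeField {A : (x : M) → Tan n M x} {x : M × ℝ} (hA : DiffAt A x.1) :
    nijenhuis S.naturalJ (lift A) timeField x = tanMk ((2 : ℝ) • S.T x.1 (S.φ x.1 (A x.1))) 0 := by
  have hc := S.isAlmostContactMetric
  have hξ := S.diffAt_ξ x.1
  have dφ := S.isTensor_φ hA
  have m := S.mdifferentiableAt_η hA
  have d0 : DiffAt (fun x : M ↦ (0 : Tan n M x)) x.1 := by
    simpa using! hξ.const_smul 0
  have eA : (fun x ↦ S.naturalJ x (lift A x)) = prodField (fun x ↦ S.φ x (A x)) fun x ↦ S.η x (A x) := by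
    rw [lift_eq_prodField, naturalJ_prodField]
    simp only [zero_smul, sub_zero]
  have eT : (fun x ↦ S.naturalJ x (timeField x)) = prodField (fun x ↦ (-1 : ℝ) • S.ξ x) fun _ ↦ 0 := by
    rw [timeField_eq_prodField, naturalJ_prodField]
    simp
  have b0 : ∀ B : (x : M) → Tan n M x, bracket B (fun x : M ↦ (0 : Tan n M x)) x.1 = 0 := fun B ↦
    congrFun VectorField.mlieBracket_zero_right x.1
  have k1 := S.h_apply hA
  have k2 := S.dOneForm_eq hξ hA
  unfold h at k1
  unfold dOneForm at k2
  unfold nijenhuis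
  rw [eA, eT, bracket_lift_timeField hA, lift_eq_prodField, timeField_eq_prodField,
    bracket_prodField dφ (hξ.const_smul _) m mdifferentiableAt_const,
    bracket_prodField dφ d0 m mdifferentiableAt_const,
    bracket_prodField hA (hξ.const_smul _) mdifferentiableAt_const mdifferentiableAt_const,
    bracket_smul_right mdifferentiableAt_const hξ, bracket_smul_right mdifferentiableAt_const hξ,
    b0]
  have k3 : dirDeriv S.ξ (fun x ↦ S.η x (A x)) x.1 = S.η x.1 (bracket S.ξ A x.1) := by
    have e : S.metric x.1 (S.ξ x.1) (S.φ x.1 (A x.1)) = 0 :=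
      ((hc x.1).ξ_g _).trans ((hc x.1).η_φ _)
    simp only [S.η_ξ, dirDeriv_const] at k2
    rw [e] at k2
    linarith
  have k4 : dirDeriv (fun x ↦ (-1 : ℝ) • S.ξ x) (fun x ↦ S.η x (A x)) x.1
      = -S.η x.1 (bracket S.ξ A x.1) := by
    rw [← k3, dirDeriv, dirDeriv, map_smul]
    simp
  have k5 (f : M → ℝ) : dirDeriv (fun x : M ↦ (0 : Tan n M x)) f x.1 = 0 := map_zero _
  rw [bracket_swap _ S.ξ, bracket_swap A S.ξ, naturalJ_naturalJ, k4, k5, ← k1]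
  simp only [dirDeriv_const, naturalJ_tanMk]
  refine tanProd_ext ?_ ?_
  · simp
  · simp

/-- Torsion-freeness turns the brackets into covariant derivatives. With the given ∇φ the tangential
part reduces to the identity for dη(A,B), multiplied by ξ; the ∂ₜ part is dη(φA,B) + dη(A,φB) = 0.
-/
theorem nijenhuis_lift_lift {A B : (x : M) → Tan n M x} {x : M × ℝ} (hA : DiffAt A x.1)
    (hB : DiffAt B x.1)
    (hF : ∀ u v, S.nablaφ x.1 u v = S.metric x.1 u v • S.ξ x.1 - S.η x.1 v • u) :
    nijenhuis S.naturalJ (lift A) (lift B) x = 0 := by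
  have hc := S.isAlmostContactMetric
  have dA := S.isTensor_φ hA
  have dB := S.isTensor_φ hB
  have mA := S.mdifferentiableAt_η hA
  have mB := S.mdifferentiableAt_η hB
  have eJ (A : (x : M) → Tan n M x) : (fun x ↦ S.naturalJ x (lift A x))
      = prodField (fun x ↦ S.φ x (A x)) fun x ↦ S.η x (A x) := by
    rw [lift_eq_prodField, naturalJ_prodField]
    simp only [zero_smul, sub_zero]
  have d1 := S.dOneForm_eq hA hB
  have d2 := S.dOneForm_eq dA hB
  have d3 := S.dOneForm_eq hA dB
  have s1 := (hc x.1).skew (A x.1) (S.φ x.1 (B x.1))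
  have s2 := (hc x.1).skew (A x.1) (B x.1)
  have s3 := (hc x.1).symm (S.φ x.1 (B x.1)) (A x.1)
  unfold dOneForm at d1 d2 d3
  simp only [(hc _).η_φ, dirDeriv_const, metric] at d1 d2 d3
  unfold nijenhuis
  rw [eJ, eJ, naturalJ_naturalJ, lift_eq_prodField, lift_eq_prodField,
    bracket_prodField dA dB mA mB, bracket_prodField hA hB mdifferentiableAt_const
    mdifferentiableAt_const, bracket_prodField dA hB mA mdifferentiableAt_const,
    bracket_prodField hA dB mdifferentiableAt_const mB]
  have b0 := S.bracket_eq hA hB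
  have b1 := S.bracket_eq dA dB
  have b2 := S.bracket_eq dA hB
  have b3 := S.bracket_eq hA dB
  rw [S.conn_φ dA hB, S.conn_φ dB hA] at b1
  rw [S.conn_φ hB hA] at b2
  rw [S.conn_φ hA hB] at b3
  simp only [dirDeriv_const, naturalJ_tanMk]
  refine tanProd_ext ?_ ?_
  · have d1' := congrArg (fun r : ℝ ↦ (2 * r) • S.ξ x.1) d1
    have e : S.g.inner x.1 (S.φ x.1 (A x.1)) (B x.1) = -S.g.inner x.1 (A x.1) (S.φ x.1 (B x.1)) := s2
    simp only [horizontal_sub, horizontal_add, horizontal_neg, horizontal_tanMk, horizontal_zero]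
    rw [b1, b2, b3]
    simp only [map_add, map_sub, S.φ_sq, hF, map_smul, (hc _).φ_ξ, metric, e, s3]
    rw [b0] at d1' ⊢
    simp only [map_sub] at d1'
    rw [← sub_eq_zero] at d1'
    refine Eq.trans ?_ d1'
    module
  · simp only [vertical_sub, vertical_add, vertical_neg, vertical_tanMk, vertical_zero]
    linarith

/-- The structure is Sasakian if `(∇_X φ) Y = g(X, Y) ξ - η(Y) X` and `h = 0`. -/
theorem isSasakian_of_nablaφ (hT : ∀ p, S.T p = 0)
    (hF : ∀ p u v, S.nablaφ p u v = S.metric p u v • S.ξ p - S.η p v • u) : S.IsSasakian := by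
  intro x Z W hZ hW
  have h1 : ∀ A : (x : M) → Tan n M x, DiffAt A x.1 →
      nijenhuis S.naturalJ (lift A) timeField x = 0 := by
    intro A hA
    rw [S.nijenhuis_lift_timeField hA, hT]
    exact tanProd_ext (smul_zero _) rfl
  have h2 : nijenhuis S.naturalJ timeField timeField x = 0 := by
    have h := S.nijenhuis_swap timeField timeField x
    have h' : (2 : ℝ) • nijenhuis S.naturalJ timeField timeField x = 0 := by
      rw [two_smul]
      nth_rewrite 1 [h]
      exact neg_add_cancel _
    exact (smul_eq_zero.1 h').resolve_left two_ne_zero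
  have h3 : ∀ {Z : (x : M × ℝ) → TanProd n M x}, DiffAt Z x →
      nijenhuis S.naturalJ Z timeField x = 0 := fun hZ ↦
    tensorialAt_eq_zero (S.tensorialAt_nijenhuis timeField x) h1 h2 hZ
  have h4 : ∀ A : (x : M) → Tan n M x, DiffAt A x.1 → ∀ {Z : (x : M × ℝ) → TanProd n M x},
      DiffAt Z x → nijenhuis S.naturalJ Z (lift A) x = 0 := fun A hA Z hZ ↦
    tensorialAt_eq_zero (S.tensorialAt_nijenhuis (lift A) x)
      (fun B hB ↦ S.nijenhuis_lift_lift hB hA (hF x.1))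
      (by rw [S.nijenhuis_swap, h1 A hA, neg_zero]) hZ
  exact tensorialAt_eq_zero (S.tensorialAt_nijenhuis W x)
    (fun B hB ↦ by rw [S.nijenhuis_swap, h4 B hB hW.diffAt, neg_zero])
    (by rw [S.nijenhuis_swap, h3 hW.diffAt, neg_zero]) hZ.diffAt

/-- On a Sasakian manifold `h = 0`. -/
theorem IsSasakian.T_eq_zero {S : ContactMetricStructure n M} (hS : S.IsSasakian) (p : M) :
    S.T p = 0 := by
  have hφ : ∀ v : Tan n M p, S.T p (S.φ p v) = 0 := by
    intro v
    have h1 := S.nijenhuis_lift_timeField (x := (p, 0)) (diffAt_extend v)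
    rw [hS (p, 0) _ _ (smoothAt_lift (smoothAt_extend v)) (smoothAt_timeField _)] at h1
    have h2 := congrArg horizontal h1
    simp only [horizontal_zero, horizontal_tanMk, extend_self] at h2
    exact (smul_eq_zero.1 h2.symm).resolve_left two_ne_zero
  ext v
  -- Modulo ξ, which T kills, every vector lies in the image of φ.
  have h1 := hφ (S.φ p v)
  rw [S.φ_sq, map_add, map_smul, S.T_ξ, smul_zero, add_zero, map_neg, neg_eq_zero] at h1
  rw [h1]
  rfl

end ContactMetricStructure

end Sasakian

/-! ### Changing the constants and recognizing the Sasakian case. -/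

section Contact

variable {n : ℕ} {M : Type*} [TopologicalSpace M] [ChartedSpace (Model n) M]
  [IsManifold (𝓡 (2 * n + 1)) ∞ M]

namespace ContactMetricStructure

variable (S : ContactMetricStructure n M)

/-- The common form of the nullity conditions on `M` and on its metric symplectization. -/
def Rel (c α β : ℝ) : Prop :=
  ∀ p, NullityRel (S.η p) (S.φ p) (S.T p) (S.nablaφ p) (S.nablaT p) c α β

variable {S} {c α β : ℝ}

theorem Rel.nablaT_eq_zero (hR : S.Rel c α β) (hc : c ≠ 0) (hα : α = 1) (p : M) :
    S.nablaT p = 0 := by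
  subst hα
  exact S.nablaT_eq_zero (fun q ↦ (S.isSecondOrder q).T_eq_zero (hR q) hc) p

theorem Rel.change (hR : S.Rel c α β) (hc : c ≠ 0) (c' : ℝ) :
    S.Rel c' (1 + c' / c * (α - 1)) (1 + c' / c * (β - 1)) := fun p ↦
  (S.isSecondOrder p).nullityRel_change (hR p) hc (fun hα _ ↦ hR.nablaT_eq_zero hc hα p) c'

/-- Otherwise η would embed a space of dimension 2n + 1 ≥ 3 in ℝ. -/
theorem exists_horizontal (hn : 1 ≤ n) (p : M) : ∃ v : Tan n M p, v ≠ 0 ∧ S.η p v = 0 := by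
  by_contra! h
  have h1 : Function.Injective (S.η p : Tan n M p →ₗ[ℝ] ℝ) := by
    rw [injective_iff_map_eq_zero]
    intro v hv
    by_contra hne
    exact h v hne hv
  have : FiniteDimensional ℝ (Tan n M p) := inferInstanceAs (FiniteDimensional ℝ (Model n))
  have h2 := LinearMap.finrank_le_finrank_of_injective h1
  have h3 : Module.finrank ℝ (Tan n M p) = 2 * n + 1 :=
    finrank_euclideanSpace_fin (𝕜 := ℝ) (n := 2 * n + 1)
  rw [h3, Module.finrank_self] at h2
  omega

/-- A Sasakian structure has T = 0, so cT² = 1 - α on a nonzero horizontal vector gives α = 1.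
Conversely α = 1 gives T = 0, and `F_eq` becomes the Sasakian formula for ∇φ. -/
theorem Rel.isSasakian_iff [Nonempty M] (hn : 1 ≤ n) (hR : S.Rel c α β) (hc : c ≠ 0) :
    S.IsSasakian ↔ α = 1 := by
  constructor
  · intro hS
    obtain ⟨p⟩ := ‹Nonempty M›
    obtain ⟨v, hv, hv'⟩ := S.exists_horizontal hn p
    have h1 := (S.isSecondOrder p).T_sq_eq (hR p) hv'
    rw [hS.T_eq_zero p] at h1
    have h2 : (1 - α) • v = 0 := by
      rw [← h1]
      exact smul_zero c
    linarith [(smul_eq_zero.1 h2).resolve_right hv]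
  · intro hα
    have hT : ∀ p, S.T p = 0 := fun q ↦ by
      subst hα
      exact (S.isSecondOrder q).T_eq_zero (hR q) hc
    refine S.isSasakian_of_nablaφ hT fun p u v ↦ ?_
    have h1 := (S.isSecondOrder p).F_eq (hR p) hc (fun hα _ ↦ hR.nablaT_eq_zero hc hα p) u v
    rw [h1, hT, zero_apply, add_zero]

theorem Nullity.rel {κ μ : ℝ} (h : S.Nullity κ μ) : S.Rel 1 κ μ := (S.nullity_iff κ μ).1 h

theorem Rel.isKappaMu (hR : S.Rel c α β) (hc : c ≠ 0) : S.IsKappaMu :=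
  ⟨_, _, (S.nullity_iff _ _).2 (hR.change hc 1)⟩

theorem SympNullity.rel {t κ μ : ℝ} (h : S.SympNullity t κ μ) :
    S.Rel (1 / Real.exp (2 * t)) (κ * Real.exp (2 * t) + (1 + Real.exp (2 * t)))
      (μ * Real.exp (2 * t) + (1 - Real.exp (2 * t)) / Real.exp (2 * t)) :=
  (S.sympNullity_iff t κ μ).1 h

theorem coeff_eq_one_iff (t κ : ℝ) :
    κ * Real.exp (2 * t) + (1 + Real.exp (2 * t)) = 1 ↔ κ = -1 := by
  have ha := (Real.exp_pos (2 * t)).ne'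
  constructor
  · intro h
    have h1 : (κ + 1) * Real.exp (2 * t) = 0 := by linarith
    linarith [(mul_eq_zero.1 h1).resolve_right ha]
  · rintro rfl
    ring

theorem Rel.exists_sympNullity (hR : S.Rel c α β) (hc : c ≠ 0) (t : ℝ) :
    ∃ κ μ : ℝ, (α ≠ 1 → κ ≠ -1) ∧ S.SympNullity t κ μ := by
  have ha := (Real.exp_pos (2 * t)).ne'
  have h1 := hR.change hc (1 / Real.exp (2 * t))
  have e {r s : ℝ} : (r - s) / Real.exp (2 * t) * Real.exp (2 * t) + s = r := by
    field_simp
    ring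
  -- The constants solve the affine equations of `sympNullity_iff` for the coefficients that
  -- `Rel.change` supplies at c' = e^{-2t}.
  refine ⟨(1 + 1 / Real.exp (2 * t) / c * (α - 1) - (1 + Real.exp (2 * t))) / Real.exp (2 * t),
    (1 + 1 / Real.exp (2 * t) / c * (β - 1) - (1 - Real.exp (2 * t)) / Real.exp (2 * t))
      / Real.exp (2 * t), ?_, ?_⟩
  · intro hα
    rw [ne_eq, ← coeff_eq_one_iff t, e, add_eq_left]
    exact mul_ne_zero (div_ne_zero (one_div_ne_zero ha) hc) (sub_ne_zero.2 hα)
  · rw [S.sympNullity_iff, e, e]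
    exact h1

end ContactMetricStructure

end Contact

end ContactMetric

end

theorem theorem1p3 {n : ℕ} (hn : 1 ≤ n)
    {M : Type*} [TopologicalSpace M] [T2Space M] [SecondCountableTopology M] [Nonempty M]
    [ChartedSpace (ContactMetric.Model n) M] [IsManifold (𝓡 (2 * n + 1)) ∞ M]
    (S : ContactMetric.ContactMetricStructure n M) :
    (S.IsKappaMu ↔ ∃ t κ' μ' : ℝ, S.SympNullity t κ' μ') ∧
    ((¬ S.IsSasakian ∧ S.IsKappaMu) ↔
      ∃ t κ' μ' : ℝ, κ' ≠ -1 ∧ S.SympNullity t κ' μ') ∧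
    (∀ t κ' μ' : ℝ, S.SympNullity t κ' μ' →
      ∀ s : ℝ, ∃ κ'' μ'' : ℝ, (κ' ≠ -1 → κ'' ≠ -1) ∧ S.SympNullity s κ'' μ'') := by
  have hc (t : ℝ) : 1 / Real.exp (2 * t) ≠ 0 := one_div_ne_zero (Real.exp_pos _).ne'
  refine ⟨⟨?_, ?_⟩, ⟨?_, ?_⟩, ?_⟩
  · rintro ⟨κ, μ, h⟩
    -- The slice t = 0 is an arbitrary choice; any other would serve.
    obtain ⟨κ', μ', -, h'⟩ := h.rel.exists_sympNullity one_ne_zero 0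
    exact ⟨0, κ', μ', h'⟩
  · rintro ⟨t, κ', μ', h⟩
    exact h.rel.isKappaMu (hc t)
  · rintro ⟨hS, κ, μ, h⟩
    obtain ⟨κ', μ', hκ, h'⟩ := h.rel.exists_sympNullity one_ne_zero 0
    exact ⟨0, κ', μ', hκ fun hα ↦ hS ((h.rel.isSasakian_iff hn one_ne_zero).2 hα), h'⟩
  · rintro ⟨t, κ', μ', hκ, h⟩
    refine ⟨fun hS ↦ hκ ?_, h.rel.isKappaMu (hc t)⟩
    exact (ContactMetric.ContactMetricStructure.coeff_eq_one_iff t κ').1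
      ((h.rel.isSasakian_iff hn (hc t)).1 hS)
  · intro t κ' μ' h s
    obtain ⟨κ'', μ'', hκ, h'⟩ := h.rel.exists_sympNullity (hc t) s
    refine ⟨κ'', μ'', fun hne ↦ hκ fun hα ↦ hne ?_, h'⟩
    exact (ContactMetric.ContactMetricStructure.coeff_eq_one_iff t κ').1 hα
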